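/- Theorem 2.3 (with the generalized denominator identity (2.14)). Let $\mathcal A$ be a countable abelian group with a coloring map $\theta:\mathcal A\times\mathcal A\to\mathbb C^\times$, i.e. $\theta$ is bimultiplicative and $\theta(a,b)\theta(b,a)=1$, and put $\psi(a)=\theta(a,a)\in\{\pm1\}$. Let $\Gamma$ be a countable abelian semigroup such that every element of $\Gamma\times\mathcal A$ can be written as a sum of elements of $\Gamma\times\mathcal A$ in only finitely many ways (a way being a finite multiset of summands). Let $\mathfrak L=\bigoplus_{(\alpha,a)\in\Gamma\times\mathcal A}\mathfrak L_{(\alpha,a)}$ be a $(\Gamma\times\mathcal A)$-graded $\theta$-colored Lie superalgebra over $\mathbb C$ with $\dim\mathfrak L_{(\alpha,a)}<\infty$ for all $(\alpha,a)$: the bracket is bilinear and, for $x\in\mathfrak L_{(\alpha,a)}$, $y\in\mathfrak L_{(\beta,b)}$, $z\in\mathfrak L$, $$[x,y]\in\mathfrak L_{(\alpha+\beta,a+b)},\qquad [x,y]=-\theta(a,b)[y,x],\qquad [x,[y,z]]=[[x,y],z]+\theta(a,b)[y,[x,z]].$$ Let a group $G$ act linearly on $\mathfrak L$ by Lie superalgebra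 automorphisms preserving the $(\Gamma\times\mathcal A)$-gradation. Let $C_k(\mathfrak L)$ be the $k$-th graded component of the $\theta$-exterior algebra of $\mathfrak L$, i.e. of the tensor algebra modulo the relations $x\wedge y=-\theta(a,b)\,y\wedge x$ ($x$ of color $a$, $y$ of color $b$); thus $C_k(\mathfrak L)=\bigoplus_{p+q=k}\Lambda^p(\mathfrak L_0)\otimes S^q(\mathfrak L_1)$, where $\mathfrak L_0$ (resp. $\mathfrak L_1$) is the sum of the $\mathfrak L_{(\alpha,a)}$ with $\psi(a)=1$ (resp. $-1$) and $\Lambda$, $S$ are formed with the commutation factors $\theta$. For $x_s$ homogeneous of color $a_s$ let $$d(x_1\wedge\cdots\wedge x_k)=\sum_{1\le s<t\le k}(-1)^s\,\theta(a_s,a_{s+1}+\cdots+a_{t-1})\;x_1\wedge\cdots\widehat{x_s}\cdots\wedge x_{t-1}\wedge[x_s,x_t]\wedge x_{t+1}\wedge\cdots\wedge x_k .$$ Then $d^2=0$; let $H_k(\mathfrak L)$ be the homology of $(C_\bullet(\mathfrak L),d)$. The spaces $C_k(\mathfrak L)$, $H_k(\mathfrak L)$ are graded by $M=(\Gamma\times\mathcal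 A)\cup\{0\}$ (a zero is adjoined; $C_0(\mathfrak L)=\mathbb C$ has degree $0$), and $G$ acts on their homogeneous components. In the completed semigroup algebra of $M$, with basis elements $e^m$, put $E^{(\alpha,a)}=\psi(a)e^{(\alpha,a)}$ and $E^0=1$. For a $G$-stable homogeneous component put $\mathrm{str}(g|V_{(\alpha,a)})=\psi(a)\,\mathrm{tr}(g|V_{(\alpha,a)})$ and $\mathrm{str}(g|V_0)=\mathrm{tr}(g|V_0)$, and let $\mathrm{sch}_gV=\sum_{m\in M}\mathrm{str}(g|V_m)E^m$. Further let $$\mathrm{str}(g|H(\mathfrak L)_m)=\sum_{k\ge1}(-1)^{k+1}\mathrm{str}(g|H_k(\mathfrak L)_m),\qquad \mathrm{sch}_gH(\mathfrak L)=\sum_{m}\mathrm{str}(g|H(\mathfrak L)_m)E^m .$$ For $(\tau,b)\in\Gamma\times\mathcal A$ let $T_g(\tau,b)$ be the (finite) set of finitely supported families $s=(s_i)$ of nonnegative integers, indexed by those $i\in\Gamma\times\mathcal A$ with $\mathrm{str}(g|H(\mathfrak L)_i)\ne0$, such that $\sum_i s_i\, i=(\tau,b)$, and define the Witt partition function $$W_g(\tau,b)=\sum_{s\in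 T_g(\tau,b)}\frac{(|s|-1)!}{s!}\prod_i\mathrm{str}(g|H(\mathfrak L)_i)^{s_i},\qquad |s|=\sum_i s_i,\quad s!=\prod_i s_i!.$$ Then the following hold. (1) Every $C_k(\mathfrak L)_m$ is finite-dimensional and, for each $m\in M$, is zero for all but finitely many $k$; and for all $g\in G$ the Euler–Poincaré principle $$\sum_{k\ge0}(-1)^k\,\mathrm{sch}_gC_k(\mathfrak L)=\sum_{k\ge0}(-1)^k\,\mathrm{sch}_gH_k(\mathfrak L)$$ holds. (2) (Generalized denominator identity.) For all $g\in G$, the formal infinite product below converges (each coefficient of the finite partial products is eventually constant) and $$\prod_{(\alpha,a)\in\Gamma\times\mathcal A}\exp\Bigl(-\sum_{r=1}^\infty\frac1r\,\mathrm{str}(g^r|\mathfrak L_{(\alpha,a)})\,E^{r(\alpha,a)}\Bigr)=1-\mathrm{sch}_gH(\mathfrak L).$$ (3) (Supertrace formula.) For all $g\in G$ and $(\alpha,a)\in\Gamma\times\mathcal A$, $$\mathrm{str}(g|\mathfrak L_{(\alpha,a)})=\sum_{\substack{d>0\\(\alpha,a)=d(\tau,b)}}\frac1d\,\mu(d)\,W_{g^d}(\tau,b),$$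 where the (finite) sum runs over all pairs of a positive integer $d$ and an element $(\tau,b)\in\Gamma\times\mathcal A$ with $d(\tau,b)=(\alpha,a)$, and $\mu$ is the Möbius function. -/

import Mathlib

noncomputable section

/-! ### Formal series over a semigroup with finitely many decompositions -/

/-- Every element of the abelian semigroup `S` can be written as a sum of elements of `S` in only
finitely many ways.  A way of writing `x` as a sum is a finite multiset of elements of `S` with sum
`x`; the sum is computed in the monoid `WithZero S`, which is `S` with a zero adjoined. -/
class FinitelyManySums (S : Type*) [AddCommSemigroup S] : Prop where
  finite_sums : ∀ x : S,
    {s : Multiset S | (s.map (fun y : S => (y : WithZero S))).sum = (x : WithZero S)}.Finite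

namespace FinitelyManySums

variable {S : Type*} [AddCommSemigroup S]

theorem sum_ne_zero (s : Multiset S) (hs : s ≠ 0) :
    (s.map (fun y : S => (y : WithZero S))).sum ≠ 0 := by
  induction s using Multiset.induction_on with
  | empty => exact absurd rfl hs
  | cons a s _ =>
    rw [Multiset.map_cons, Multiset.sum_cons]
    cases h : (s.map (fun y : S => (y : WithZero S))).sum with
    | zero => simp
    | coe b => exact WithZero.coe_ne_zero (a := a + b)

theorem finite_sums' [FinitelyManySums S] (m : WithZero S) :
    {s : Multiset S | (s.map (fun y : S => (y : WithZero S))).sum = m}.Finite := by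
  cases m with
  | zero =>
    refine (Set.finite_singleton (0 : Multiset S)).subset fun s hs => ?_
    by_contra h
    exact sum_ne_zero s h hs
  | coe x => exact finite_sums x

theorem finite_pairs [FinitelyManySums S] (m : WithZero S) :
    {p : WithZero S × WithZero S | p.1 + p.2 = m}.Finite := by
  let tm : WithZero S → Multiset S := fun w => WithZero.recZeroCoe 0 (fun y => {y}) w
  have htm : ∀ w, ((tm w).map (fun y : S => (y : WithZero S))).sum = w := by
    intro w; cases w <;> simp [tm]
  let F : Set (WithZero S) :=
    {0} ∪ ⋃ s ∈ {s : Multiset S | (s.map (fun y : S => (y : WithZero S))).sum = m},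
      {w | w ∈ s.map (fun y : S => (y : WithZero S))}
  have hF : F.Finite := by
    refine (Set.finite_singleton _).union ((finite_sums' m).biUnion fun s _ => ?_)
    exact Multiset.finite_toSet _
  refine (hF.prod hF).subset ?_
  rintro ⟨a, b⟩ hab
  have hs : ((tm a + tm b).map (fun y : S => (y : WithZero S))).sum = m := by
    rw [Multiset.map_add, Multiset.sum_add, htm, htm]; exact hab
  have key : ∀ w, tm w ≤ tm a + tm b → w ∈ F := by
    intro w hw
    cases w with
    | zero => exact Or.inl rfl
    | coe x =>
      refine Or.inr (Set.mem_biUnion (x := tm a + tm b) hs ?_)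
      refine Multiset.mem_map_of_mem _ (Multiset.mem_of_le hw ?_)
      simp [tm]
  exact ⟨key a (Multiset.le_add_right _ _), key b (Multiset.le_add_left _ _)⟩

/-- The finite set of pairs with sum `m`. -/
def pairs [FinitelyManySums S] (m : WithZero S) : Finset (WithZero S × WithZero S) :=
  (finite_pairs m).toFinset

theorem mem_pairs [FinitelyManySums S] {m : WithZero S} {p : WithZero S × WithZero S} :
    p ∈ pairs m ↔ p.1 + p.2 = m := by
  simp [pairs]

end FinitelyManySums

/-- Formal (infinite) series `∑ c_m e^m`, `m` running over `S` and the adjoined zero: the completion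
of the algebra of the monoid `WithZero S`.  The series is given by its coefficients `m ↦ c_m`. -/
def FormalSeries (S : Type*) : Type _ := WithZero S → ℂ

namespace FormalSeries

variable {S : Type*}

instance : AddCommGroup (FormalSeries S) := inferInstanceAs (AddCommGroup (WithZero S → ℂ))
instance : Module ℂ (FormalSeries S) := inferInstanceAs (Module ℂ (WithZero S → ℂ))

@[ext] theorem ext' {f g : FormalSeries S} (h : ∀ m, f m = g m) : f = g := funext h

open scoped Classical in
/-- The basis element `e^m`. -/
def e (m : WithZero S) : FormalSeries S := fun n => if n = m then 1 else 0

/-- The sum of a family of series whose coefficients are, in each degree, finite sums. -/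
def formalSum {J : Type*} (f : J → FormalSeries S) : FormalSeries S := fun m => ∑ᶠ j, f j m

theorem add_apply (f g : FormalSeries S) (m : WithZero S) : (f + g) m = f m + g m := rfl

variable [AddCommSemigroup S] [FinitelyManySums S]

open FinitelyManySums

/-- Multiplication determined by `e^a e^b = e^(a+b)`. -/
instance : Mul (FormalSeries S) := ⟨fun f g m => ∑ p ∈ pairs m, f p.1 * g p.2⟩

instance : One (FormalSeries S) := ⟨e 0⟩

theorem mul_apply (f g : FormalSeries S) (m : WithZero S) :
    (f * g) m = ∑ p ∈ pairs m, f p.1 * g p.2 := rfl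

protected theorem mul_comm' (f g : FormalSeries S) : f * g = g * f := by
  ext m
  rw [mul_apply, mul_apply]
  refine Finset.sum_nbij' Prod.swap Prod.swap ?_ ?_ ?_ ?_ ?_
  · intro p hp; rw [mem_pairs] at hp ⊢; simpa [add_comm] using hp
  · intro p hp; rw [mem_pairs] at hp ⊢; simpa [add_comm] using hp
  · intro p _; rfl
  · intro p _; rfl
  · intro p _; simp [mul_comm]

protected theorem one_mul' (f : FormalSeries S) : 1 * f = f := by
  ext m
  rw [mul_apply, Finset.sum_eq_single (0, m)]
  · change e 0 0 * f m = f m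
    simp [e]
  · rintro ⟨a, b⟩ hp hne
    rw [mem_pairs] at hp
    change e 0 a * f b = 0
    by_cases ha : a = 0
    · subst ha; simp at hp; subst hp; exact absurd rfl hne
    · simp [e, ha]
  · intro h; exact absurd (mem_pairs.2 (zero_add m)) h

protected theorem mul_assoc' (f g h : FormalSeries S) : f * g * h = f * (g * h) := by
  ext m
  simp only [mul_apply, Finset.sum_mul, Finset.mul_sum, Finset.sum_sigma']
  refine Finset.sum_nbij' (fun p => ⟨(p.2.1, p.2.2 + p.1.2), (p.2.2, p.1.2)⟩)
    (fun p => ⟨(p.1.1 + p.2.1, p.2.2), (p.1.1, p.2.1)⟩) ?_ ?_ ?_ ?_ ?_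
  · rintro ⟨⟨a, b⟩, ⟨c, d⟩⟩ hp
    simp only [Finset.mem_sigma, mem_pairs] at hp ⊢
    simp [← hp.1, ← hp.2, add_assoc]
  · rintro ⟨⟨a, b⟩, ⟨c, d⟩⟩ hp
    simp only [Finset.mem_sigma, mem_pairs] at hp ⊢
    simp [← hp.1, ← hp.2, add_assoc]
  · rintro ⟨⟨a, b⟩, ⟨c, d⟩⟩ hp
    simp only [Finset.mem_sigma, mem_pairs] at hp
    obtain ⟨_, rfl⟩ := hp
    rfl
  · rintro ⟨⟨a, b⟩, ⟨c, d⟩⟩ hp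
    simp only [Finset.mem_sigma, mem_pairs] at hp
    obtain ⟨_, rfl⟩ := hp
    rfl
  · rintro ⟨⟨a, b⟩, ⟨c, d⟩⟩ _
    simp [mul_assoc]

protected theorem mul_add' (f g h : FormalSeries S) : f * (g + h) = f * g + f * h := by
  ext m
  simp only [mul_apply, add_apply, mul_add, Finset.sum_add_distrib]

instance : CommRing (FormalSeries S) where
  __ := (inferInstance : AddCommGroup (FormalSeries S))
  mul := (· * ·)
  one := 1
  mul_assoc := FormalSeries.mul_assoc'
  mul_comm := FormalSeries.mul_comm'
  one_mul := FormalSeries.one_mul'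
  mul_one f := by rw [FormalSeries.mul_comm', FormalSeries.one_mul']
  left_distrib := FormalSeries.mul_add'
  right_distrib f g h := by
    rw [FormalSeries.mul_comm', FormalSeries.mul_add', FormalSeries.mul_comm' h f,
      FormalSeries.mul_comm' h g]
  zero_mul f := by
    ext m
    exact Finset.sum_eq_zero fun p _ => zero_mul (f p.2)
  mul_zero f := by
    ext m
    exact Finset.sum_eq_zero fun p _ => mul_zero (f p.1)

theorem e_mul_e (a b : WithZero S) : (e a * e b : FormalSeries S) = e (a + b) := by
  ext m
  rw [mul_apply]
  by_cases h : m = a + b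
  · subst h
    rw [Finset.sum_eq_single (a, b)]
    · simp [e]
    · rintro ⟨c, d⟩ _ hne
      by_cases h1 : c = a
      · by_cases h2 : d = b
        · exact absurd (by rw [h1, h2]) hne
        · simp [e, h2]
      · simp [e, h1]
    · intro h; exact absurd (mem_pairs.2 rfl) h
  · rw [Finset.sum_eq_zero]
    · simp [e, h]
    · rintro ⟨c, d⟩ hp
      rw [mem_pairs] at hp
      by_cases h1 : c = a
      · by_cases h2 : d = b
        · subst h1 h2; exact absurd hp.symm h
        · simp [e, h2]
      · simp [e, h1]

/-- The exponential `∑ fⁿ / n!` of a series `f` without constant term. -/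
def exp (f : FormalSeries S) : FormalSeries S :=
  formalSum fun n : ℕ => ((n.factorial : ℂ)⁻¹) • f ^ n

/-- The formal infinite product `∏ f_j` converges to `F`: each coefficient of the finite partial
products is eventually equal to the coefficient of `F`. -/
def HasFormalProd {J : Type*} (f : J → FormalSeries S) (F : FormalSeries S) : Prop :=
  ∀ m : WithZero S, ∀ᶠ s : Finset J in Filter.atTop, (∏ j ∈ s, f j) m = F m

end FormalSeries

/-! ### Coloring maps and graded `θ`-colored Lie superalgebras -/

/-- A coloring map `θ : A × A → ℂˣ` on the abelian group `A`. -/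
structure ColoringMap (A : Type*) [AddCommGroup A] where
  /-- the underlying map -/
  toFun : A → A → ℂˣ
  map_add_left : ∀ a b c, toFun (a + b) c = toFun a c * toFun b c
  map_add_right : ∀ a b c, toFun a (b + c) = toFun a b * toFun a c
  mul_swap : ∀ a b, toFun a b * toFun b a = 1

instance {A : Type*} [AddCommGroup A] : CoeFun (ColoringMap A) (fun _ => A → A → ℂˣ) :=
  ⟨ColoringMap.toFun⟩

namespace ColoringMap

variable {A : Type*} [AddCommGroup A] (θ : ColoringMap A)

/-- The sign map `ψ(a) = θ(a,a)`; it takes the values `±1`. -/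
def sign (a : A) : ℂ := (θ a a : ℂ)

theorem mul_swap_coe (a b : A) : (θ a b : ℂ) * (θ b a : ℂ) = 1 := by
  rw [← Units.val_mul, θ.mul_swap]; rfl

theorem sign_eq (a : A) : θ.sign a = 1 ∨ θ.sign a = -1 :=
  mul_self_eq_one_iff.1 (θ.mul_swap_coe a a)

variable {Γ : Type*}

/-- The sign of a degree in `Γ × A`, with the sign `1` for the adjoined zero degree. -/
def degSign (m : WithZero (Γ × A)) : ℂ := WithZero.recZeroCoe 1 (fun i => θ.sign i.2) m

/-- The basis elements `E^(α,a) = ψ(a) e^(α,a)`, and `E^0 = e^0 = 1`. -/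
def E (m : WithZero (Γ × A)) : FormalSeries (Γ × A) := θ.degSign m • FormalSeries.e m

end ColoringMap

open scoped Classical in
/-- A `θ`-colored Lie superalgebra structure on `L`, graded by `Γ × A`.  The subspace of color
`a : A` is the sum of the `piece (α, a)`. -/
structure GradedColorLie (Γ : Type*) {A : Type*} [AddCommSemigroup Γ] [AddCommGroup A]
    (θ : ColoringMap A) (L : Type*) [AddCommGroup L] [Module ℂ L] where
  /-- the homogeneous subspaces `L_(α,a)` -/
  piece : Γ × A → Submodule ℂ L
  isInternal : DirectSum.IsInternal piece
  /-- the bracket -/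
  bracket : L →ₗ[ℂ] L →ₗ[ℂ] L
  bracket_mem : ∀ {i j : Γ × A} {x y : L}, x ∈ piece i → y ∈ piece j → bracket x y ∈ piece (i + j)
  skew : ∀ {i j : Γ × A} {x y : L}, x ∈ piece i → y ∈ piece j →
    bracket x y = -((θ i.2 j.2 : ℂ) • bracket y x)
  jacobi : ∀ {i j : Γ × A} {x y : L} (z : L), x ∈ piece i → y ∈ piece j →
    bracket x (bracket y z) =
      bracket (bracket x y) z + (θ i.2 j.2 : ℂ) • bracket y (bracket x z)

namespace GradedColorLie

variable {Γ A L : Type*} [AddCommSemigroup Γ] [AddCommGroup A] {θ : ColoringMap A}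
  [AddCommGroup L] [Module ℂ L] (𝔏 : GradedColorLie Γ θ L)

/-- An action of the group `G` on the Lie superalgebra by automorphisms preserving the grading. -/
structure Action (G : Type*) [Group G] where
  /-- the linear action -/
  rep : Representation ℂ G L
  map_mem : ∀ (g : G) {i : Γ × A} {x : L}, x ∈ 𝔏.piece i → rep g x ∈ 𝔏.piece i
  map_bracket : ∀ (g : G) (x y : L), rep g (𝔏.bracket x y) = 𝔏.bracket (rep g x) (rep g y)

open scoped Classical in
/-- The linear map on `L` that agrees with `f i` on each `L_i`. -/
def glue {V : Type*} [AddCommGroup V] [Module ℂ V] (f : Γ × A → L →ₗ[ℂ] V) : L →ₗ[ℂ] V :=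
  (DirectSum.toModule ℂ (Γ × A) V fun i => f i ∘ₗ (𝔏.piece i).subtype) ∘ₗ
    (LinearEquiv.ofBijective (DirectSum.coeLinearMap 𝔏.piece) 𝔏.isInternal).symm.toLinearMap

open scoped Classical in
theorem glue_apply {V : Type*} [AddCommGroup V] [Module ℂ V] (f : Γ × A → L →ₗ[ℂ] V) {i : Γ × A}
    {x : L} (hx : x ∈ 𝔏.piece i) : 𝔏.glue f x = f i x := by
  have : (LinearEquiv.ofBijective (DirectSum.coeLinearMap 𝔏.piece) 𝔏.isInternal).symm x
      = DirectSum.lof ℂ (Γ × A) (fun i => 𝔏.piece i) i ⟨x, hx⟩ := by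
    rw [LinearEquiv.symm_apply_eq]
    exact (DirectSum.coeLinearMap_lof 𝔏.piece (i := i) ⟨x, hx⟩).symm
  simp only [glue, LinearMap.comp_apply, LinearEquiv.coe_coe]
  rw [this, DirectSum.toModule_lof]
  rfl

open scoped Classical in
theorem iSup_piece : ⨆ i, 𝔏.piece i = ⊤ := 𝔏.isInternal.submodule_iSup_eq_top

open scoped Classical in
theorem iSupIndep_piece : iSupIndep 𝔏.piece := 𝔏.isInternal.submodule_iSupIndep

theorem hom_induction {P : L → Prop} (h : ∀ i, ∀ x ∈ 𝔏.piece i, P x)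
    (h0 : P 0) (hadd : ∀ x y, P x → P y → P (x + y)) (x : L) : P x := by
  have hx : x ∈ ⨆ i, 𝔏.piece i := by rw [𝔏.iSup_piece]; trivial
  exact Submodule.iSup_induction 𝔏.piece (motive := P) hx h h0 hadd

/-! ### The standard complex

`Chains` is the `θ`-exterior algebra of `L`, the quotient of the tensor algebra by the relations
`x ∧ y = -θ(a,b) y ∧ x` (`x` of color `a`, `y` of color `b`).  As `θ(a,a) = 1` for even and
`θ(a,a) = -1` for odd `a`, it is the exterior algebra on the even part times the symmetric algebra
on the odd part, formed with the commutation factors of `θ`.  The differential is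
`d(x_1 ∧ ⋯ ∧ x_k) = ∑_{s<t} (-1)^s θ(a_s, a_{s+1} + ⋯ + a_{t-1})
  x_1 ∧ ⋯ x̂_s ⋯ ∧ [x_s,x_t] ∧ ⋯ ∧ x_k` with `[x_s,x_t]` in the place of `x_t`.  It is built by the
equivalent recursion `d(x ∧ w) = -(x · w) - x ∧ d w`, where `x · w` is the adjoint action. -/

/-- One step of the recursion below. -/
def stepMap {V : Type*} [AddCommGroup V] [Module ℂ V]
    (α : L →ₗ[ℂ] TensorAlgebra ℂ L →ₗ[ℂ] V) (β : L →ₗ[ℂ] V →ₗ[ℂ] V) :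
    L →ₗ[ℂ] Module.End ℂ (TensorAlgebra ℂ L × V) where
  toFun x := (LinearMap.mulLeft ℂ (TensorAlgebra.ι ℂ x) ∘ₗ LinearMap.fst ℂ _ _).prod
    (α x ∘ₗ LinearMap.fst ℂ _ _ + β x ∘ₗ LinearMap.snd ℂ _ _)
  map_add' x y := by ext p <;> simp [add_mul]
  map_smul' c x := by ext p <;> simp

/-- Given `α` and `β`, the linear map `R` on the tensor algebra determined by `R 1 = 0` and
`R (x ⊗ w) = α x w + β x (R w)`. -/
def tensorRec {V : Type*} [AddCommGroup V] [Module ℂ V]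
    (α : L →ₗ[ℂ] TensorAlgebra ℂ L →ₗ[ℂ] V) (β : L →ₗ[ℂ] V →ₗ[ℂ] V) :
    TensorAlgebra ℂ L →ₗ[ℂ] V where
  toFun w := (TensorAlgebra.lift ℂ (stepMap α β) w (1, 0)).2
  map_add' w w' := by simp
  map_smul' c w := by simp

theorem tensorRec_one {V : Type*} [AddCommGroup V] [Module ℂ V]
    (α : L →ₗ[ℂ] TensorAlgebra ℂ L →ₗ[ℂ] V) (β : L →ₗ[ℂ] V →ₗ[ℂ] V) :
    tensorRec α β 1 = 0 := by
  simp [tensorRec]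

theorem lift_stepMap_fst {V : Type*} [AddCommGroup V] [Module ℂ V]
    (α : L →ₗ[ℂ] TensorAlgebra ℂ L →ₗ[ℂ] V) (β : L →ₗ[ℂ] V →ₗ[ℂ] V) (w : TensorAlgebra ℂ L) :
    ∀ p : TensorAlgebra ℂ L × V,
      (TensorAlgebra.lift ℂ (stepMap α β) w p).1 = w * p.1 := by
  induction w using TensorAlgebra.induction with
  | algebraMap r => intro p; simp [Algebra.smul_def]
  | ι x => intro p; simp [stepMap]
  | mul a b ha hb => intro p; rw [map_mul, Module.End.mul_apply, mul_assoc, ha, hb]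
  | add a b ha hb => intro p; simp [ha, hb, add_mul]

theorem tensorRec_cons {V : Type*} [AddCommGroup V] [Module ℂ V]
    (α : L →ₗ[ℂ] TensorAlgebra ℂ L →ₗ[ℂ] V) (β : L →ₗ[ℂ] V →ₗ[ℂ] V) (x : L)
    (w : TensorAlgebra ℂ L) :
    tensorRec α β (TensorAlgebra.ι ℂ x * w) = α x w + β x (tensorRec α β w) := by
  have h := lift_stepMap_fst α β w (1, 0)
  rw [mul_one] at h
  simp only [tensorRec, LinearMap.coe_mk, AddHom.coe_mk, map_mul, TensorAlgebra.lift_ι_apply,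
    Module.End.mul_apply]
  generalize TensorAlgebra.lift ℂ (stepMap α β) w (1, 0) = p at h ⊢
  simp [stepMap, h]

/-- A subspace of the tensor algebra that contains `1` and is stable under left multiplication by
homogeneous elements of `L` is everything. -/
theorem tensor_mem (N : Submodule ℂ (TensorAlgebra ℂ L)) (h1 : (1 : TensorAlgebra ℂ L) ∈ N)
    (hc : ∀ i, ∀ x ∈ 𝔏.piece i, ∀ w ∈ N, TensorAlgebra.ι ℂ x * w ∈ N) (w : TensorAlgebra ℂ L) :
    w ∈ N := by
  suffices h : ∀ v ∈ N, w * v ∈ N by simpa using h 1 h1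
  induction w using TensorAlgebra.induction with
  | algebraMap r => intro v hv; rw [← Algebra.smul_def]; exact N.smul_mem r hv
  | ι x =>
    intro v hv
    refine 𝔏.hom_induction (P := fun x => TensorAlgebra.ι ℂ x * v ∈ N)
      (fun i x hx => hc i x hx v hv) (by simp) (fun x y hx hy => ?_) x
    simpa [add_mul] using N.add_mem hx hy
  | mul a b ha hb => intro v hv; rw [mul_assoc]; exact ha _ (hb _ hv)
  | add a b ha hb => intro v hv; rw [add_mul]; exact N.add_mem (ha _ hv) (hb _ hv)

/-- The map `y ↦ θ(a,b) y` for `y` of color `b`. -/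
def twist (a : A) : L →ₗ[ℂ] L := 𝔏.glue fun j => (θ a j.2 : ℂ) • LinearMap.id

theorem twist_apply (a : A) {j : Γ × A} {y : L} (hy : y ∈ 𝔏.piece j) :
    𝔏.twist a y = (θ a j.2 : ℂ) • y := by
  rw [twist, glue_apply _ _ hy]; rfl

/-- The adjoint action on the tensor algebra of elements of color `a`. -/
def actColor (a : A) : TensorAlgebra ℂ L →ₗ[ℂ] L →ₗ[ℂ] TensorAlgebra ℂ L :=
  tensorRec
    (LinearMap.mk₂ ℂ (fun y w =>
        LinearMap.mulRight ℂ w ∘ₗ TensorAlgebra.ι ℂ ∘ₗ 𝔏.bracket.flip y)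
      (by intros; ext; simp [add_mul]) (by intros; ext; simp)
      (by intros; ext; simp [mul_add]) (by intros; ext; simp))
    (LinearMap.mk₂ ℂ (fun y φ => LinearMap.mulLeft ℂ (TensorAlgebra.ι ℂ (𝔏.twist a y)) ∘ₗ φ)
      (by intros; ext; simp [add_mul]) (by intros; ext; simp)
      (by intros; ext; simp [mul_add]) (by intros; ext; simp))

/-- The adjoint action of `L` on the tensor algebra, by `θ`-derivations: for `x` of color `a`,
`x · (y_1 ⊗ ⋯ ⊗ y_n) = ∑_t θ(a, b_1 + ⋯ + b_{t-1}) y_1 ⊗ ⋯ ⊗ [x, y_t] ⊗ ⋯ ⊗ y_n`. -/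
def act : L →ₗ[ℂ] TensorAlgebra ℂ L →ₗ[ℂ] TensorAlgebra ℂ L :=
  𝔏.glue fun i => (𝔏.actColor i.2).flip

theorem act_one (x : L) : 𝔏.act x 1 = 0 := by
  refine 𝔏.hom_induction (P := fun x => 𝔏.act x 1 = 0) (fun i x hx => ?_) (by simp)
    (fun x y hx hy => by simp [hx, hy]) x
  rw [act, glue_apply _ _ hx, LinearMap.flip_apply, actColor, tensorRec_one]; rfl

theorem act_cons {i j : Γ × A} {x y : L} (hx : x ∈ 𝔏.piece i) (hy : y ∈ 𝔏.piece j)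
    (w : TensorAlgebra ℂ L) :
    𝔏.act x (TensorAlgebra.ι ℂ y * w) = TensorAlgebra.ι ℂ (𝔏.bracket x y) * w
      + (θ i.2 j.2 : ℂ) • (TensorAlgebra.ι ℂ y * 𝔏.act x w) := by
  rw [act, glue_apply _ _ hx, LinearMap.flip_apply, LinearMap.flip_apply, actColor, tensorRec_cons]
  simp [twist_apply _ _ hy]

/-- The differential on the tensor algebra: `d 1 = 0`, `d (x ⊗ w) = -(x · w) - x ⊗ d w`. -/
def diff : TensorAlgebra ℂ L →ₗ[ℂ] TensorAlgebra ℂ L :=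
  tensorRec (-𝔏.act) (-(LinearMap.mul ℂ (TensorAlgebra ℂ L) ∘ₗ TensorAlgebra.ι ℂ))

theorem diff_one : 𝔏.diff 1 = 0 := tensorRec_one _ _

theorem diff_cons (x : L) (w : TensorAlgebra ℂ L) :
    𝔏.diff (TensorAlgebra.ι ℂ x * w) = -𝔏.act x w - TensorAlgebra.ι ℂ x * 𝔏.diff w := by
  rw [diff, tensorRec_cons]; simp [sub_eq_add_neg]

theorem act_act {i j : Γ × A} {x y : L} (hx : x ∈ 𝔏.piece i) (hy : y ∈ 𝔏.piece j)
    (w : TensorAlgebra ℂ L) :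
    𝔏.act x (𝔏.act y w) = 𝔏.act (𝔏.bracket x y) w + (θ i.2 j.2 : ℂ) • 𝔏.act y (𝔏.act x w) := by
  refine 𝔏.tensor_mem (LinearMap.eqLocus (𝔏.act x ∘ₗ 𝔏.act y)
    (𝔏.act (𝔏.bracket x y) + (θ i.2 j.2 : ℂ) • (𝔏.act y ∘ₗ 𝔏.act x))) ?_ ?_ w
  · simp [LinearMap.mem_eqLocus, act_one]
  · intro k z hz w hw
    simp only [LinearMap.mem_eqLocus, LinearMap.comp_apply, LinearMap.add_apply,
      LinearMap.smul_apply] at hw ⊢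
    rw [𝔏.act_cons hy hz, 𝔏.act_cons hx hz, 𝔏.act_cons (𝔏.bracket_mem hx hy) hz, map_add, map_add,
      map_smul, map_smul, 𝔏.act_cons hx (𝔏.bracket_mem hy hz), 𝔏.act_cons hx hz,
      𝔏.act_cons hy (𝔏.bracket_mem hx hz), 𝔏.act_cons hy hz, hw, 𝔏.jacobi z hx hy]
    simp only [Prod.snd_add, θ.map_add_left, θ.map_add_right, Units.val_mul, map_add, map_smul,
      add_mul, mul_add, smul_add, smul_smul, smul_mul_assoc, mul_smul_comm]
    have h := θ.mul_swap_coe i.2 j.2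
    have e1 : (θ i.2 j.2 : ℂ) * ((θ j.2 i.2 : ℂ) * (θ j.2 k.2 : ℂ)) = (θ j.2 k.2 : ℂ) := by
      rw [← mul_assoc, h, one_mul]
    rw [e1]
    module

theorem diff_act (x : L) (w : TensorAlgebra ℂ L) : 𝔏.diff (𝔏.act x w) = 𝔏.act x (𝔏.diff w) := by
  refine 𝔏.hom_induction (P := fun x => 𝔏.diff (𝔏.act x w) = 𝔏.act x (𝔏.diff w))
    (fun i x hx => ?_) (by simp) (fun x y hx hy => by simp [hx, hy]) x
  refine 𝔏.tensor_mem (LinearMap.eqLocus (𝔏.diff ∘ₗ 𝔏.act x) (𝔏.act x ∘ₗ 𝔏.diff)) ?_ ?_ w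
  · simp [LinearMap.mem_eqLocus, act_one, diff_one]
  · intro j y hy w hw
    simp only [LinearMap.mem_eqLocus, LinearMap.comp_apply] at hw ⊢
    rw [𝔏.act_cons hx hy, map_add, map_smul, diff_cons, diff_cons, diff_cons, map_sub, map_neg,
      𝔏.act_cons hx hy, 𝔏.act_act hx hy, hw]
    module

theorem diff_diff (w : TensorAlgebra ℂ L) : 𝔏.diff (𝔏.diff w) = 0 := by
  refine 𝔏.tensor_mem (LinearMap.ker (𝔏.diff ∘ₗ 𝔏.diff)) ?_ ?_ w
  · simp [diff_one]
  · intro j y hy w hw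
    simp only [LinearMap.mem_ker, LinearMap.comp_apply] at hw ⊢
    rw [diff_cons, map_sub, map_neg, diff_cons, diff_act, hw]
    simp

/-- The relation `x ⊗ y + θ(a,b) y ⊗ x`. -/
def relator (i j : Γ × A) (x y : L) : TensorAlgebra ℂ L :=
  TensorAlgebra.ι ℂ x * TensorAlgebra.ι ℂ y
    + (θ i.2 j.2 : ℂ) • (TensorAlgebra.ι ℂ y * TensorAlgebra.ι ℂ x)

/-- The two-sided ideal of the tensor algebra generated by the `x ⊗ y + θ(a,b) y ⊗ x`, for
homogeneous `x`, `y` of colors `a`, `b`. -/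
def relIdeal : Submodule ℂ (TensorAlgebra ℂ L) :=
  Submodule.span ℂ {t | ∃ i j : Γ × A, ∃ x ∈ 𝔏.piece i, ∃ y ∈ 𝔏.piece j, ∃ u v : TensorAlgebra ℂ L,
    t = u * relator (θ := θ) i j x y * v}

theorem relator_mem {i j : Γ × A} {x y : L} (hx : x ∈ 𝔏.piece i) (hy : y ∈ 𝔏.piece j)
    (u v : TensorAlgebra ℂ L) : u * relator (θ := θ) i j x y * v ∈ 𝔏.relIdeal :=
  Submodule.subset_span ⟨i, j, x, hx, y, hy, u, v, rfl⟩

theorem mul_mem_relIdeal (a : TensorAlgebra ℂ L) {t : TensorAlgebra ℂ L} (ht : t ∈ 𝔏.relIdeal) :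
    a * t ∈ 𝔏.relIdeal := by
  have : 𝔏.relIdeal ≤ 𝔏.relIdeal.comap (LinearMap.mulLeft ℂ a) := by
    refine Submodule.span_le.2 ?_
    rintro _ ⟨i, j, x, hx, y, hy, u, v, rfl⟩
    have := 𝔏.relator_mem hx hy (a * u) v
    simpa [mul_assoc] using this
  exact this ht

theorem act_relator {i j k : Γ × A} {x y z : L} (hx : x ∈ 𝔏.piece i) (hy : y ∈ 𝔏.piece j)
    (hz : z ∈ 𝔏.piece k) (v : TensorAlgebra ℂ L) :
    𝔏.act x (relator (θ := θ) j k y z * v) =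
      relator (θ := θ) (i + j) k (𝔏.bracket x y) z * v
      + (θ i.2 j.2 : ℂ) • (relator (θ := θ) j (i + k) y (𝔏.bracket x z) * v)
      + ((θ i.2 j.2 : ℂ) * (θ i.2 k.2 : ℂ)) • (relator (θ := θ) j k y z * 𝔏.act x v) := by
  have h := θ.mul_swap_coe i.2 j.2
  have e1 : (θ i.2 j.2 : ℂ) * ((θ j.2 i.2 : ℂ) * (θ j.2 k.2 : ℂ)) = (θ j.2 k.2 : ℂ) := by
    rw [← mul_assoc, h, one_mul]
  simp only [relator, add_mul, smul_mul_assoc, mul_assoc, map_add, map_smul, 𝔏.act_cons hx hy,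
    𝔏.act_cons hx hz, Prod.snd_add, θ.map_add_left, θ.map_add_right, Units.val_mul, mul_add,
    smul_add, smul_smul, mul_smul_comm, e1]
  module

theorem act_mem_relIdeal (x : L) {t : TensorAlgebra ℂ L} (ht : t ∈ 𝔏.relIdeal) :
    𝔏.act x t ∈ 𝔏.relIdeal := by
  refine 𝔏.hom_induction (P := fun x => 𝔏.act x t ∈ 𝔏.relIdeal) (fun i x hx => ?_) (by simp)
    (fun x y hx hy => by simpa using 𝔏.relIdeal.add_mem hx hy) x
  have : 𝔏.relIdeal ≤ 𝔏.relIdeal.comap (𝔏.act x) := by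
    refine Submodule.span_le.2 ?_
    rintro _ ⟨j, k, y, hy, z, hz, u, v, rfl⟩
    rw [SetLike.mem_coe, Submodule.mem_comap]
    rw [mul_assoc]
    refine 𝔏.tensor_mem (𝔏.relIdeal.comap
      (𝔏.act x ∘ₗ LinearMap.mulRight ℂ (relator (θ := θ) j k y z * v))) ?_ ?_ u
    · simp only [Submodule.mem_comap, LinearMap.comp_apply, LinearMap.mulRight_apply, one_mul]
      rw [𝔏.act_relator hx hy hz]
      have h1 := 𝔏.relator_mem (𝔏.bracket_mem hx hy) hz 1 v
      have h2 := 𝔏.relator_mem hy (𝔏.bracket_mem hx hz) 1 v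
      have h3 := 𝔏.relator_mem hy hz 1 (𝔏.act x v)
      rw [one_mul] at h1 h2 h3
      exact Submodule.add_mem _ (Submodule.add_mem _ h1 (Submodule.smul_mem _ _ h2))
        (Submodule.smul_mem _ _ h3)
    · intro l s hs w hw
      simp only [Submodule.mem_comap, LinearMap.comp_apply, LinearMap.mulRight_apply] at hw ⊢
      rw [mul_assoc, 𝔏.act_cons hx hs]
      refine Submodule.add_mem _ ?_ (Submodule.smul_mem _ _ (𝔏.mul_mem_relIdeal _ hw))
      have := 𝔏.relator_mem hy hz (TensorAlgebra.ι ℂ (𝔏.bracket x s) * w) v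
      simpa [mul_assoc] using this
  exact this ht

theorem diff_relator {j k : Γ × A} {y z : L} (hy : y ∈ 𝔏.piece j) (hz : z ∈ 𝔏.piece k)
    (v : TensorAlgebra ℂ L) :
    𝔏.diff (relator (θ := θ) j k y z * v) = relator (θ := θ) j k y z * 𝔏.diff v := by
  have h := θ.mul_swap_coe j.2 k.2
  simp only [relator, add_mul, smul_mul_assoc, mul_assoc, map_add, map_smul, diff_cons,
    𝔏.act_cons hy hz, 𝔏.act_cons hz hy, 𝔏.skew hy hz, map_neg, neg_mul, mul_sub, mul_neg, smul_add,
    smul_sub, smul_neg, smul_smul, h, one_smul]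
  module

theorem diff_mem_relIdeal {t : TensorAlgebra ℂ L} (ht : t ∈ 𝔏.relIdeal) :
    𝔏.diff t ∈ 𝔏.relIdeal := by
  have : 𝔏.relIdeal ≤ 𝔏.relIdeal.comap 𝔏.diff := by
    refine Submodule.span_le.2 ?_
    rintro _ ⟨j, k, y, hy, z, hz, u, v, rfl⟩
    rw [SetLike.mem_coe, Submodule.mem_comap]
    rw [mul_assoc]
    refine 𝔏.tensor_mem (𝔏.relIdeal.comap
      (𝔏.diff ∘ₗ LinearMap.mulRight ℂ (relator (θ := θ) j k y z * v))) ?_ ?_ u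
    · simp only [Submodule.mem_comap, LinearMap.comp_apply, LinearMap.mulRight_apply, one_mul]
      rw [𝔏.diff_relator hy hz]
      have h3 := 𝔏.relator_mem hy hz 1 (𝔏.diff v)
      rwa [one_mul] at h3
    · intro l s hs w hw
      simp only [Submodule.mem_comap, LinearMap.comp_apply, LinearMap.mulRight_apply] at hw ⊢
      rw [mul_assoc, diff_cons]
      refine Submodule.sub_mem _ (Submodule.neg_mem _ (𝔏.act_mem_relIdeal s ?_))
        (𝔏.mul_mem_relIdeal _ hw)
      have := 𝔏.relator_mem hy hz w v
      simpa [mul_assoc] using this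
  exact this ht

/-- The `θ`-exterior algebra of `L`, the space of all chains. -/
abbrev Chains : Type _ := TensorAlgebra ℂ L ⧸ 𝔏.relIdeal

/-- The differential on chains. -/
def bdry : 𝔏.Chains →ₗ[ℂ] 𝔏.Chains :=
  𝔏.relIdeal.mapQ 𝔏.relIdeal 𝔏.diff fun _ ht => 𝔏.diff_mem_relIdeal ht

theorem bdry_bdry (c : 𝔏.Chains) : 𝔏.bdry (𝔏.bdry c) = 0 := by
  obtain ⟨w, rfl⟩ := Submodule.mkQ_surjective _ c
  change 𝔏.relIdeal.mkQ (𝔏.diff (𝔏.diff w)) = 0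
  rw [diff_diff, map_zero]

/-- The tensors of tensor degree `k` and weight `m`, spanned by the `x_1 ⊗ ⋯ ⊗ x_k` with
homogeneous `x_s` whose degrees sum up to `m`. -/
def homog (k : ℕ) (m : WithZero (Γ × A)) : Submodule ℂ (TensorAlgebra ℂ L) :=
  Submodule.span ℂ {t | ∃ l : List (Σ i, 𝔏.piece i), l.length = k ∧
    (l.map fun x => (x.1 : WithZero (Γ × A))).sum = m ∧
    (l.map fun x => TensorAlgebra.ι ℂ (x.2 : L)).prod = t}

theorem list_mem_homog (l : List (Σ i, 𝔏.piece i)) :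
    (l.map fun x => TensorAlgebra.ι ℂ (x.2 : L)).prod ∈
      𝔏.homog l.length (l.map fun x => (x.1 : WithZero (Γ × A))).sum :=
  Submodule.subset_span ⟨l, rfl, rfl, rfl⟩

theorem cons_mem_homog {i : Γ × A} {x : L} (hx : x ∈ 𝔏.piece i) {k : ℕ} {m : WithZero (Γ × A)}
    {w : TensorAlgebra ℂ L} (hw : w ∈ 𝔏.homog k m) :
    TensorAlgebra.ι ℂ x * w ∈ 𝔏.homog (k + 1) ((i : WithZero (Γ × A)) + m) := by
  have : 𝔏.homog k m ≤ (𝔏.homog (k + 1) ((i : WithZero (Γ × A)) + m)).comap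
      (LinearMap.mulLeft ℂ (TensorAlgebra.ι ℂ x)) := by
    refine Submodule.span_le.2 ?_
    rintro _ ⟨l, rfl, rfl, rfl⟩
    simpa using 𝔏.list_mem_homog (⟨i, ⟨x, hx⟩⟩ :: l)
  exact this hw

theorem act_mem_homog {i : Γ × A} {x : L} (hx : x ∈ 𝔏.piece i) {k : ℕ} {m : WithZero (Γ × A)}
    {w : TensorAlgebra ℂ L} (hw : w ∈ 𝔏.homog k m) :
    𝔏.act x w ∈ 𝔏.homog k ((i : WithZero (Γ × A)) + m) := by
  have : 𝔏.homog k m ≤ (𝔏.homog k ((i : WithZero (Γ × A)) + m)).comap (𝔏.act x) := by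
    refine Submodule.span_le.2 ?_
    rintro _ ⟨l, rfl, rfl, rfl⟩
    rw [SetLike.mem_coe, Submodule.mem_comap]
    clear hw
    induction l with
    | nil => simp [act_one]
    | cons y l ih =>
      obtain ⟨j, y, hy⟩ := y
      simp only [List.map_cons, List.prod_cons, List.sum_cons, List.length_cons]
      rw [𝔏.act_cons hx hy]
      refine Submodule.add_mem _ ?_ (Submodule.smul_mem _ _ ?_)
      · have := 𝔏.cons_mem_homog (𝔏.bracket_mem hx hy) (𝔏.list_mem_homog l)
        rwa [WithZero.coe_add, add_assoc] at this
      · rw [add_left_comm]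
        exact 𝔏.cons_mem_homog hy ih
  exact this hw

theorem diff_list_mem (l : List (Σ i, 𝔏.piece i)) :
    𝔏.diff (l.map fun x => TensorAlgebra.ι ℂ (x.2 : L)).prod ∈
      𝔏.homog (l.length - 1) (l.map fun x => (x.1 : WithZero (Γ × A))).sum := by
  induction l with
  | nil => simp [diff_one]
  | cons x l ih =>
    obtain ⟨i, x, hx⟩ := x
    simp only [List.map_cons, List.prod_cons, List.sum_cons, List.length_cons,
      Nat.add_sub_cancel]
    rw [diff_cons]
    refine Submodule.sub_mem _ (Submodule.neg_mem _ (𝔏.act_mem_homog hx (𝔏.list_mem_homog l))) ?_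
    cases l with
    | nil => simp [diff_one]
    | cons y l => exact 𝔏.cons_mem_homog hx ih

theorem diff_mem_homog {k : ℕ} {m : WithZero (Γ × A)} {w : TensorAlgebra ℂ L}
    (hw : w ∈ 𝔏.homog k m) : 𝔏.diff w ∈ 𝔏.homog (k - 1) m := by
  have : 𝔏.homog k m ≤ (𝔏.homog (k - 1) m).comap 𝔏.diff := by
    refine Submodule.span_le.2 ?_
    rintro _ ⟨l, rfl, rfl, rfl⟩
    exact 𝔏.diff_list_mem l
  exact this hw

/-- The homogeneous component `C_k(L)_m` of the standard complex. -/
def chain (k : ℕ) (m : WithZero (Γ × A)) : Submodule ℂ 𝔏.Chains :=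
  (𝔏.homog k m).map 𝔏.relIdeal.mkQ

theorem bdry_mem_chain {k : ℕ} {m : WithZero (Γ × A)} {c : 𝔏.Chains} (hc : c ∈ 𝔏.chain k m) :
    𝔏.bdry c ∈ 𝔏.chain (k - 1) m := by
  obtain ⟨w, hw, rfl⟩ := hc
  exact ⟨𝔏.diff w, 𝔏.diff_mem_homog hw, rfl⟩

/-- The cycles in `C_k(L)_m`. -/
def cycle (k : ℕ) (m : WithZero (Γ × A)) : Submodule ℂ 𝔏.Chains :=
  𝔏.chain k m ⊓ LinearMap.ker 𝔏.bdry

/-- The boundaries in `C_k(L)_m`. -/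
def boundary (k : ℕ) (m : WithZero (Γ × A)) : Submodule ℂ 𝔏.Chains :=
  (𝔏.chain (k + 1) m).map 𝔏.bdry

theorem boundary_le_cycle (k : ℕ) (m : WithZero (Γ × A)) : 𝔏.boundary k m ≤ 𝔏.cycle k m := by
  rintro _ ⟨c, hc, rfl⟩
  exact Submodule.mem_inf.2
    ⟨𝔏.bdry_mem_chain (k := k + 1) hc, LinearMap.mem_ker.2 (𝔏.bdry_bdry c)⟩

/-- The homogeneous component `H_k(L)_m` of the homology with trivial coefficients. -/
abbrev Homology (k : ℕ) (m : WithZero (Γ × A)) : Type _ :=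
  𝔏.cycle k m ⧸ (𝔏.boundary k m).submoduleOf (𝔏.cycle k m)

/-! ### The group action, supertraces and supercharacters -/

namespace Action

variable {𝔏} {G : Type*} [Group G] (ρ : 𝔏.Action G)

/-- The action on the tensor algebra. -/
def onTensor (g : G) : TensorAlgebra ℂ L →ₐ[ℂ] TensorAlgebra ℂ L :=
  TensorAlgebra.lift ℂ (TensorAlgebra.ι ℂ ∘ₗ ρ.rep g)

theorem onTensor_ι (g : G) (x : L) :
    ρ.onTensor g (TensorAlgebra.ι ℂ x) = TensorAlgebra.ι ℂ (ρ.rep g x) := by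
  simp [onTensor]

theorem onTensor_act (g : G) (x : L) (w : TensorAlgebra ℂ L) :
    ρ.onTensor g (𝔏.act x w) = 𝔏.act (ρ.rep g x) (ρ.onTensor g w) := by
  refine 𝔏.hom_induction
    (P := fun x => ρ.onTensor g (𝔏.act x w) = 𝔏.act (ρ.rep g x) (ρ.onTensor g w))
    (fun i x hx => ?_) (by simp) (fun x y hx hy => by simp [hx, hy]) x
  refine 𝔏.tensor_mem (LinearMap.eqLocus ((ρ.onTensor g).toLinearMap ∘ₗ 𝔏.act x)
    (𝔏.act (ρ.rep g x) ∘ₗ (ρ.onTensor g).toLinearMap)) ?_ ?_ w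
  · simp [LinearMap.mem_eqLocus, act_one]
  · intro j y hy w hw
    simp only [LinearMap.mem_eqLocus, LinearMap.comp_apply, AlgHom.toLinearMap_apply] at hw ⊢
    rw [𝔏.act_cons hx hy, map_mul, onTensor_ι, 𝔏.act_cons (ρ.map_mem g hx) (ρ.map_mem g hy),
      map_add, map_mul, onTensor_ι, map_smul, map_mul, onTensor_ι, hw, ρ.map_bracket]

theorem onTensor_diff (g : G) (w : TensorAlgebra ℂ L) :
    ρ.onTensor g (𝔏.diff w) = 𝔏.diff (ρ.onTensor g w) := by
  refine 𝔏.tensor_mem (LinearMap.eqLocus ((ρ.onTensor g).toLinearMap ∘ₗ 𝔏.diff)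
    (𝔏.diff ∘ₗ (ρ.onTensor g).toLinearMap)) ?_ ?_ w
  · simp [LinearMap.mem_eqLocus, diff_one]
  · intro j y hy w hw
    simp only [LinearMap.mem_eqLocus, LinearMap.comp_apply, AlgHom.toLinearMap_apply] at hw ⊢
    rw [diff_cons, map_mul, onTensor_ι, diff_cons, map_sub, map_neg, map_mul, onTensor_ι, hw,
      onTensor_act]

theorem onTensor_mem_relIdeal (g : G) {t : TensorAlgebra ℂ L} (ht : t ∈ 𝔏.relIdeal) :
    ρ.onTensor g t ∈ 𝔏.relIdeal := by
  have : 𝔏.relIdeal ≤ 𝔏.relIdeal.comap (ρ.onTensor g).toLinearMap := by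
    refine Submodule.span_le.2 ?_
    rintro _ ⟨i, j, x, hx, y, hy, u, v, rfl⟩
    have := 𝔏.relator_mem (ρ.map_mem g hx) (ρ.map_mem g hy) (ρ.onTensor g u) (ρ.onTensor g v)
    simpa [relator, onTensor_ι] using this
  exact this ht

theorem onTensor_mem_homog (g : G) {k : ℕ} {m : WithZero (Γ × A)} {w : TensorAlgebra ℂ L}
    (hw : w ∈ 𝔏.homog k m) : ρ.onTensor g w ∈ 𝔏.homog k m := by
  have : 𝔏.homog k m ≤ (𝔏.homog k m).comap (ρ.onTensor g).toLinearMap := by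
    refine Submodule.span_le.2 ?_
    rintro _ ⟨l, rfl, rfl, rfl⟩
    rw [SetLike.mem_coe, Submodule.mem_comap]
    rw [AlgHom.toLinearMap_apply]
    clear hw
    induction l with
    | nil => simpa using 𝔏.list_mem_homog []
    | cons x l ih =>
      obtain ⟨i, x, hx⟩ := x
      simp only [List.map_cons, List.prod_cons, List.sum_cons, List.length_cons, map_mul]
      rw [onTensor_ι]
      exact 𝔏.cons_mem_homog (ρ.map_mem g hx) ih
  exact this hw

/-- The action on chains, `g (x_1 ∧ ⋯ ∧ x_k) = g x_1 ∧ ⋯ ∧ g x_k`. -/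
def onChains (g : G) : 𝔏.Chains →ₗ[ℂ] 𝔏.Chains :=
  𝔏.relIdeal.mapQ 𝔏.relIdeal (ρ.onTensor g).toLinearMap fun _ ht => ρ.onTensor_mem_relIdeal g ht

theorem onChains_bdry (g : G) (c : 𝔏.Chains) :
    ρ.onChains g (𝔏.bdry c) = 𝔏.bdry (ρ.onChains g c) := by
  obtain ⟨w, rfl⟩ := Submodule.mkQ_surjective _ c
  exact congrArg 𝔏.relIdeal.mkQ (ρ.onTensor_diff g w)

theorem onChains_mem_chain (g : G) {k : ℕ} {m : WithZero (Γ × A)} {c : 𝔏.Chains}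
    (hc : c ∈ 𝔏.chain k m) : ρ.onChains g c ∈ 𝔏.chain k m := by
  obtain ⟨w, hw, rfl⟩ := hc
  exact ⟨ρ.onTensor g w, ρ.onTensor_mem_homog g hw, rfl⟩

theorem onChains_mem_cycle (g : G) {k : ℕ} {m : WithZero (Γ × A)} {c : 𝔏.Chains}
    (hc : c ∈ 𝔏.cycle k m) : ρ.onChains g c ∈ 𝔏.cycle k m := by
  refine ⟨ρ.onChains_mem_chain g hc.1, ?_⟩
  have h : 𝔏.bdry c = 0 := hc.2
  change 𝔏.bdry (ρ.onChains g c) = 0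
  rw [← onChains_bdry, h, map_zero]

theorem onChains_mem_boundary (g : G) {k : ℕ} {m : WithZero (Γ × A)} {c : 𝔏.Chains}
    (hc : c ∈ 𝔏.boundary k m) : ρ.onChains g c ∈ 𝔏.boundary k m := by
  obtain ⟨b, hb, rfl⟩ := hc
  exact ⟨ρ.onChains g b, ρ.onChains_mem_chain g hb, (ρ.onChains_bdry g b).symm⟩

/-- The action on `L_i`. -/
def onPiece (g : G) (i : Γ × A) : 𝔏.piece i →ₗ[ℂ] 𝔏.piece i :=
  (ρ.rep g).restrict fun _ hx => ρ.map_mem g hx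

/-- The action on `C_k(L)_m`. -/
def onChain (g : G) (k : ℕ) (m : WithZero (Γ × A)) : 𝔏.chain k m →ₗ[ℂ] 𝔏.chain k m :=
  (ρ.onChains g).restrict fun _ hc => ρ.onChains_mem_chain g hc

/-- The action on `H_k(L)_m`. -/
def onHomology (g : G) (k : ℕ) (m : WithZero (Γ × A)) : 𝔏.Homology k m →ₗ[ℂ] 𝔏.Homology k m :=
  Submodule.mapQ _ _ ((ρ.onChains g).restrict fun _ hc => ρ.onChains_mem_cycle g hc)
    fun _ hc => ρ.onChains_mem_boundary g hc

/-- `str(g | L_i) = ψ(a) tr(g | L_i)`, `i = (α,a)`. -/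
def str (g : G) (i : Γ × A) : ℂ := θ.sign i.2 * LinearMap.trace ℂ _ (ρ.onPiece g i)

/-- `str(g | C_k(L)_m)`. -/
def strChain (g : G) (k : ℕ) (m : WithZero (Γ × A)) : ℂ :=
  θ.degSign m * LinearMap.trace ℂ _ (ρ.onChain g k m)

/-- `str(g | H_k(L)_m)`. -/
def strHomology (g : G) (k : ℕ) (m : WithZero (Γ × A)) : ℂ :=
  θ.degSign m * LinearMap.trace ℂ _ (ρ.onHomology g k m)

/-- `str(g | H(L)_m)` for the alternating direct sum
`H(L) = ∑_{k ≥ 1} (-1)^(k+1) H_k(L) = H_1(L) ⊖ H_2(L) ⊕ H_3(L) ⊖ ⋯`. -/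
def strH (g : G) (m : WithZero (Γ × A)) : ℂ := ∑ᶠ k : ℕ, (-1) ^ k * ρ.strHomology g (k + 1) m

/-- The supercharacter `sch_g C_k(L) = ∑ str(g | C_k(L)_m) E^m`. -/
def schChain (g : G) (k : ℕ) : FormalSeries (Γ × A) :=
  FormalSeries.formalSum fun m : WithZero (Γ × A) => ρ.strChain g k m • θ.E m

/-- The supercharacter `sch_g H_k(L) = ∑ str(g | H_k(L)_m) E^m`. -/
def schHomology (g : G) (k : ℕ) : FormalSeries (Γ × A) :=
  FormalSeries.formalSum fun m : WithZero (Γ × A) => ρ.strHomology g k m • θ.E m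

/-- The supercharacter `sch_g H(L) = ∑ str(g | H(L)_m) E^m`. -/
def schH (g : G) : FormalSeries (Γ × A) :=
  FormalSeries.formalSum fun m : WithZero (Γ × A) => ρ.strH g m • θ.E m

/-- The series `∑_{r ≥ 1} (1/r) str(g^r | L_i) E^(r i)`. -/
def logFactor (g : G) (i : Γ × A) : FormalSeries (Γ × A) :=
  FormalSeries.formalSum fun r : ℕ =>
    (((r + 1 : ℕ) : ℂ)⁻¹ * ρ.str (g ^ (r + 1)) i) • θ.E ((r + 1) • (i : WithZero (Γ × A)))

/-- The set `T(τ,b)` of partitions of `j = (τ,b)` into elements of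
`P = {i | str(g | H(L)_i) ≠ 0}`, a partition being given by its multiplicities `s`. -/
def partitionSet (g : G) (j : Γ × A) : Set (Γ × A →₀ ℕ) :=
  {s | (∀ i ∈ s.support, ρ.strH g i ≠ 0) ∧
    (s.sum fun i n => n • (i : WithZero (Γ × A))) = (j : WithZero (Γ × A))}

variable [FinitelyManySums (Γ × A)]

theorem partitionSet_finite (g : G) (j : Γ × A) : (ρ.partitionSet g j).Finite := by
  classical
  refine Set.Finite.of_finite_image (f := Finsupp.toMultiset)
    ((FinitelyManySums.finite_sums j).subset ?_) (Finsupp.orderIsoMultiset (ι := Γ × A)).injective.injOn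
  rintro _ ⟨s, hs, rfl⟩
  change (Multiset.map _ (Finsupp.toMultiset s)).sum = _
  rw [← hs.2]
  clear hs
  induction s using Finsupp.induction_linear with
  | zero => simp
  | add s t h1 h2 =>
    rw [map_add, Multiset.map_add, Multiset.sum_add, h1, h2]
    exact (Finsupp.sum_add_index' (f := s) (g := t)
      (h := fun (i : Γ × A) (n : ℕ) => n • (i : WithZero (Γ × A)))
      (fun _ => zero_nsmul _) (fun _ _ _ => add_nsmul _ _ _)).symm
  | single i n => simp [Multiset.map_nsmul, Multiset.sum_nsmul]

/-- The Witt partition function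
`W_g(j) = ∑_{s ∈ T(j)} (|s| - 1)! / s! ∏ str(g | H(L)_i)^(s_i)`; here `|s| ≥ 1`. -/
def witt (g : G) (j : Γ × A) : ℂ :=
  ∑ s ∈ (ρ.partitionSet_finite g j).toFinset,
    ((s.degree - 1).factorial : ℂ) / (s.prod fun _ n => (n.factorial : ℂ)) *
      s.prod fun i n => ρ.strH g i ^ n

end Action

/-- The pairs `(d, j)` with `d > 0` and `i = d j`. -/
def divisorSet (i : Γ × A) : Set (ℕ × (Γ × A)) :=
  {p | 0 < p.1 ∧ p.1 • (p.2 : WithZero (Γ × A)) = (i : WithZero (Γ × A))}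

theorem divisorSet_finite [FinitelyManySums (Γ × A)] (i : Γ × A) : (divisorSet i).Finite := by
  refine Set.Finite.of_finite_image (f := fun p => Multiset.replicate p.1 p.2)
    ((FinitelyManySums.finite_sums i).subset ?_) ?_
  · rintro _ ⟨p, hp, rfl⟩
    simpa using hp.2
  · rintro ⟨d, x⟩ hp ⟨d', x'⟩ _ h
    have h1 : d = d' := by simpa using congrArg Multiset.card h
    subst h1
    have h2 : x ∈ Multiset.replicate d x' := by
      rw [← show Multiset.replicate d x = Multiset.replicate d x' from h]
      exact Multiset.mem_replicate.2 ⟨hp.1.ne', rfl⟩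
    rw [Multiset.eq_of_mem_replicate h2]

end GradedColorLie

end

/-! Fix `g`. Since ℂ is algebraically closed, each finite-dimensional piece of `L` has a basis in
which `g` is triangular, with diagonal entries λ_j. The θ-exterior algebra has a basis of monomials
indexed by the multisets of basis elements in which no even element is repeated, and `g` is
triangular on these monomials too. So tr(g | C_k) is a sum of products of the λ_j over such
multisets (`trace_onChain`).

Consequently ∑ (-1)^k tr(g | C_k) factors over the basis: an even element contributes 1 - λ_j e^(deg
j), an odd one (1 + λ_j e^(deg j))⁻¹, because it may be repeated (`admSeries_insert_eq`). As tr(g^r)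
is the sum of the λ_j^r, the logarithms of the factors from one piece add up to minus the series ∑
(1/r) str(g^r | L_i) E^(r i) (`logFactor_eq_sum`). This is the product side of the denominator
identity.

Traces are additive on short exact sequences, so the alternating sums over chains and over homology
differ by a telescoping sum that vanishes (`finsum_trace_onChain`). The differential is zero on C_0
and C_1, hence H_0 = C_0 = ℂ contributes the 1 in `1 - ρ.schH g`.

Taking logarithms of the denominator identity and expanding -log(1 - sch_g H) by the multinomial
theorem, the coefficient at j gives W_g(j) = ∑ (1/d) str(g^d | L_i) over j = d i (`witt_eq`). Möbius
inversion, applied to all powers of `g` at once, yields the supertrace formula.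

Infinite series are handled one coefficient at a time. The coefficient at m of a product depends
only on coefficients at summands of m, and modulo `vanishIdeal m` every series without constant term
is nilpotent, so identities between power series reduce to finite sums. -/

noncomputable section

/-! ### Truncations of the completed semigroup algebra -/

namespace FormalSeries

open FinitelyManySums

section Basic

variable {S : Type*}

theorem sub_apply (f g : FormalSeries S) (m : WithZero S) : (f - g) m = f m - g m := rfl

theorem neg_apply (f : FormalSeries S) (m : WithZero S) : (-f) m = -f m := rfl

theorem smul_apply (c : ℂ) (f : FormalSeries S) (m : WithZero S) : (c • f) m = c * f m := rfl

theorem sum_apply {ι : Type*} (s : Finset ι) (f : ι → FormalSeries S) (m : WithZero S) :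
    (∑ i ∈ s, f i) m = ∑ i ∈ s, f i m :=
  Finset.sum_apply m s f

open scoped Classical in
theorem e_apply (m n : WithZero S) : (e m : FormalSeries S) n = if n = m then 1 else 0 := rfl

theorem formalSum_apply {J : Type*} (f : J → FormalSeries S) (m : WithZero S) :
    formalSum f m = ∑ᶠ j, f j m := rfl

variable [AddCommSemigroup S]

/-- The degree in `WithZero S` of a multiset of elements of `S`. -/
def multisetSum (s : Multiset S) : WithZero S := (s.map (fun y : S => (y : WithZero S))).sum

theorem multisetSum_add (s t : Multiset S) :
    multisetSum (s + t) = multisetSum s + multisetSum t := by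
  simp [multisetSum]

theorem exists_multisetSum_eq (m : WithZero S) : ∃ s : Multiset S, multisetSum s = m := by
  cases m with
  | zero => exact ⟨0, rfl⟩
  | coe x => exact ⟨{x}, by simp [multisetSum]⟩

end Basic

variable {S : Type*} [AddCommSemigroup S] [FinitelyManySums S]

/-- The algebra structure on formal series. -/
@[reducible]
def algebraComplex : Algebra ℂ (FormalSeries S) :=
  Algebra.ofModule
    (fun c f g => by
      ext m; simp only [smul_apply, mul_apply, Finset.mul_sum, mul_assoc])
    (fun c f g => by
      ext m; simp only [smul_apply, mul_apply, Finset.mul_sum, mul_left_comm])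

attribute [local instance] algebraComplex

/-- The ideal of series supported in degrees that are sums of at least `n` elements of `S`. -/
def depthIdeal (S : Type*) [AddCommSemigroup S] [FinitelyManySums S] (n : ℕ) :
    Ideal (FormalSeries S) where
  carrier := {f | ∀ m, f m ≠ 0 → ∃ s : Multiset S, n ≤ Multiset.card s ∧ multisetSum s = m}
  add_mem' {f g} hf hg m hm := by
    by_cases h : f m = 0
    · exact hg m fun h' => hm (by rw [add_apply, h, h', add_zero])
    · exact hf m h
  zero_mem' m hm := absurd rfl hm
  smul_mem' f g hg m hm := by
    obtain ⟨p, hp, hne⟩ := Finset.exists_ne_zero_of_sum_ne_zero hm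
    obtain ⟨s, hs, hsum⟩ := hg p.2 (right_ne_zero_of_mul hne)
    obtain ⟨t, ht⟩ := exists_multisetSum_eq p.1
    exact ⟨t + s, by simp; omega, by rw [multisetSum_add, ht, hsum, mem_pairs.1 hp]⟩

theorem mul_mem_depthIdeal {a b : ℕ} {f g : FormalSeries S} (hf : f ∈ depthIdeal S a)
    (hg : g ∈ depthIdeal S b) : f * g ∈ depthIdeal S (a + b) := by
  intro m hm
  obtain ⟨p, hp, hne⟩ := Finset.exists_ne_zero_of_sum_ne_zero hm
  obtain ⟨s, hs, hsum⟩ := hg p.2 (right_ne_zero_of_mul hne)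
  obtain ⟨t, ht, htsum⟩ := hf p.1 (left_ne_zero_of_mul hne)
  exact ⟨t + s, by simp; omega, by rw [multisetSum_add, htsum, hsum, mem_pairs.1 hp]⟩

theorem mem_depthIdeal_one {f : FormalSeries S} (hf : f 0 = 0) : f ∈ depthIdeal S 1 := by
  intro m hm
  cases m with
  | zero => exact absurd hf hm
  | coe x => exact ⟨{x}, by simp, by simp [multisetSum]⟩

theorem pow_mem_depthIdeal {f : FormalSeries S} (hf : f 0 = 0) (n : ℕ) :
    f ^ n ∈ depthIdeal S n := by
  induction n with
  | zero =>
    intro m _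
    obtain ⟨s, hs⟩ := exists_multisetSum_eq m
    exact ⟨s, Nat.zero_le _, hs⟩
  | succ n ih => rw [pow_succ]; exact mul_mem_depthIdeal ih (mem_depthIdeal_one hf)

/-- The ideal of series that vanish at all summands of `m`. -/
def vanishIdeal (m : WithZero S) : Ideal (FormalSeries S) where
  carrier := {f | ∀ p q, p + q = m → f p = 0}
  add_mem' {f g} hf hg p q h := by rw [add_apply, hf p q h, hg p q h, add_zero]
  zero_mem' _ _ _ := rfl
  -- A summand of `p` is again a summand of `m`. Vanishing at `m` alone would not define an ideal.
  smul_mem' f g hg p q h := Finset.sum_eq_zero fun x hx => by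
    have hx := mem_pairs.1 hx
    rw [hg x.2 (x.1 + q) (by rw [← h, ← hx]; abel), mul_zero]

theorem apply_eq_zero_of_mem {m : WithZero S} {f : FormalSeries S} (hf : f ∈ vanishIdeal m) :
    f m = 0 := hf m 0 (add_zero m)

theorem apply_eq_of_mk_eq {m : WithZero S} {f g : FormalSeries S}
    (h : Ideal.Quotient.mk (vanishIdeal m) f = Ideal.Quotient.mk (vanishIdeal m) g) :
    f m = g m :=
  sub_eq_zero.1 (apply_eq_zero_of_mem (Ideal.Quotient.eq.1 h))

theorem ext_of_mk {f g : FormalSeries S}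
    (h : ∀ m, Ideal.Quotient.mk (vanishIdeal m) f = Ideal.Quotient.mk (vanishIdeal m) g) :
    f = g :=
  FormalSeries.ext' fun m => apply_eq_of_mk_eq (h m)

theorem exists_length_bound (m : WithZero S) :
    ∃ N : ℕ, ∀ s : Multiset S, multisetSum s = m → Multiset.card s < N := by
  obtain ⟨N, hN⟩ := ((finite_sums' m).image Multiset.card).bddAbove
  exact ⟨N + 1, fun s hs => Nat.lt_succ_of_le (hN ⟨s, hs, rfl⟩)⟩

/-- A strict bound for the lengths of the decompositions of `m`. -/
def lengthBound (m : WithZero S) : ℕ := (exists_length_bound m).choose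

theorem card_lt_lengthBound {m : WithZero S} {s : Multiset S} (hs : multisetSum s = m) :
    Multiset.card s < lengthBound m := (exists_length_bound m).choose_spec s hs

/-- If `p + q = m` and `p` splits into at least `n` parts, then adjoining a decomposition of `q`
gives one of `m` that is too long. This is what makes series without constant term nilpotent modulo
`vanishIdeal m`. -/
theorem depthIdeal_le {m : WithZero S} {n : ℕ} (hn : lengthBound m ≤ n) :
    depthIdeal S n ≤ vanishIdeal m := by
  intro f hf p q h
  by_contra hne
  obtain ⟨s, hs, hsum⟩ := hf p hne
  obtain ⟨t, ht⟩ := exists_multisetSum_eq q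
  have := card_lt_lengthBound (m := m) (s := s + t) (by rw [multisetSum_add, hsum, ht, h])
  simp at this
  omega

theorem pow_mem_vanishIdeal {f : FormalSeries S} (hf : f 0 = 0) {m : WithZero S} {n : ℕ}
    (hn : lengthBound m ≤ n) : f ^ n ∈ vanishIdeal m :=
  depthIdeal_le hn (pow_mem_depthIdeal hf n)

theorem mul_apply_zero (f g : FormalSeries S) : (f * g) 0 = f 0 * g 0 := by
  rw [mul_apply, Finset.sum_eq_single (0, 0)]
  · rintro ⟨a, b⟩ hp hne
    rw [mem_pairs] at hp
    exfalso
    cases a with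
    | zero => rw [show ((0 : WithZero S), b).1 = 0 from rfl, zero_add] at hp; exact hne (by
        simpa using hp)
    | coe a =>
      cases b with
      | zero => simp at hp
      | coe b => exact WithZero.coe_ne_zero (a := a + b) hp
  · intro h; exact absurd (mem_pairs.2 (zero_add 0)) h

/-! ### Evaluation of power series -/

/-- The value `∑ c_n f^n` at `f` of the power series `∑ c_n t^n`. -/
def ev (f : FormalSeries S) (p : PowerSeries ℂ) : FormalSeries S :=
  formalSum fun n : ℕ => PowerSeries.coeff n p • f ^ n

theorem ev_apply {f : FormalSeries S} (hf : f 0 = 0) (p : PowerSeries ℂ) {m : WithZero S} {N : ℕ}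
    (hN : lengthBound m ≤ N) :
    ev f p m = (Polynomial.aeval f (PowerSeries.trunc N p)) m := by
  rw [ev, formalSum_apply, finsum_eq_sum_of_support_subset (s := Finset.range N),
    Polynomial.aeval_def, PowerSeries.eval₂_trunc_eq_sum_range, sum_apply]
  · exact Finset.sum_congr rfl fun n _ => by rw [Algebra.smul_def]
  · intro n hn
    by_contra h
    refine hn ?_
    have := apply_eq_zero_of_mem
      (pow_mem_vanishIdeal hf (m := m) (n := n) (hN.trans (by simpa using h)))
    simp only [smul_apply, this, mul_zero]

theorem aeval_X_pow_dvd_mem {f : FormalSeries S} (hf : f 0 = 0) {m : WithZero S} {N : ℕ}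
    (hN : lengthBound m ≤ N) {P : Polynomial ℂ} (hP : Polynomial.X ^ N ∣ P) :
    Polynomial.aeval f P ∈ vanishIdeal m := by
  obtain ⟨Q, rfl⟩ := hP
  rw [map_mul, map_pow, Polynomial.aeval_X]
  exact Ideal.mul_mem_right _ _ (pow_mem_vanishIdeal hf hN)

theorem mk_ev {f : FormalSeries S} (hf : f 0 = 0) (p : PowerSeries ℂ) {m : WithZero S} {N : ℕ}
    (hN : lengthBound m ≤ N) :
    Ideal.Quotient.mk (vanishIdeal m) (ev f p) =
      Ideal.Quotient.mk (vanishIdeal m) (Polynomial.aeval f (PowerSeries.trunc N p)) := by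
  rw [Ideal.Quotient.eq]
  intro a b hab
  -- The bound `lengthBound a` is an arbitrary choice and need not be at most `N`, even though `a`
  -- is a summand of `m`. Truncating at a common larger `M` changes the polynomial only by a
  -- multiple of `X ^ N`.
  obtain ⟨M, hM⟩ : ∃ M, lengthBound a ≤ M ∧ N ≤ M := ⟨_, le_max_left _ _, le_max_right _ _⟩
  rw [sub_apply, ev_apply hf p hM.1, ← sub_apply, ← map_sub]
  refine aeval_X_pow_dvd_mem hf hN ?_ a b hab
  rw [Polynomial.X_pow_dvd_iff]
  intro d hd
  rw [Polynomial.coeff_sub, PowerSeries.coeff_trunc, PowerSeries.coeff_trunc, if_pos hd,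
    if_pos (hd.trans_le hM.2), sub_self]

/-- The truncation of a product and the product of the truncations agree in low degrees, so they
differ by a polynomial divisible by `X ^ lengthBound m`, whose value at `f` dies modulo `vanishIdeal
m`. -/
theorem ev_mul {f : FormalSeries S} (hf : f 0 = 0) (p q : PowerSeries ℂ) :
    ev f (p * q) = ev f p * ev f q := by
  refine ext_of_mk fun m => ?_
  rw [map_mul, mk_ev hf _ le_rfl, mk_ev hf p le_rfl, mk_ev hf q le_rfl, ← map_mul, ← map_mul,
    Ideal.Quotient.eq, ← map_sub]
  refine aeval_X_pow_dvd_mem hf le_rfl ?_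
  rw [Polynomial.X_pow_dvd_iff]
  intro d hd
  rw [Polynomial.coeff_sub, PowerSeries.coeff_trunc, if_pos hd,
    PowerSeries.coeff_mul_eq_coeff_trunc_mul_trunc _ _ hd, ← Polynomial.coe_mul,
    Polynomial.coeff_coe, sub_self]

theorem ev_add {f : FormalSeries S} (hf : f 0 = 0) (p q : PowerSeries ℂ) :
    ev f (p + q) = ev f p + ev f q := by
  refine ext_of_mk fun m => ?_
  rw [map_add, mk_ev hf _ le_rfl, mk_ev hf p le_rfl, mk_ev hf q le_rfl, ← map_add, ← map_add]
  exact congrArg _ (congrArg _ (map_add _ _ _))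

theorem ev_coe {f : FormalSeries S} (hf : f 0 = 0) (p : Polynomial ℂ) :
    ev f (p : PowerSeries ℂ) = Polynomial.aeval f p := by
  ext m
  rw [ev_apply hf _ (le_max_left _ (p.natDegree + 1)), PowerSeries.trunc_coe_eq_self]
  exact (Nat.lt_succ_self _).trans_le (le_max_right _ _)

/-- Evaluation at a series without constant term, as a ring homomorphism. -/
def evHom (f : FormalSeries S) (hf : f 0 = 0) : PowerSeries ℂ →+* FormalSeries S where
  toFun := ev f
  map_one' := by simpa using ev_coe hf 1
  map_zero' := by simpa using ev_coe hf 0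
  map_mul' := ev_mul hf
  map_add' := ev_add hf

theorem evHom_apply {f : FormalSeries S} (hf : f 0 = 0) (p : PowerSeries ℂ) :
    evHom f hf p = ev f p := rfl

theorem evHom_X {f : FormalSeries S} (hf : f 0 = 0) : evHom f hf PowerSeries.X = f := by
  rw [evHom_apply]
  simpa using ev_coe hf Polynomial.X

/-! ### Exponential and logarithm of formal series -/

theorem exp_eq_ev (f : FormalSeries S) : exp f = ev f (PowerSeries.exp ℂ) := by
  simp [exp, ev, PowerSeries.coeff_exp]

theorem mk_ev_eq_sum {f : FormalSeries S} (hf : f 0 = 0) (p : PowerSeries ℂ) {m : WithZero S}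
    {N : ℕ} (hN : lengthBound m ≤ N) :
    Ideal.Quotient.mk (vanishIdeal m) (ev f p) =
      ∑ n ∈ Finset.range N, PowerSeries.coeff n p • (Ideal.Quotient.mk (vanishIdeal m) f) ^ n := by
  rw [mk_ev hf p hN, Polynomial.aeval_def, PowerSeries.eval₂_trunc_eq_sum_range, map_sum]
  refine Finset.sum_congr rfl fun n _ => ?_
  rw [← Algebra.smul_def, ← map_pow]
  rfl

theorem mk_pow_eq_zero {f : FormalSeries S} (hf : f 0 = 0) {m : WithZero S} {N : ℕ}
    (hN : lengthBound m ≤ N) : (Ideal.Quotient.mk (vanishIdeal m) f) ^ N = 0 := by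
  rw [← map_pow]
  exact Ideal.Quotient.eq_zero_iff_mem.2 (pow_mem_vanishIdeal hf hN)

/-- The rational scalars on the truncated algebras. -/
@[reducible]
def ratModule (m : WithZero S) : Module ℚ (FormalSeries S ⧸ vanishIdeal m) :=
  Module.compHom _ (algebraMap ℚ ℂ)

/-- Links the formal exponential to the exponential of nilpotent elements, whose functional equation
then passes to `exp` one truncation at a time. -/
theorem mk_exp {f : FormalSeries S} (hf : f 0 = 0) (m : WithZero S) :
    letI := ratModule m
    Ideal.Quotient.mk (vanishIdeal m) (exp f) =
      IsNilpotent.exp (Ideal.Quotient.mk (vanishIdeal m) f) := by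
  let := ratModule m
  rw [IsNilpotent.exp_eq_sum (mk_pow_eq_zero hf le_rfl), exp_eq_ev, mk_ev_eq_sum hf _ le_rfl]
  refine Finset.sum_congr rfl fun n _ => ?_
  rw [PowerSeries.coeff_exp, one_div]
  rfl

theorem mk_exp_congr {f g : FormalSeries S} (hf : f 0 = 0) (hg : g 0 = 0) {m : WithZero S}
    (h : Ideal.Quotient.mk (vanishIdeal m) f = Ideal.Quotient.mk (vanishIdeal m) g) :
    Ideal.Quotient.mk (vanishIdeal m) (exp f) = Ideal.Quotient.mk (vanishIdeal m) (exp g) := by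
  rw [mk_exp hf, mk_exp hg, h]

theorem exp_add {f g : FormalSeries S} (hf : f 0 = 0) (hg : g 0 = 0) :
    exp (f + g) = exp f * exp g := by
  refine ext_of_mk fun m => ?_
  let := ratModule m
  rw [map_mul, mk_exp hf, mk_exp hg, mk_exp (by rw [add_apply, hf, hg, add_zero]), map_add]
  exact IsNilpotent.exp_add_of_commute (Commute.all _ _) ⟨_, mk_pow_eq_zero hf le_rfl⟩
    ⟨_, mk_pow_eq_zero hg le_rfl⟩

theorem exp_zero : exp (0 : FormalSeries S) = 1 := by
  refine ext_of_mk fun m => ?_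
  let := ratModule m
  rw [mk_exp rfl, map_zero, IsNilpotent.exp_zero, map_one]

theorem exp_neg_mul_exp {f : FormalSeries S} (hf : f 0 = 0) : exp (-f) * exp f = 1 := by
  rw [← exp_add (by rw [neg_apply, hf, neg_zero]) hf, neg_add_cancel, exp_zero]

theorem exp_sum {ι : Type*} (s : Finset ι) (f : ι → FormalSeries S) (hf : ∀ i ∈ s, f i 0 = 0) :
    exp (∑ i ∈ s, f i) = ∏ i ∈ s, exp (f i) := by
  classical
  induction s using Finset.induction_on with
  | empty => simpa using exp_zero
  | insert a s ha ih =>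
    rw [Finset.sum_insert ha, Finset.prod_insert ha, exp_add (hf a (by simp)), ih]
    · exact fun i hi => hf i (by simp [hi])
    · rw [sum_apply]
      exact Finset.sum_eq_zero fun i hi => hf i (by simp [hi])

/-- The power series exp t - 1 is t times a unit q, so `exp f = 1` means f · q(f) = 0, and
multiplying by q⁻¹(f) leaves f = 0. -/
theorem eq_zero_of_exp_eq_one {f : FormalSeries S} (hf : f 0 = 0) (h : exp f = 1) : f = 0 := by
  let q : PowerSeries ℂ := PowerSeries.mk fun n => ((n + 1).factorial : ℂ)⁻¹
  have hq : PowerSeries.exp ℂ = PowerSeries.X * q + 1 := by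
    ext n
    cases n with
    | zero => simp
    | succ n =>
      rw [map_add, PowerSeries.coeff_succ_X_mul]
      simp [q, PowerSeries.coeff_exp, PowerSeries.coeff_one]
  have hinv : q * q⁻¹ = 1 := PowerSeries.mul_inv_cancel q (by simp [q])
  have h1 : f * evHom f hf q = 0 := by
    have : exp f = f * evHom f hf q + 1 := by
      rw [exp_eq_ev, ← evHom_apply hf, hq, map_add, map_mul, map_one, evHom_X]
    rw [h] at this
    simpa using this.symm
  calc f = f * evHom f hf (q * q⁻¹) := by rw [hinv, map_one, mul_one]
    _ = 0 := by rw [map_mul, ← mul_assoc, h1, zero_mul]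

theorem exp_injective {f g : FormalSeries S} (hf : f 0 = 0) (hg : g 0 = 0) (h : exp f = exp g) :
    f = g := by
  have hg' : (-g) 0 = 0 := by rw [neg_apply, hg, neg_zero]
  refine sub_eq_zero.1 (eq_zero_of_exp_eq_one (by rw [sub_apply, hf, hg, sub_zero]) ?_)
  rw [sub_eq_add_neg, exp_add hf hg', h, mul_comm, exp_neg_mul_exp hg]

theorem ev_apply_zero {f : FormalSeries S} (hf : f 0 = 0) {p : PowerSeries ℂ}
    (hp : PowerSeries.constantCoeff p = 0) : ev f p 0 = 0 := by
  obtain ⟨q, rfl⟩ := PowerSeries.X_dvd_iff.2 hp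
  rw [ev_mul hf, mul_apply_zero, ← evHom_apply hf PowerSeries.X, evHom_X, hf, zero_mul]

theorem exp_ev {f : FormalSeries S} (hf : f 0 = 0) {p : PowerSeries ℂ}
    (hp : PowerSeries.constantCoeff p = 0) :
    exp (ev f p) = ev f ((PowerSeries.exp ℂ).subst p) := by
  refine ext_of_mk fun m => ?_
  have hs : PowerSeries.HasSubst p := PowerSeries.HasSubst.of_constantCoeff_zero' hp
  rw [exp_eq_ev, mk_ev_eq_sum (ev_apply_zero hf hp) _ le_rfl,
    mk_ev_eq_sum hf ((PowerSeries.exp ℂ).subst p) le_rfl]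
  have hpow : ∀ d, Ideal.Quotient.mk (vanishIdeal m) (ev f p) ^ d =
      ∑ n ∈ Finset.range (lengthBound m),
        PowerSeries.coeff n (p ^ d) • Ideal.Quotient.mk (vanishIdeal m) f ^ n := fun d => by
    rw [← mk_ev_eq_sum hf _ le_rfl, ← map_pow, ← evHom_apply hf, ← evHom_apply hf,
      map_pow (evHom f hf)]
  simp only [hpow, Finset.smul_sum]
  rw [Finset.sum_comm]
  refine Finset.sum_congr rfl fun n hn => ?_
  rw [PowerSeries.coeff_subst' hs, finsum_eq_sum_of_support_subset
    (s := Finset.range (lengthBound m)), Finset.sum_smul]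
  · exact Finset.sum_congr rfl fun d _ => by rw [smul_smul, smul_eq_mul]
  · intro d hd
    by_contra h
    refine hd ?_
    simp only [Finset.coe_range, Set.mem_Iio, not_lt, Finset.mem_range] at h hn
    -- As `p` has no constant term, p^d starts in degree at least d, so only the d below the bound
    -- reach degree n.
    have : PowerSeries.X ^ d ∣ p ^ d := pow_dvd_pow_of_dvd (PowerSeries.X_dvd_iff.2 hp) d
    simp only [PowerSeries.X_pow_dvd_iff.1 this n (hn.trans_le h), smul_zero]

/-- The power series `-log (1 - t) = ∑ t^n / n`. -/
def negLogSeries : PowerSeries ℂ := PowerSeries.mk fun n => (n : ℂ)⁻¹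

/-- The term n = 0 vanishes by the convention `(0 : ℂ)⁻¹ = 0`. -/
theorem constantCoeff_negLogSeries : PowerSeries.constantCoeff negLogSeries = 0 := by
  simp [negLogSeries]

/-- The left side y satisfies y(0) = 1 and (1 - t) y' = -y, since the derivative of `negLogSeries`
is the geometric series. The differential equation determines all coefficients recursively. -/
theorem exp_subst_neg_negLogSeries :
    (PowerSeries.exp ℂ).subst (-negLogSeries) = 1 - PowerSeries.X := by
  have hc : PowerSeries.constantCoeff (-negLogSeries) = 0 := by
    rw [map_neg, constantCoeff_negLogSeries, neg_zero]
  have hs : PowerSeries.HasSubst (-negLogSeries) :=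
    PowerSeries.HasSubst.of_constantCoeff_zero' hc
  set y := (PowerSeries.exp ℂ).subst (-negLogSeries) with hy
  have hd : PowerSeries.derivative ℂ negLogSeries = PowerSeries.mk 1 := by
    ext n
    have : (n : ℂ) + 1 ≠ 0 := by exact_mod_cast Nat.succ_ne_zero n
    simp [negLogSeries, PowerSeries.coeff_derivative, this]
  have hgeom : (PowerSeries.mk 1 : PowerSeries ℂ) * (1 - PowerSeries.X) = 1 :=
    PowerSeries.mk_one_mul_one_sub_eq_one ℂ
  have hy' : PowerSeries.derivative ℂ y = -(y * PowerSeries.mk 1) := by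
    rw [hy, PowerSeries.derivative_subst hs, PowerSeries.derivative_exp, map_neg, hd]
    ring
  have h0 : PowerSeries.coeff 0 y = 1 := by
    rw [hy, PowerSeries.coeff_subst' hs, finsum_eq_single _ 0]
    · simp
    · intro n hn
      simp [hc, hn]
  have hrec : (1 - PowerSeries.X) * PowerSeries.derivative ℂ y = -y := by
    rw [hy']; linear_combination (-y) * hgeom
  have hcoeff : ∀ n, PowerSeries.coeff (n + 1) y = PowerSeries.coeff (n + 1)
      (1 - PowerSeries.X : PowerSeries ℂ) := by
    intro n
    induction n with
    | zero =>
      have := congrArg (PowerSeries.coeff 0) hrec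
      rw [sub_mul, map_sub, map_neg, h0] at this
      simpa [PowerSeries.coeff_derivative, PowerSeries.coeff_one] using this
    | succ n ih =>
      have := congrArg (PowerSeries.coeff (n + 1)) hrec
      rw [sub_mul, map_sub, map_neg, PowerSeries.coeff_succ_X_mul, one_mul,
        PowerSeries.coeff_derivative, PowerSeries.coeff_derivative, ih] at this
      have hne : ((n + 1 : ℕ) : ℂ) + 1 ≠ 0 := by exact_mod_cast Nat.succ_ne_zero (n + 1)
      have hz : PowerSeries.coeff (n + 1 + 1) (1 - PowerSeries.X : PowerSeries ℂ) = 0 := by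
        simp [PowerSeries.coeff_one, PowerSeries.coeff_X]
      rw [hz]
      refine (mul_eq_zero.1 (?_ : _ * (((n + 1 : ℕ) : ℂ) + 1) = 0)).resolve_right hne
      rw [sub_eq_iff_eq_add.1 this]
      -- What remains is `n` times the coefficient of `1 - X` in degree n + 1: the first factor
      -- vanishes for n = 0, the second for n ≥ 1.
      cases n with
      | zero => simp [PowerSeries.coeff_one]
      | succ n => simp [PowerSeries.coeff_one, PowerSeries.coeff_X]
  ext n
  cases n with
  | zero => simpa using h0
  | succ n => exact hcoeff n

/-- The series `-log (1 - f) = ∑ f^n / n`. -/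
def negLog (f : FormalSeries S) : FormalSeries S := ev f negLogSeries

theorem negLog_apply_zero {f : FormalSeries S} (hf : f 0 = 0) : negLog f 0 = 0 :=
  ev_apply_zero hf constantCoeff_negLogSeries

theorem exp_neg_negLog {f : FormalSeries S} (hf : f 0 = 0) : exp (-negLog f) = 1 - f := by
  have : -negLog f = ev f (-negLogSeries) := by
    rw [negLog, ← evHom_apply hf, ← evHom_apply hf, map_neg]
  rw [this, exp_ev hf (by rw [map_neg, constantCoeff_negLogSeries, neg_zero]),
    exp_subst_neg_negLogSeries, ← evHom_apply hf, map_sub, map_one, evHom_X]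

end FormalSeries

/-! ### Homogeneous bases and monomial bases of the chain spaces -/

namespace GradedColorLie

variable {Γ A L : Type*} [AddCommSemigroup Γ] [AddCommGroup A] {θ : ColoringMap A}
  [AddCommGroup L] [Module ℂ L] (𝔏 : GradedColorLie Γ θ L)

/-- A basis of `L` consisting of homogeneous elements. -/
structure HomogBasis (J : Type*) where
  /-- the basis of `L` -/
  basis : Module.Basis J ℂ L
  /-- the degrees of the basis elements -/
  deg : J → Γ × A
  piece_eq : ∀ i, 𝔏.piece i = Submodule.span ℂ (basis '' (deg ⁻¹' {i}))

namespace HomogBasis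

variable {𝔏} {J : Type*} (b : 𝔏.HomogBasis J)

theorem basis_mem (j : J) : b.basis j ∈ 𝔏.piece (b.deg j) := by
  rw [b.piece_eq]
  exact Submodule.subset_span ⟨j, rfl, rfl⟩

/-- The commutation factor `θ` of two basis elements. -/
def factor (j k : J) : ℂ := (θ (b.deg j).2 (b.deg k).2 : ℂ)

theorem factor_mul_factor (j k : J) : b.factor j k * b.factor k j = 1 := θ.mul_swap_coe _ _

theorem factor_ne_zero (j k : J) : b.factor j k ≠ 0 := Units.ne_zero _

/-- The sign of a basis element. -/
def sign (j : J) : ℂ := θ.sign (b.deg j).2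

theorem sign_eq (j : J) : b.sign j = 1 ∨ b.sign j = -1 := θ.sign_eq _

theorem factor_self (j : J) : b.factor j j = b.sign j := rfl

/-! ### A model of the `θ`-exterior algebra -/

section Model

variable [LinearOrder J]

/-- The coefficient in `x_j ∧ e_s = c e_{j + s}`. -/
def modelCoeff (j : J) (s : Multiset J) : ℂ :=
  if b.sign j = 1 ∧ j ∈ s then 0 else
    (s.map fun k => if k < j then -b.factor j k else 1).prod

/-- Left multiplication by `x_j` on the model. -/
def modelMul (j : J) : Module.End ℂ (Multiset J →₀ ℂ) :=
  Finsupp.linearCombination ℂ fun s => Finsupp.single (j ::ₘ s) (b.modelCoeff j s)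

theorem modelMul_single (j : J) (s : Multiset J) (a : ℂ) :
    b.modelMul j (Finsupp.single s a) = Finsupp.single (j ::ₘ s) (a * b.modelCoeff j s) := by
  rw [modelMul, Finsupp.linearCombination_single, Finsupp.smul_single, smul_eq_mul]

/-- For k < j, only x_j has to be moved past x_k, which produces the factor -θ(j,k); the case j < k
is the same relation multiplied by θ(j,k). For j = k, either both products vanish (even) or θ(j,j) =
-1 (odd). -/
theorem modelCoeff_rel (j k : J) (s : Multiset J) :
    b.modelCoeff k s * b.modelCoeff j (k ::ₘ s)
      + b.factor j k * (b.modelCoeff j s * b.modelCoeff k (j ::ₘ s)) = 0 := by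
  have key : ∀ j k : J, k < j → b.modelCoeff k s * b.modelCoeff j (k ::ₘ s)
      + b.factor j k * (b.modelCoeff j s * b.modelCoeff k (j ::ₘ s)) = 0 := by
    intro j k h
    simp only [modelCoeff, Multiset.mem_cons, h.ne, h.ne', false_or, Multiset.map_cons,
      Multiset.prod_cons, if_pos h, if_neg h.not_gt]
    split_ifs <;> ring
  rcases lt_trichotomy k j with h | rfl | h
  · exact key j k h
  · rcases b.sign_eq k with h | h
    · simp [modelCoeff, h]
    · rw [factor_self, h]; ring
  · have h1 := key k j h
    have h2 := b.factor_mul_factor j k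
    linear_combination b.factor j k * h1
      - b.modelCoeff k s * b.modelCoeff j (k ::ₘ s) * h2

theorem modelMul_rel (j k : J) :
    b.modelMul j * b.modelMul k + b.factor j k • (b.modelMul k * b.modelMul j) = 0 := by
  refine Finsupp.lhom_ext fun s a => ?_
  rw [LinearMap.add_apply, LinearMap.smul_apply, Module.End.mul_apply, Module.End.mul_apply,
    modelMul_single, modelMul_single, modelMul_single, modelMul_single, Multiset.cons_swap,
    Finsupp.smul_single, ← Finsupp.single_add, LinearMap.zero_apply, Finsupp.single_eq_zero,
    smul_eq_mul]
  linear_combination a * b.modelCoeff_rel j k s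

/-- The representation of the tensor algebra on the model. -/
def modelRep : TensorAlgebra ℂ L →ₐ[ℂ] Module.End ℂ (Multiset J →₀ ℂ) :=
  TensorAlgebra.lift ℂ (b.basis.constr ℂ b.modelMul)

theorem modelRep_basis (j : J) : b.modelRep (TensorAlgebra.ι ℂ (b.basis j)) = b.modelMul j := by
  rw [modelRep, TensorAlgebra.lift_ι_apply, Module.Basis.constr_basis]

/-- By bilinearity it suffices to treat basis elements. This lets the model act as a target for the
θ-exterior algebra, where independence of monomials is visible. -/
theorem modelRep_relator {i i' : Γ × A} {x y : L} (hx : x ∈ 𝔏.piece i) (hy : y ∈ 𝔏.piece i') :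
    b.modelRep (relator (θ := θ) i i' x y) = 0 := by
  rw [b.piece_eq] at hx hy
  induction hx, hy using Submodule.span_induction₂ with
  | mem_mem x y hx hy =>
    obtain ⟨j, rfl, rfl⟩ := hx
    obtain ⟨k, rfl, rfl⟩ := hy
    rw [relator, map_add, map_smul, map_mul, map_mul, modelRep_basis, modelRep_basis]
    exact b.modelMul_rel j k
  | zero_left y hy => simp [relator]
  | zero_right x hx => simp [relator]
  | add_left x y z _ _ _ h1 h2 =>
    have : relator (θ := θ) i i' (x + y) z = relator (θ := θ) i i' x z
        + relator (θ := θ) i i' y z := by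
      simp only [relator, map_add, add_mul, mul_add, smul_add]; abel
    rw [this, map_add, h1, h2, add_zero]
  | add_right x y z _ _ _ h1 h2 =>
    have : relator (θ := θ) i i' x (y + z) = relator (θ := θ) i i' x y
        + relator (θ := θ) i i' x z := by
      simp only [relator, map_add, add_mul, mul_add, smul_add]; abel
    rw [this, map_add, h1, h2, add_zero]
  | smul_left r x y _ _ h =>
    have : relator (θ := θ) i i' (r • x) y = r • relator (θ := θ) i i' x y := by
      simp only [relator, map_smul, smul_mul_assoc, mul_smul_comm, smul_add]
      rw [smul_comm]
    rw [this, map_smul, h, smul_zero]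
  | smul_right r x y _ _ h =>
    have : relator (θ := θ) i i' x (r • y) = r • relator (θ := θ) i i' x y := by
      simp only [relator, map_smul, smul_mul_assoc, mul_smul_comm, smul_add]
      rw [smul_comm]
    rw [this, map_smul, h, smul_zero]

/-- The comparison map from chains to the model. -/
def toModel : 𝔏.Chains →ₗ[ℂ] (Multiset J →₀ ℂ) :=
  𝔏.relIdeal.liftQ (LinearMap.applyₗ (Finsupp.single 0 1) ∘ₗ b.modelRep.toLinearMap) <| by
    refine Submodule.span_le.2 ?_
    rintro _ ⟨i, j, x, hx, y, hy, u, v, rfl⟩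
    simp [b.modelRep_relator hx hy]

theorem toModel_mkQ (w : TensorAlgebra ℂ L) :
    b.toModel (𝔏.relIdeal.mkQ w) = b.modelRep w (Finsupp.single 0 1) := rfl

end Model

/-! ### Monomials -/

/-- The tensor `x_{j_1} ⊗ ⋯ ⊗ x_{j_k}`. -/
def tensorMon (l : List J) : TensorAlgebra ℂ L :=
  (l.map fun j => TensorAlgebra.ι ℂ (b.basis j)).prod

theorem tensorMon_nil : b.tensorMon [] = 1 := rfl

theorem tensorMon_cons (j : J) (l : List J) :
    b.tensorMon (j :: l) = TensorAlgebra.ι ℂ (b.basis j) * b.tensorMon l := by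
  simp [tensorMon]

/-- The chain `x_{j_1} ∧ ⋯ ∧ x_{j_k}`. -/
def mon (l : List J) : 𝔏.Chains := 𝔏.relIdeal.mkQ (b.tensorMon l)

theorem mkQ_mul_congr (x : TensorAlgebra ℂ L) {v w : TensorAlgebra ℂ L}
    (h : 𝔏.relIdeal.mkQ v = 𝔏.relIdeal.mkQ w) :
    𝔏.relIdeal.mkQ (x * v) = 𝔏.relIdeal.mkQ (x * w) := by
  rw [Submodule.mkQ_apply, Submodule.mkQ_apply, Submodule.Quotient.eq] at h ⊢
  rw [← mul_sub]
  exact 𝔏.mul_mem_relIdeal x h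

theorem mon_swap (j k : J) (l : List J) :
    b.mon (k :: j :: l) = (-b.factor k j) • b.mon (j :: k :: l) := by
  rw [mon, mon, ← map_smul, ← sub_eq_zero, ← map_sub, Submodule.mkQ_apply,
    Submodule.Quotient.mk_eq_zero]
  have := 𝔏.relator_mem (b.basis_mem k) (b.basis_mem j) 1 (b.tensorMon l)
  simp only [relator, one_mul, add_mul, smul_mul_assoc, mul_assoc, ← tensorMon_cons] at this
  rwa [neg_smul, sub_neg_eq_add]

/-- Adjacent transpositions cost a factor -θ, which is invertible. -/
theorem mon_perm {l l' : List J} (h : l.Perm l') : ∃ c : ℂ, c ≠ 0 ∧ b.mon l = c • b.mon l' := by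
  induction h with
  | nil => exact ⟨1, one_ne_zero, by simp⟩
  | cons x h ih =>
    obtain ⟨c, hc, h⟩ := ih
    refine ⟨c, hc, ?_⟩
    rw [mon, mon, ← map_smul] at h ⊢
    rw [tensorMon_cons, tensorMon_cons, ← mul_smul_comm]
    exact mkQ_mul_congr _ h
  | swap x y l => exact ⟨_, neg_ne_zero.2 (b.factor_ne_zero y x), b.mon_swap x y l⟩
  | trans _ _ ih1 ih2 =>
    obtain ⟨c, hc, h⟩ := ih1
    obtain ⟨d, hd, h'⟩ := ih2
    exact ⟨c * d, mul_ne_zero hc hd, by rw [h, h', smul_smul]⟩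

/-- A multiset of basis elements is admissible if no even element is repeated. -/
def Admissible (s : Multiset J) : Prop :=
  ∀ j t, s = j ::ₘ j ::ₘ t → b.sign j ≠ 1

theorem admissible_of_cons {j : J} {s : Multiset J} (h : b.Admissible (j ::ₘ s)) :
    b.Admissible s := by
  rintro k t rfl
  exact h k (j ::ₘ t) (by rw [Multiset.cons_swap j k, Multiset.cons_swap j k])

theorem not_mem_of_admissible_cons {j : J} {s : Multiset J} (h : b.Admissible (j ::ₘ s)) :
    ¬(b.sign j = 1 ∧ j ∈ s) := by
  rintro ⟨h1, h2⟩
  obtain ⟨t, rfl⟩ := Multiset.exists_cons_of_mem h2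
  exact h j t rfl h1

/-- Bring the two equal even factors to the front: swapping them multiplies the monomial by -θ(j,j)
= -1, so twice the monomial is zero. -/
theorem mon_eq_zero {l : List J} (h : ¬b.Admissible l) : b.mon l = 0 := by
  simp only [Admissible, not_forall, not_not] at h
  obtain ⟨j, t, ht, hj⟩ := h
  obtain ⟨t, rfl⟩ := Quot.exists_rep t
  have hp : l.Perm (j :: j :: t) := Quotient.exact ht
  obtain ⟨c, _, hc⟩ := b.mon_perm hp
  have h2 := b.mon_swap j j t
  rw [factor_self, hj] at h2
  have h3 : (2 : ℂ) • b.mon (j :: j :: t) = 0 := by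
    rw [two_smul]
    nth_rewrite 1 [h2]
    rw [neg_one_smul, neg_add_cancel]
  rw [hc, (smul_eq_zero.1 h3).resolve_left two_ne_zero, smul_zero]

theorem toModel_cons [LinearOrder J] (j : J) (l : List J) :
    b.toModel (b.mon (j :: l)) = b.modelMul j (b.toModel (b.mon l)) := by
  rw [mon, mon, toModel_mkQ, toModel_mkQ, tensorMon_cons, map_mul, Module.End.mul_apply,
    modelRep_basis]

theorem toModel_nil [LinearOrder J] :
    b.toModel (b.mon []) = Finsupp.single 0 1 := by
  rw [mon, toModel_mkQ, tensorMon_nil, map_one, Module.End.one_apply]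

/-- Each left multiplication moves one multiset to one multiset, and by admissibility its
coefficient is a product of units. -/
theorem toModel_mon [LinearOrder J] (l : List J) :
    ∃ a : ℂ, b.toModel (b.mon l) = Finsupp.single (l : Multiset J) a ∧
      (b.Admissible l → a ≠ 0) := by
  induction l with
  | nil => exact ⟨1, b.toModel_nil, fun _ => one_ne_zero⟩
  | cons j l ih =>
    obtain ⟨a, ha, h⟩ := ih
    refine ⟨a * b.modelCoeff j l, by rw [toModel_cons, ha, modelMul_single]; rfl, fun hl => ?_⟩
    rw [← Multiset.cons_coe] at hl
    refine mul_ne_zero (h (b.admissible_of_cons hl)) ?_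
    rw [modelCoeff, if_neg (b.not_mem_of_admissible_cons hl)]
    refine Multiset.prod_ne_zero fun h0 => ?_
    obtain ⟨k, _, hk⟩ := Multiset.mem_map.1 h0
    split_ifs at hk with hlt
    · exact neg_ne_zero.2 (b.factor_ne_zero j k) hk
    · exact one_ne_zero hk

/-- The weight of a multiset of basis elements. -/
def weight (s : Multiset J) : WithZero (Γ × A) :=
  (s.map fun j => (b.deg j : WithZero (Γ × A))).sum

theorem weight_cons (j : J) (s : Multiset J) :
    b.weight (j ::ₘ s) = (b.deg j : WithZero (Γ × A)) + b.weight s := by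
  simp [weight]

theorem tensorMon_mem_homog (l : List J) : b.tensorMon l ∈ 𝔏.homog l.length (b.weight l) := by
  induction l with
  | nil => simpa [weight, tensorMon] using 𝔏.list_mem_homog []
  | cons j l ih =>
    rw [tensorMon_cons, ← Multiset.cons_coe, weight_cons]
    exact 𝔏.cons_mem_homog (b.basis_mem j) ih

theorem homog_eq (k : ℕ) (m : WithZero (Γ × A)) :
    𝔏.homog k m = Submodule.span ℂ (b.tensorMon '' {l | l.length = k ∧ b.weight l = m}) := by
  apply le_antisymm
  · refine Submodule.span_le.2 ?_
    rintro _ ⟨l, rfl, rfl, rfl⟩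
    induction l with
    | nil => exact Submodule.subset_span ⟨[], ⟨rfl, rfl⟩, rfl⟩
    | cons x l ih =>
      obtain ⟨i, x, hx⟩ := x
      simp only [List.map_cons, List.prod_cons, List.sum_cons, List.length_cons]
      rw [b.piece_eq] at hx
      generalize (l.map fun x => TensorAlgebra.ι ℂ (x.2 : L)).prod = w at ih ⊢
      induction hx, ih using Submodule.span_induction₂ with
      | mem_mem x y hx hy =>
        obtain ⟨j, rfl, rfl⟩ := hx
        obtain ⟨l', ⟨h1, h2⟩, rfl⟩ := hy
        refine Submodule.subset_span ⟨j :: l', ⟨by simp [h1], ?_⟩, b.tensorMon_cons _ _⟩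
        rw [← Multiset.cons_coe, weight_cons, h2]
      | zero_left y hy => simp
      | zero_right x hx => simp
      | add_left x y z _ _ _ h1 h2 => rw [map_add, add_mul]; exact Submodule.add_mem _ h1 h2
      | add_right x y z _ _ _ h1 h2 => rw [mul_add]; exact Submodule.add_mem _ h1 h2
      | smul_left r x y _ _ h =>
        rw [map_smul, smul_mul_assoc]; exact Submodule.smul_mem _ _ h
      | smul_right r x y _ _ h => rw [mul_smul_comm]; exact Submodule.smul_mem _ _ h
  · refine Submodule.span_le.2 ?_
    rintro _ ⟨l, ⟨rfl, rfl⟩, rfl⟩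
    exact b.tensorMon_mem_homog l

/-- The index set of the monomial basis of `C_k(L)_m`. -/
def chainIndex (k : ℕ) (m : WithZero (Γ × A)) : Set (Multiset J) :=
  {s | Multiset.card s = k ∧ b.weight s = m ∧ b.Admissible s}

theorem chain_eq (k : ℕ) (m : WithZero (Γ × A)) :
    𝔏.chain k m =
      Submodule.span ℂ (Set.range fun s : b.chainIndex k m => b.mon s.1.toList) := by
  rw [chain, b.homog_eq, Submodule.map_span]
  apply le_antisymm
  · refine Submodule.span_le.2 ?_
    rintro _ ⟨_, ⟨l, ⟨rfl, rfl⟩, rfl⟩, rfl⟩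
    by_cases h : b.Admissible l
    · obtain ⟨c, _, hc⟩ := b.mon_perm (l := l) (l' := (l : Multiset J).toList)
        (Multiset.coe_eq_coe.1 (Multiset.coe_toList _).symm)
      change b.mon l ∈ _
      rw [hc]
      exact Submodule.smul_mem _ _ (Submodule.subset_span ⟨⟨l, rfl, rfl, h⟩, rfl⟩)
    · change b.mon l ∈ _
      rw [b.mon_eq_zero h]
      exact Submodule.zero_mem _
  · refine Submodule.span_le.2 ?_
    rintro _ ⟨⟨s, rfl, rfl, h⟩, rfl⟩
    exact Submodule.subset_span ⟨_, ⟨s.toList, ⟨by simp, by simp⟩, rfl⟩, rfl⟩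

section ChainBasis

variable [LinearOrder J]

/-- The nonzero coefficient of a monomial in the model. -/
def leadCoeff (s : Multiset J) : ℂ := b.toModel (b.mon s.toList) s

theorem toModel_mon_toList (s : Multiset J) :
    b.toModel (b.mon s.toList) = Finsupp.single s (b.leadCoeff s) := by
  obtain ⟨a, ha, _⟩ := b.toModel_mon s.toList
  rw [Multiset.coe_toList] at ha
  rw [leadCoeff, ha, Finsupp.single_eq_same]

theorem leadCoeff_ne_zero {s : Multiset J} (h : b.Admissible s) : b.leadCoeff s ≠ 0 := by
  obtain ⟨a, ha, h'⟩ := b.toModel_mon s.toList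
  rw [Multiset.coe_toList] at ha h'
  rw [leadCoeff, ha, Finsupp.single_eq_same]
  exact h' h

/-- In the model, distinct admissible multisets give nonzero multiples of distinct basis vectors.
This excludes hidden relations in the quotient of the tensor algebra. -/
theorem linearIndependent_mon (k : ℕ) (m : WithZero (Γ × A)) :
    LinearIndependent ℂ fun s : b.chainIndex k m => b.mon s.1.toList := by
  refine LinearIndependent.of_comp b.toModel ?_
  have : (b.toModel ∘ fun s : b.chainIndex k m => b.mon s.1.toList) = fun s =>
      (Units.mk0 (b.leadCoeff s.1) (b.leadCoeff_ne_zero s.2.2.2)) •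
        (Finsupp.single s.1 1 : Multiset J →₀ ℂ) := by
    funext s
    rw [Function.comp_apply, toModel_mon_toList, Units.smul_mk0, Finsupp.smul_single, smul_eq_mul,
      mul_one]
  rw [this]
  exact LinearIndependent.units_smul
    ((Finsupp.linearIndependent_single_one ℂ (Multiset J)).comp _ Subtype.val_injective) _

/-- The monomial basis of `C_k(L)_m`. -/
def chainBasis (k : ℕ) (m : WithZero (Γ × A)) :
    Module.Basis (b.chainIndex k m) ℂ (𝔏.chain k m) :=
  (Module.Basis.span (b.linearIndependent_mon k m)).map (LinearEquiv.ofEq _ _ (b.chain_eq k m).symm)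

theorem coe_chainBasis (k : ℕ) (m : WithZero (Γ × A)) (s : b.chainIndex k m) :
    (b.chainBasis k m s : 𝔏.Chains) = b.mon s.1.toList := by
  rw [chainBasis, Module.Basis.map_apply, LinearEquiv.coe_ofEq_apply, Module.Basis.span_apply]

/-- Coordinates of a chain can be read off in the model, which is how the diagonal entries of `g`
are found later. -/
theorem chainBasis_repr (k : ℕ) (m : WithZero (Γ × A)) (c : 𝔏.chain k m) (s : b.chainIndex k m) :
    (b.chainBasis k m).repr c s = b.toModel c s.1 / b.leadCoeff s.1 := by
  have hs := b.leadCoeff_ne_zero s.2.2.2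
  rw [eq_div_iff hs]
  have : (b.leadCoeff s.1 • (b.chainBasis k m).coord s) =
      Finsupp.lapply s.1 ∘ₗ b.toModel ∘ₗ (𝔏.chain k m).subtype := by
    refine (b.chainBasis k m).ext fun t => ?_
    simp only [LinearMap.smul_apply, Module.Basis.coord_apply, Module.Basis.repr_self,
      LinearMap.comp_apply, Submodule.subtype_apply, coe_chainBasis, toModel_mon_toList,
      Finsupp.lapply_apply]
    by_cases h : t = s
    · subst h; simp
    · have h' : t.1 ≠ s.1 := fun h' => h (Subtype.ext h')
      simp [h, h']
  have := LinearMap.congr_fun this c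
  simpa [mul_comm] using this

end ChainBasis

end HomogBasis

end GradedColorLie

/-! ### Triangular bases and traces -/

section LinearAlgebra

open Module

/-- An endomorphism of a finite-dimensional complex vector space is triangular in a suitable
basis.  The basis is ordered by a height function. -/
theorem LinearMap.exists_triangular_basis (n : ℕ) : ∀ {V : Type*} [AddCommGroup V] [Module ℂ V]
    [FiniteDimensional ℂ V], finrank ℂ V = n → ∀ f : V →ₗ[ℂ] V,
    ∃ (ι : Type) (_ : Fintype ι) (b : Basis ι ℂ V) (c : ι → ℂ) (h : ι → ℕ),
      ∀ j, f (b j) - c j • b j ∈ Submodule.span ℂ (b '' {k | h k < h j}) := by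
  induction n with
  | zero =>
    intro V _ _ _ hn f
    have : Subsingleton V := finrank_zero_iff.1 hn
    exact ⟨Empty, inferInstance, Basis.empty V, Empty.elim, Empty.elim, fun j => j.elim⟩
  | succ n ih =>
    intro V _ _ _ hn f
    have : Nontrivial V := nontrivial_of_finrank_pos (R := ℂ) (by omega)
    -- Split off an eigenvector, triangularize on the quotient by its line, and lift that basis.
    obtain ⟨μ, hμ⟩ := Module.End.exists_eigenvalue f
    obtain ⟨v, hv⟩ := hμ.exists_hasEigenvector
    have hfv : f v = μ • v := hv.apply_eq_smul
    let W : Submodule ℂ V := ℂ ∙ v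
    have hW : W ≤ W.comap f := by
      refine (Submodule.span_singleton_le_iff_mem _ _).2 ?_
      rw [Submodule.mem_comap, hfv]
      exact W.smul_mem _ (Submodule.mem_span_singleton_self v)
    have hrank : finrank ℂ (V ⧸ W) = n := by
      have h1 := W.finrank_quotient_add_finrank
      have h2 : finrank ℂ W = 1 := finrank_span_singleton hv.2
      omega
    obtain ⟨ι, _, b, c, h, hb⟩ := ih hrank (W.mapQ W f hW)
    let bW : Basis Unit ℂ W := (Basis.singleton Unit ℂ).map (LinearEquiv.toSpanNonzeroSingleton ℂ V v hv.2)
    let B := Basis.sumQuot bW b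
    have hB : ∀ i, W.mkQ (B (Sum.inr i)) = b i := fun i => by simp [B]
    have hB0 : B (Sum.inl ()) = v := by
      simp only [B, bW, Basis.sumQuot_inl, Basis.map_apply, Basis.singleton_apply]
      exact one_smul ℂ v
    -- Raising the heights of the lifted vectors by one places the eigenvector strictly below all of
    -- them.
    let H : Unit ⊕ ι → ℕ := Sum.elim (fun _ => 0) (fun i => h i + 1)
    refine ⟨Unit ⊕ ι, inferInstance, B, Sum.elim (fun _ => μ) c, H, ?_⟩
    rintro (⟨⟩ | i)
    · rw [hB0, hfv, Sum.elim_inl, sub_self]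
      exact Submodule.zero_mem _
    · rw [Sum.elim_inr]
      set N := Submodule.span ℂ (B '' {k | H k < H (Sum.inr i)}) with hN
      have hvN : W ≤ N := by
        refine (Submodule.span_singleton_le_iff_mem _ _).2 (Submodule.subset_span ?_)
        exact ⟨Sum.inl (), Nat.succ_pos _, hB0⟩
      have hmap : Submodule.span ℂ (b '' {k | h k < h i}) ≤ N.map W.mkQ := by
        refine Submodule.span_le.2 ?_
        rintro _ ⟨k, hk, rfl⟩
        exact ⟨B (Sum.inr k), Submodule.subset_span ⟨_, Nat.succ_lt_succ hk, rfl⟩, hB k⟩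
      obtain ⟨y, hy, hyi⟩ := hmap (hb i)
      rw [← hB i] at hyi
      -- The error term in the quotient lifts to a combination `y` of lower vectors; what is then
      -- left over is a multiple of the eigenvector, which is lower as well.
      have hmem : f (B (Sum.inr i)) - c i • B (Sum.inr i) - y ∈ W := by
        rw [← Submodule.Quotient.mk_eq_zero, ← Submodule.mkQ_apply, map_sub, hyi, map_sub, map_smul]
        exact sub_self _
      simpa using N.add_mem (hvN hmem) hy

/-- The trace of the powers of a triangular endomorphism. -/
theorem LinearMap.trace_pow_of_triangular {V ι : Type*} [AddCommGroup V] [Module ℂ V] [Fintype ι]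
    (f : V →ₗ[ℂ] V) (b : Basis ι ℂ V) (c : ι → ℂ) (h : ι → ℕ)
    (hf : ∀ j, f (b j) - c j • b j ∈ Submodule.span ℂ (b '' {k | h k < h j})) (r : ℕ) :
    LinearMap.trace ℂ V (f ^ r) = ∑ j, c j ^ r := by
  classical
  have hstab : ∀ j, ∀ x ∈ Submodule.span ℂ (b '' {k | h k < h j}),
      f x ∈ Submodule.span ℂ (b '' {k | h k < h j}) := by
    intro j x hx
    induction hx using Submodule.span_induction with
    | mem x hx =>
      obtain ⟨k, hk, rfl⟩ := hx
      have hsub : {l | h l < h k} ⊆ {l | h l < h j} := fun l (hl : h l < h k) => hl.trans hk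
      have h1 := Submodule.span_mono (R := ℂ) (Set.image_mono (f := b) hsub) (hf k)
      have h2 : b k ∈ Submodule.span ℂ (b '' {k | h k < h j}) :=
        Submodule.subset_span ⟨k, hk, rfl⟩
      have h3 := Submodule.add_mem _ h1 (Submodule.smul_mem _ (c k) h2)
      rwa [sub_add_cancel] at h3
    | zero => simp
    | add x y _ _ hx hy => rw [map_add]; exact Submodule.add_mem _ hx hy
    | smul a x _ hx => rw [map_smul]; exact Submodule.smul_mem _ a hx
  -- The spans of lower vectors are stable under `f`, so powers of `f` stay triangular with diagonal
  -- entries `c j ^ r`.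
  have hpow : ∀ j, (f ^ r) (b j) - c j ^ r • b j ∈ Submodule.span ℂ (b '' {k | h k < h j}) := by
    intro j
    induction r with
    | zero => simp
    | succ r ih =>
      have h1 := Submodule.add_mem _ (hstab j _ ih) (Submodule.smul_mem _ (c j ^ r) (hf j))
      rw [map_sub, map_smul, smul_sub, smul_smul, ← pow_succ, sub_add_sub_cancel] at h1
      rwa [pow_succ', Module.End.mul_apply]
  rw [LinearMap.trace_eq_matrix_trace ℂ b, Matrix.trace]
  refine Finset.sum_congr rfl fun j _ => ?_
  rw [Matrix.diag_apply, LinearMap.toMatrix_apply]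
  have hzero : ∀ x ∈ Submodule.span ℂ (b '' {k | h k < h j}), b.repr x j = 0 := by
    intro x hx
    have : Submodule.span ℂ (b '' {k | h k < h j}) ≤ LinearMap.ker (b.coord j) := by
      refine Submodule.span_le.2 ?_
      rintro _ ⟨k, hk, rfl⟩
      have hne : k ≠ j := fun hkj => (hkj ▸ hk : h j < h j).false
      simp [hne]
    exact this hx
  have := hzero _ (hpow j)
  rw [map_sub, map_smul, Finsupp.sub_apply, Finsupp.smul_apply, b.repr_self,
    Finsupp.single_eq_same, smul_eq_mul, mul_one] at this
  exact sub_eq_zero.1 this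

open Module.Basis in
/-- The trace is additive on short exact sequences. -/
theorem LinearMap.trace_eq_trace_restrict_add_trace_mapQ {V : Type*} [AddCommGroup V] [Module ℂ V]
    [FiniteDimensional ℂ V] (W : Submodule ℂ V) (e : V →ₗ[ℂ] V) (he : W ≤ W.comap e) :
    LinearMap.trace ℂ V e =
      LinearMap.trace ℂ W (e.restrict he) + LinearMap.trace ℂ (V ⧸ W) (W.mapQ W e he) := by
  classical
  let bW := Module.Free.chooseBasis ℂ W
  let bQ := Module.Free.chooseBasis ℂ (V ⧸ W)
  rw [LinearMap.trace_eq_matrix_trace ℂ (sumQuot bW bQ), LinearMap.trace_eq_matrix_trace ℂ bW,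
    LinearMap.trace_eq_matrix_trace ℂ bQ, Matrix.trace, Matrix.trace, Matrix.trace,
    Fintype.sum_sum_type]
  congr 1
  · refine Finset.sum_congr rfl fun i _ => ?_
    simp only [Matrix.diag_apply, LinearMap.toMatrix_apply, sumQuot_inl]
    have := sumQuot_repr_inl_of_mem bW bQ _ (he (bW i).2) i
    exact this
  · refine Finset.sum_congr rfl fun i _ => ?_
    simp only [Matrix.diag_apply, LinearMap.toMatrix_apply, sumQuot_repr_inr]
    rw [← sumQuot_inr bW bQ i, W.mapQ_apply]
    simp

end LinearAlgebra

/-! ### The trace of an automorphism on chains -/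

namespace GradedColorLie

variable {Γ A L G : Type*} [AddCommSemigroup Γ] [AddCommGroup A] {θ : ColoringMap A}
  [AddCommGroup L] [Module ℂ L] {𝔏 : GradedColorLie Γ θ L} [Group G]

namespace Action

variable (ρ : 𝔏.Action G)

theorem onPiece_pow (g : G) (i : Γ × A) (r : ℕ) : ρ.onPiece (g ^ r) i = ρ.onPiece g i ^ r := by
  induction r with
  | zero => ext x; simp [onPiece]
  | succ r ih =>
    rw [pow_succ, pow_succ, ← ih]
    ext x
    simp [onPiece]

theorem onChains_mkQ (g : G) (w : TensorAlgebra ℂ L) :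
    ρ.onChains g (𝔏.relIdeal.mkQ w) = 𝔏.relIdeal.mkQ (ρ.onTensor g w) := rfl

end Action

/-- A homogeneous basis of `L` in which the automorphism `g` is triangular. -/
structure TriangularBasis (ρ : 𝔏.Action G) (g : G) (J : Type*) extends 𝔏.HomogBasis J where
  /-- the diagonal entries -/
  eig : J → ℂ
  /-- the height function that orders the basis -/
  height : J → ℕ
  finite_fiber : ∀ i, (deg ⁻¹' {i}).Finite
  triangular : ∀ j, ρ.rep g (basis j) - eig j • basis j ∈
    Submodule.span ℂ (basis '' {k | height k < height j})
  trace_pow : ∀ i r, LinearMap.trace ℂ _ (ρ.onPiece (g ^ r) i) =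
    ∑ j ∈ (finite_fiber i).toFinset, eig j ^ r

open scoped Classical in
theorem exists_triangularBasis (hfin : ∀ i, FiniteDimensional ℂ (𝔏.piece i)) (ρ : 𝔏.Action G)
    (g : G) : ∃ ι : Γ × A → Type, Nonempty (TriangularBasis ρ g (Σ i, ι i)) := by
  have H := fun i => LinearMap.exists_triangular_basis _ rfl (ρ.onPiece g i)
  choose ι hι v c h hv using H
  have hcoe : ∀ j, 𝔏.isInternal.collectedBasis v j = (v j.1 j.2 : L) := fun j => by
    rw [DirectSum.IsInternal.collectedBasis_coe]
  have hfib : ∀ i : Γ × A, (Sigma.fst (β := ι) ⁻¹' {i}) = Set.range (Sigma.mk i) := by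
    intro i
    ext ⟨i', k⟩
    constructor
    · rintro rfl; exact ⟨k, rfl⟩
    · rintro ⟨k', hk⟩; cases hk; rfl
  have hfinite : ∀ i : Γ × A, (Sigma.fst (β := ι) ⁻¹' {i}).Finite := fun i => by
    rw [hfib]; exact Set.finite_range _
  refine ⟨ι, ⟨⟨⟨𝔏.isInternal.collectedBasis v, Sigma.fst, fun i => ?_⟩, fun j => c j.1 j.2,
    fun j => h j.1 j.2, hfinite, ?_, ?_⟩⟩⟩
  · rw [hfib, ← Set.range_comp]
    have : (𝔏.isInternal.collectedBasis v ∘ Sigma.mk i) = (𝔏.piece i).subtype ∘ v i :=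
      funext fun k => hcoe _
    rw [this, Set.range_comp, ← Submodule.map_span, (v i).span_eq, Submodule.map_top,
      Submodule.range_subtype]
  · rintro ⟨i, j⟩
    have := Submodule.mem_map_of_mem (f := (𝔏.piece i).subtype) (hv i j)
    rw [Submodule.map_span, ← Set.image_comp] at this
    rw [hcoe]
    refine Submodule.span_mono ?_ this
    rintro _ ⟨k, hk, rfl⟩
    exact ⟨⟨i, k⟩, hk, hcoe _⟩
  · intro i r
    rw [ρ.onPiece_pow, LinearMap.trace_pow_of_triangular _ (v i) (c i) (h i) (hv i)]
    refine Finset.sum_bij (fun k _ => ⟨i, k⟩) ?_ ?_ ?_ ?_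
    · simp
    · intro k _ l _ hkl; simpa using hkl
    · rintro ⟨i', k⟩ hk
      obtain rfl : i' = i := by simpa using hk
      exact ⟨k, Finset.mem_univ _, rfl⟩
    · simp

namespace TriangularBasis

variable {ρ : 𝔏.Action G} {g : G} {J : Type*} (b : TriangularBasis ρ g J)

/-- The total height of a multiset of basis elements. -/
def totalHeight (s : Multiset J) : ℕ := (s.map b.height).sum

/-- The span of the monomials of total height less than `n`. -/
def lowerSpan (n : ℕ) : Submodule ℂ (TensorAlgebra ℂ L) :=
  Submodule.span ℂ (b.tensorMon '' {l | b.totalHeight l < n})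

theorem mul_mem_lowerSpan {j : J} {n : ℕ} {w : TensorAlgebra ℂ L} (hw : w ∈ b.lowerSpan n) :
    TensorAlgebra.ι ℂ (b.basis j) * w ∈ b.lowerSpan (b.height j + n) := by
  have : b.lowerSpan n ≤ (b.lowerSpan (b.height j + n)).comap
      (LinearMap.mulLeft ℂ (TensorAlgebra.ι ℂ (b.basis j))) := by
    refine Submodule.span_le.2 ?_
    rintro _ ⟨l, hl, rfl⟩
    refine Submodule.subset_span ⟨j :: l, ?_, b.tensorMon_cons j l⟩
    have hl : b.totalHeight l < n := hl
    change b.totalHeight (j ::ₘ l) < _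
    rw [totalHeight, Multiset.map_cons, Multiset.sum_cons, ← totalHeight]
    omega
  exact this hw

theorem mul_mem_lowerSpan_of_lt {a n : ℕ} {x : L} {w : TensorAlgebra ℂ L}
    (hx : x ∈ Submodule.span ℂ (b.basis '' {k | b.height k < a})) (hw : w ∈ b.lowerSpan n) :
    TensorAlgebra.ι ℂ x * w ∈ b.lowerSpan (a + n) := by
  induction hx using Submodule.span_induction with
  | mem x hx =>
    obtain ⟨k, hk, rfl⟩ := hx
    refine Submodule.span_mono (Set.image_mono fun l hl => ?_) (b.mul_mem_lowerSpan hw)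
    exact lt_of_lt_of_le hl (Nat.add_le_add_right (le_of_lt hk) n)
  | zero => simp
  | add x y _ _ hx hy => rw [map_add, add_mul]; exact Submodule.add_mem _ hx hy
  | smul r x _ hx => rw [map_smul, smul_mul_assoc]; exact Submodule.smul_mem _ _ hx

theorem mul_tensorMon_mem_lowerSpan {a : ℕ} {x : L} (l : List J)
    (hx : x ∈ Submodule.span ℂ (b.basis '' {k | b.height k < a})) :
    TensorAlgebra.ι ℂ x * b.tensorMon l ∈ b.lowerSpan (a + b.totalHeight l) := by
  induction hx using Submodule.span_induction with
  | mem x hx =>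
    obtain ⟨k, hk, rfl⟩ := hx
    refine Submodule.subset_span ⟨k :: l, ?_, b.tensorMon_cons k l⟩
    have hk : b.height k < a := hk
    change b.totalHeight (k ::ₘ l) < _
    rw [totalHeight, Multiset.map_cons, Multiset.sum_cons, ← totalHeight]
    omega
  | zero => simp
  | add x y _ _ hx hy => rw [map_add, add_mul]; exact Submodule.add_mem _ hx hy
  | smul r x _ hx => rw [map_smul, smul_mul_assoc]; exact Submodule.smul_mem _ _ hx

/-- Write g x_j = λ_j x_j + u and g w = Λ w + v with lower terms u and v. Then g(x_j w) - λ_j Λ x_j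
w = u v + λ_j x_j v + Λ u w, and each term has smaller total height. -/
theorem onTensor_tensorMon (l : List J) :
    ρ.onTensor g (b.tensorMon l) - (l.map b.eig).prod • b.tensorMon l ∈
      b.lowerSpan (b.totalHeight l) := by
  induction l with
  | nil => simp [HomogBasis.tensorMon_nil]
  | cons j l ih =>
    have h1 := b.mul_tensorMon_mem_lowerSpan l (b.triangular j)
    have h2 := b.mul_mem_lowerSpan_of_lt (b.triangular j) ih
    have h3 := b.mul_mem_lowerSpan (j := j) ih
    have h4 := Submodule.add_mem _ (Submodule.add_mem _ h2
      (Submodule.smul_mem _ (b.eig j) h3)) (Submodule.smul_mem _ (l.map b.eig).prod h1)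
    have hh : b.totalHeight (j :: l : List J) = b.height j + b.totalHeight l := by
      simp [totalHeight]
    rw [hh, HomogBasis.tensorMon_cons, map_mul, Action.onTensor_ι, List.map_cons, List.prod_cons]
    convert h4 using 1
    simp only [map_sub, map_smul, sub_mul, mul_sub, smul_mul_assoc, mul_smul_comm, smul_sub,
      smul_smul]
    module

/-- Total height depends only on the multiset of factors, so monomials of lower height belong to
other multisets, and reordering them cannot produce `s`. Only the diagonal term contributes. -/
theorem toModel_onChains [LinearOrder J] (s : Multiset J) :
    b.toModel (ρ.onChains g (b.mon s.toList)) s = (s.map b.eig).prod * b.leadCoeff s := by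
  have h1 := b.onTensor_tensorMon s.toList
  rw [Multiset.coe_toList] at h1
  have h2 : ∀ w ∈ b.lowerSpan (b.totalHeight s), b.toModel (𝔏.relIdeal.mkQ w) s = 0 := by
    intro w hw
    have : b.lowerSpan (b.totalHeight s) ≤
        LinearMap.ker (Finsupp.lapply s ∘ₗ b.toModel ∘ₗ 𝔏.relIdeal.mkQ) := by
      refine Submodule.span_le.2 ?_
      rintro _ ⟨l, hl, rfl⟩
      obtain ⟨a, ha, _⟩ := b.toModel_mon l
      have hne : (l : Multiset J) ≠ s := fun h => (h ▸ hl : b.totalHeight s < _).false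
      change b.toModel (b.mon l) s = 0
      rw [ha, Finsupp.single_eq_of_ne hne.symm]
    exact this hw
  have h3 := h2 _ h1
  rw [map_sub, map_sub, map_smul, map_smul, Finsupp.sub_apply, Finsupp.smul_apply, sub_eq_zero,
    ← Action.onChains_mkQ] at h3
  rw [HomogBasis.mon, h3, smul_eq_mul, ← Multiset.prod_coe, ← Multiset.map_coe,
    Multiset.coe_toList]
  rfl

theorem trace_onChain [LinearOrder J] (k : ℕ) (m : WithZero (Γ × A))
    [Fintype (b.chainIndex k m)] :
    LinearMap.trace ℂ _ (ρ.onChain g k m) =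
      ∑ s : b.chainIndex k m, (s.1.map b.eig).prod := by
  classical
  rw [LinearMap.trace_eq_matrix_trace ℂ (b.chainBasis k m), Matrix.trace]
  refine Finset.sum_congr rfl fun s _ => ?_
  rw [Matrix.diag_apply, LinearMap.toMatrix_apply, HomogBasis.chainBasis_repr]
  have : ((ρ.onChain g k m (b.chainBasis k m s) : 𝔏.chain k m) : 𝔏.Chains) =
      ρ.onChains g (b.mon s.1.toList) := by
    rw [← HomogBasis.coe_chainBasis]; rfl
  rw [this, toModel_onChains, mul_div_cancel_right₀ _ (b.leadCoeff_ne_zero s.2.2.2)]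

end TriangularBasis

end GradedColorLie

/-! ### Traces on complexes and homology -/

/-- The trace is additive on short exact sequences with compatible endomorphisms. -/
theorem LinearMap.trace_eq_add_of_exact {K V U : Type*} [AddCommGroup K] [Module ℂ K]
    [AddCommGroup V] [Module ℂ V] [AddCommGroup U] [Module ℂ U] [FiniteDimensional ℂ V]
    (i : K →ₗ[ℂ] V) (D : V →ₗ[ℂ] U) (hi : Function.Injective i) (hD : Function.Surjective D)
    (hex : LinearMap.range i = LinearMap.ker D) (k : K →ₗ[ℂ] K) (e : V →ₗ[ℂ] V) (u : U →ₗ[ℂ] U)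
    (hk : ∀ x, i (k x) = e (i x)) (hu : ∀ x, D (e x) = u (D x)) :
    LinearMap.trace ℂ V e = LinearMap.trace ℂ K k + LinearMap.trace ℂ U u := by
  have he : LinearMap.ker D ≤ (LinearMap.ker D).comap e := fun x hx => by
    rw [Submodule.mem_comap, LinearMap.mem_ker, hu, LinearMap.mem_ker.1 hx, map_zero]
  rw [LinearMap.trace_eq_trace_restrict_add_trace_mapQ (LinearMap.ker D) e he]
  congr 1
  · let E : K ≃ₗ[ℂ] LinearMap.ker D :=
      (LinearEquiv.ofInjective i hi).trans (LinearEquiv.ofEq _ _ hex)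
    have hE : ∀ x, (E x : V) = i x := fun x => rfl
    rw [← LinearMap.trace_conj' k E]
    congr 1
    ext x
    obtain ⟨y, rfl⟩ := E.surjective x
    rw [LinearEquiv.conj_apply_apply, LinearEquiv.symm_apply_apply, hE, hk]
    rfl
  · let E : (V ⧸ LinearMap.ker D) ≃ₗ[ℂ] U := D.quotKerEquivOfSurjective hD
    have hE : ∀ x, E ((LinearMap.ker D).mkQ x) = D x := fun x => rfl
    rw [← LinearMap.trace_conj' _ E]
    congr 1
    ext x
    obtain ⟨y, rfl⟩ := hD x
    rw [← hE, LinearEquiv.conj_apply_apply, LinearEquiv.symm_apply_apply, hE, ← hu, ← hE]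
    rfl

theorem LinearMap.trace_of_subsingleton {V : Type*} [AddCommGroup V] [Module ℂ V]
    [Subsingleton V] (f : V →ₗ[ℂ] V) : LinearMap.trace ℂ V f = 0 := by
  rw [Subsingleton.elim f 0, map_zero]

/-- Used with `f k` the trace on the image d(C_k), which vanishes at both ends. -/
theorem Finset.sum_range_neg_one_pow_mul_add (f : ℕ → ℂ) (K : ℕ) :
    ∑ k ∈ Finset.range K, (-1) ^ k * (f k + f (k + 1)) = f 0 - (-1) ^ K * f K := by
  induction K with
  | zero => simp
  | succ K ih => rw [Finset.sum_range_succ, ih]; ring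

namespace GradedColorLie

variable {Γ A L G : Type*} [AddCommSemigroup Γ] [AddCommGroup A] {θ : ColoringMap A}
  [AddCommGroup L] [Module ℂ L] {𝔏 : GradedColorLie Γ θ L} [Group G]

/-! ### Finiteness of the chain spaces -/

theorem HomogBasis.finite_weight [FinitelyManySums (Γ × A)] {J : Type*} (b : 𝔏.HomogBasis J)
    (hb : ∀ i, (b.deg ⁻¹' {i}).Finite) (m : WithZero (Γ × A)) :
    {s : Multiset J | b.weight s = m}.Finite := by
  classical
  refine ((FinitelyManySums.finite_sums' m).biUnion
    (t := fun t => {s : Multiset J | s.map b.deg = t}) fun t _ => ?_).subset fun s hs => ?_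
  · have hF : (⋃ i ∈ t.toFinset, b.deg ⁻¹' {i}).Finite :=
      t.toFinset.finite_toSet.biUnion fun i _ => hb i
    -- A multiset with degrees `t` uses only basis elements from the finite union of the fibers over
    -- `t`, each at most `card t` times.
    refine (Multiset.finite_toSet (Multiset.powerset
      (Multiset.card t • hF.toFinset.val))).subset ?_
    rintro s rfl
    simp only [Set.mem_ofPred_eq, Multiset.mem_powerset]
    rw [Multiset.le_iff_count]
    intro j
    by_cases hj : j ∈ s
    · rw [Multiset.count_nsmul, Multiset.card_map, Multiset.count_eq_one_of_mem
        (Finset.nodup _), mul_one]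
      · exact Multiset.count_le_card _ _
      · simp only [Finset.mem_val, Set.Finite.mem_toFinset, Set.mem_iUnion]
        exact ⟨b.deg j, by simpa using ⟨j, hj, rfl⟩, rfl⟩
    · rw [Multiset.count_eq_zero_of_notMem hj]
      exact Nat.zero_le _
  · refine Set.mem_biUnion (x := s.map b.deg) ?_ rfl
    simpa [HomogBasis.weight] using hs

theorem HomogBasis.finite_chainIndex [FinitelyManySums (Γ × A)] {J : Type*} (b : 𝔏.HomogBasis J)
    (hb : ∀ i, (b.deg ⁻¹' {i}).Finite) (k : ℕ) (m : WithZero (Γ × A)) :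
    (b.chainIndex k m).Finite :=
  (b.finite_weight hb m).subset fun _ hs => hs.2.1

theorem HomogBasis.finiteDimensional_chain [FinitelyManySums (Γ × A)] {J : Type*}
    (b : 𝔏.HomogBasis J) (hb : ∀ i, (b.deg ⁻¹' {i}).Finite) (k : ℕ) (m : WithZero (Γ × A)) :
    FiniteDimensional ℂ (𝔏.chain k m) := by
  have := (b.finite_chainIndex hb k m).to_subtype
  rw [b.chain_eq]
  exact FiniteDimensional.span_of_finite ℂ (Set.finite_range _)

theorem HomogBasis.finite_chain_ne_bot [FinitelyManySums (Γ × A)] {J : Type*}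
    (b : 𝔏.HomogBasis J) (hb : ∀ i, (b.deg ⁻¹' {i}).Finite) (m : WithZero (Γ × A)) :
    {k | 𝔏.chain k m ≠ ⊥}.Finite := by
  refine ((b.finite_weight hb m).image Multiset.card).subset fun k hk => ?_
  by_contra h
  refine hk ?_
  have : IsEmpty (b.chainIndex k m) := ⟨fun s => h ⟨s.1, s.2.2.1, s.2.1⟩⟩
  rw [b.chain_eq, Set.range_eq_empty, Submodule.span_empty]

/-! ### The Euler–Poincaré principle -/

theorem bdry_chain_zero {m : WithZero (Γ × A)} {c : 𝔏.Chains} (hc : c ∈ 𝔏.chain 0 m) :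
    𝔏.bdry c = 0 := by
  obtain ⟨w, hw, rfl⟩ := hc
  have : 𝔏.homog 0 m ≤ LinearMap.ker 𝔏.diff := by
    refine Submodule.span_le.2 ?_
    rintro _ ⟨l, hl, _, rfl⟩
    rw [List.length_eq_zero_iff.1 hl]
    exact 𝔏.diff_one
  change 𝔏.relIdeal.mkQ (𝔏.diff w) = 0
  rw [LinearMap.mem_ker.1 (this hw), map_zero]

/-- Here d x = -(x · 1) - x ⊗ d 1 = 0. Hence there are no boundaries in C_0, and H_0 = C_0. -/
theorem bdry_chain_one {m : WithZero (Γ × A)} {c : 𝔏.Chains} (hc : c ∈ 𝔏.chain 1 m) :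
    𝔏.bdry c = 0 := by
  obtain ⟨w, hw, rfl⟩ := hc
  have : 𝔏.homog 1 m ≤ LinearMap.ker 𝔏.diff := by
    refine Submodule.span_le.2 ?_
    rintro _ ⟨l, hl, _, rfl⟩
    obtain ⟨x, rfl⟩ := List.length_eq_one_iff.1 hl
    rw [List.map_singleton, List.prod_singleton, SetLike.mem_coe, LinearMap.mem_ker]
    simpa [act_one, diff_one] using 𝔏.diff_cons x.2 1
  change 𝔏.relIdeal.mkQ (𝔏.diff w) = 0
  rw [LinearMap.mem_ker.1 (this hw), map_zero]

namespace Action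

variable (ρ : 𝔏.Action G) (g : G) (m : WithZero (Γ × A))

/-- The action on the image of `C_k(L)_m` under the differential. -/
def onImage (k : ℕ) : (𝔏.chain k m).map 𝔏.bdry →ₗ[ℂ] (𝔏.chain k m).map 𝔏.bdry :=
  (ρ.onChains g).restrict (by
    rintro _ ⟨b, hb, rfl⟩
    exact ⟨ρ.onChains g b, ρ.onChains_mem_chain g hb, (ρ.onChains_bdry g b).symm⟩)

/-- The action on cycles. -/
def onCycle (k : ℕ) : 𝔏.cycle k m →ₗ[ℂ] 𝔏.cycle k m :=
  (ρ.onChains g).restrict fun _ hc => ρ.onChains_mem_cycle g hc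

/-- Uses the exact sequence 0 → Z_k → C_k → d(C_k) → 0. -/
theorem trace_onChain_eq (k : ℕ) [FiniteDimensional ℂ (𝔏.chain k m)] :
    LinearMap.trace ℂ _ (ρ.onChain g k m) =
      LinearMap.trace ℂ _ (ρ.onCycle g m k) + LinearMap.trace ℂ _ (ρ.onImage g m k) := by
  refine LinearMap.trace_eq_add_of_exact
    (Submodule.inclusion (inf_le_left : 𝔏.cycle k m ≤ 𝔏.chain k m))
    (𝔏.bdry.restrict fun c hc => Submodule.mem_map_of_mem hc)
    (Submodule.inclusion_injective _) ?_ ?_ _ _ _ (fun _ => rfl) ?_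
  · rintro ⟨_, c, hc, rfl⟩
    exact ⟨⟨c, hc⟩, rfl⟩
  · ext ⟨c, hc⟩
    rw [Submodule.range_inclusion]
    simp [LinearMap.restrict_apply]
  · rintro ⟨c, hc⟩
    exact Subtype.ext (ρ.onChains_bdry g c).symm

/-- Uses the exact sequence 0 → d(C_(k+1)) → Z_k → H_k → 0. -/
theorem trace_onCycle_eq (k : ℕ) [FiniteDimensional ℂ (𝔏.chain k m)] :
    LinearMap.trace ℂ _ (ρ.onCycle g m k) = LinearMap.trace ℂ _ (ρ.onImage g m (k + 1)) +
      LinearMap.trace ℂ _ (ρ.onHomology g k m) := by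
  have : FiniteDimensional ℂ (𝔏.cycle k m) :=
    Submodule.finiteDimensional_of_le (inf_le_left : 𝔏.cycle k m ≤ 𝔏.chain k m)
  refine LinearMap.trace_eq_add_of_exact
    (Submodule.inclusion (𝔏.boundary_le_cycle k m))
    (Submodule.mkQ _)
    (Submodule.inclusion_injective _) (Submodule.mkQ_surjective _) ?_ _ _ _ (fun _ => rfl)
    (fun _ => rfl)
  rw [Submodule.range_inclusion, Submodule.ker_mkQ]
  rfl

theorem trace_onImage_zero : LinearMap.trace ℂ _ (ρ.onImage g m 0) = 0 := by
  have : Subsingleton ((𝔏.chain 0 m).map 𝔏.bdry) := by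
    rw [Submodule.subsingleton_iff_eq_bot, Submodule.eq_bot_iff]
    rintro _ ⟨c, hc, rfl⟩
    exact bdry_chain_zero hc
  exact LinearMap.trace_of_subsingleton _

theorem trace_onImage_one : LinearMap.trace ℂ _ (ρ.onImage g m 1) = 0 := by
  have : Subsingleton ((𝔏.chain 1 m).map 𝔏.bdry) := by
    rw [Submodule.subsingleton_iff_eq_bot, Submodule.eq_bot_iff]
    rintro _ ⟨c, hc, rfl⟩
    exact bdry_chain_one hc
  exact LinearMap.trace_of_subsingleton _

theorem trace_onHomology_zero [FiniteDimensional ℂ (𝔏.chain 0 m)] :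
    LinearMap.trace ℂ _ (ρ.onHomology g 0 m) = LinearMap.trace ℂ _ (ρ.onChain g 0 m) := by
  rw [trace_onChain_eq, trace_onCycle_eq, trace_onImage_zero, trace_onImage_one, zero_add, add_zero]

variable {m}

theorem trace_onImage_eq_zero {k : ℕ} (h : 𝔏.chain k m = ⊥) :
    LinearMap.trace ℂ _ (ρ.onImage g m k) = 0 := by
  have : Subsingleton ((𝔏.chain k m).map 𝔏.bdry) := by
    rw [Submodule.subsingleton_iff_eq_bot, h, Submodule.map_bot]
  exact LinearMap.trace_of_subsingleton _

theorem trace_onChain_eq_zero {k : ℕ} (h : 𝔏.chain k m = ⊥) :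
    LinearMap.trace ℂ _ (ρ.onChain g k m) = 0 := by
  have : Subsingleton (𝔏.chain k m) := by rw [Submodule.subsingleton_iff_eq_bot, h]
  exact LinearMap.trace_of_subsingleton _

theorem trace_onHomology_eq_zero {k : ℕ} (h : 𝔏.chain k m = ⊥) :
    LinearMap.trace ℂ _ (ρ.onHomology g k m) = 0 := by
  have : Subsingleton (𝔏.cycle k m) := by
    rw [Submodule.subsingleton_iff_eq_bot, cycle, h, bot_inf_eq]
  have : Subsingleton (𝔏.Homology k m) := (Submodule.mkQ_surjective _).subsingleton
  exact LinearMap.trace_of_subsingleton _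

/-- By the two exact sequences, the traces on C_k and H_k differ by those on d(C_k) and d(C_(k+1)).
The alternating sum telescopes, with d(C_0) = 0 at the bottom and zero chain spaces at the top. -/
theorem finsum_trace_onChain (hf : ∀ k, FiniteDimensional ℂ (𝔏.chain k m))
    (hb : {k | 𝔏.chain k m ≠ ⊥}.Finite) :
    ∑ᶠ k : ℕ, (-1 : ℂ) ^ k * LinearMap.trace ℂ _ (ρ.onChain g k m) =
      ∑ᶠ k : ℕ, (-1 : ℂ) ^ k * LinearMap.trace ℂ _ (ρ.onHomology g k m) := by
  obtain ⟨K, hK⟩ := hb.bddAbove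
  have hK' : ∀ k, K + 1 ≤ k → 𝔏.chain k m = ⊥ := fun k hk => by
    by_contra h
    have := hK h
    omega
  rw [finsum_eq_sum_of_support_subset (s := Finset.range (K + 1)),
    finsum_eq_sum_of_support_subset (s := Finset.range (K + 1)), ← sub_eq_zero,
    ← Finset.sum_sub_distrib]
  · have h := Finset.sum_range_neg_one_pow_mul_add
      (fun k => LinearMap.trace ℂ _ (ρ.onImage g m k)) (K + 1)
    rw [trace_onImage_zero, trace_onImage_eq_zero ρ g (hK' _ le_rfl), mul_zero, sub_zero] at h
    rw [← h]
    refine Finset.sum_congr rfl fun k _ => ?_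
    have := hf k
    rw [trace_onChain_eq, trace_onCycle_eq]
    ring
  · intro k hk
    by_contra h
    refine hk ?_
    simp only [trace_onHomology_eq_zero ρ g (hK' k (by simpa using h)), mul_zero]
  · intro k hk
    by_contra h
    refine hk ?_
    simp only [trace_onChain_eq_zero ρ g (hK' k (by simpa using h)), mul_zero]

end Action

end GradedColorLie

/-! ### Computation rules for series and signs -/

theorem finsum_succ_eq {f : ℕ → ℂ} (h0 : f 0 = 0) : ∑ᶠ r : ℕ, f (r + 1) = ∑ᶠ n : ℕ, f n := by
  rw [← finsum_mem_range (g := fun r : ℕ => r + 1) (fun a b h => Nat.succ_injective h),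
    finsum_mem_def]
  refine finsum_congr fun n => ?_
  cases n with
  | zero => simp [h0]
  | succ n => rw [Set.indicator_of_mem (Set.mem_range_self n)]

namespace FormalSeries

variable {S : Type*}

open FinitelyManySums

theorem one_apply (m : WithZero S) [Decidable (m = 0)] :
    (1 : FormalSeries S) m = if m = 0 then 1 else 0 := by
  change (e 0 : FormalSeries S) m = _
  rw [e_apply]
  congr

theorem e_coe_apply_zero (x : S) : (e (x : WithZero S) : FormalSeries S) 0 = 0 := by
  simp [e]

variable [AddCommSemigroup S] [FinitelyManySums S]

attribute [local instance] algebraComplex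

theorem e_pow (a : WithZero S) (n : ℕ) : (e a : FormalSeries S) ^ n = e (n • a) := by
  induction n with
  | zero => rw [pow_zero, zero_smul]; rfl
  | succ n ih => rw [pow_succ, ih, e_mul_e, succ_nsmul]

/-- The semigroup need not be cancellative, so several `q` may satisfy `a + q = m` and the
coefficient is a sum over all of them. -/
theorem e_mul_apply (a : WithZero S) (f : FormalSeries S) (m : WithZero S) :
    (e a * f) m = ∑ᶠ q ∈ {q | a + q = m}, f q := by
  classical
  have hfin : {q | a + q = m}.Finite := by
    refine Set.Finite.of_finite_image (f := fun q => (a, q)) ((finite_pairs m).subset ?_)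
      (fun x _ y _ h => (Prod.mk.inj h).2)
    rintro _ ⟨q, hq, rfl⟩
    exact hq
  rw [mul_apply]
  refine Eq.trans (Eq.symm ?_) (finsum_mem_eq_finite_toFinset_sum (fun q => f q) hfin).symm
  refine Finset.sum_of_injOn (fun q => (a, q)) (fun x _ y _ h => (Prod.mk.inj h).2) ?_ ?_ ?_
  · intro q hq
    simpa [mem_pairs] using hq
  · rintro ⟨c, q⟩ hp hne
    rw [mem_pairs] at hp
    have : c ≠ a := by
      rintro rfl
      exact hne ⟨q, by simpa using hp, rfl⟩
    simp [e_apply, this]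
  · intro q _
    simp [e_apply]

theorem ev_smul {f : FormalSeries S} (hf : f 0 = 0) (c : ℂ) (p : PowerSeries ℂ) :
    ev f (c • p) = c • ev f p := by
  have h : ev f (PowerSeries.C c) = algebraMap ℂ _ c := by
    simpa using ev_coe hf (Polynomial.C c)
  rw [PowerSeries.smul_eq_C_mul, ev_mul hf, h, Algebra.smul_def]

theorem ev_smul_left (f : FormalSeries S) (c : ℂ) (p : PowerSeries ℂ) :
    ev (c • f) p = ev f (PowerSeries.rescale c p) := by
  rw [ev, ev]
  congr 1
  funext n
  rw [smul_pow, smul_smul, PowerSeries.coeff_rescale, mul_comm]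

theorem ev_sum {f : FormalSeries S} (hf : f 0 = 0) {ι : Type*} (s : Finset ι)
    (p : ι → PowerSeries ℂ) : ev f (∑ i ∈ s, p i) = ∑ i ∈ s, ev f (p i) :=
  map_sum (evHom f hf) p s

theorem pow_apply_zero (f : FormalSeries S) (n : ℕ) : (f ^ n) 0 = f 0 ^ n := by
  classical
  induction n with
  | zero => rw [pow_zero, pow_zero, one_apply, if_pos rfl]
  | succ n ih => rw [pow_succ, mul_apply_zero, ih, pow_succ]

theorem exp_apply_zero {f : FormalSeries S} (hf : f 0 = 0) : exp f 0 = 1 := by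
  rw [exp, formalSum_apply, finsum_eq_single _ 0]
  · classical
    simp [smul_apply, one_apply]
  · intro n hn
    rw [smul_apply, pow_apply_zero, hf, zero_pow hn, mul_zero]

end FormalSeries

namespace ColoringMap

variable {A Γ : Type*} [AddCommGroup A] (θ : ColoringMap A)

/-- The mixed terms θ(a,b) θ(b,a) cancel. Multiplicativity of ψ is what gives E^m E^n = E^(m+n). -/
theorem sign_add (a b : A) : θ.sign (a + b) = θ.sign a * θ.sign b := by
  have h := θ.mul_swap_coe a b
  simp only [sign, θ.map_add_left, θ.map_add_right, Units.val_mul]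
  linear_combination (θ a a : ℂ) * (θ b b : ℂ) * h

theorem degSign_coe (i : Γ × A) : θ.degSign (i : WithZero (Γ × A)) = θ.sign i.2 := rfl

theorem degSign_zero : θ.degSign (0 : WithZero (Γ × A)) = 1 := rfl

theorem degSign_add [AddCommSemigroup Γ] (m n : WithZero (Γ × A)) :
    θ.degSign (m + n) = θ.degSign m * θ.degSign n := by
  cases m with
  | zero => rw [zero_add, degSign_zero, one_mul]
  | coe i =>
    cases n with
    | zero => rw [add_zero, degSign_zero, mul_one]
    | coe j => exact θ.sign_add i.2 j.2

theorem degSign_nsmul [AddCommSemigroup Γ] (n : ℕ) (m : WithZero (Γ × A)) :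
    θ.degSign (n • m) = θ.degSign m ^ n := by
  induction n with
  | zero => rw [zero_smul, degSign_zero, pow_zero]
  | succ n ih => rw [succ_nsmul, degSign_add, ih, pow_succ]

theorem degSign_mul_self (m : WithZero (Γ × A)) : θ.degSign m * θ.degSign m = 1 := by
  cases m with
  | zero => exact one_mul 1
  | coe i => exact θ.mul_swap_coe i.2 i.2

theorem formalSum_smul_E_apply (c : WithZero (Γ × A) → ℂ) (m : WithZero (Γ × A)) :
    FormalSeries.formalSum (fun n => c n • θ.E n) m = c m * θ.degSign m := by
  rw [FormalSeries.formalSum_apply, finsum_eq_single _ m]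
  · simp [E, FormalSeries.smul_apply, FormalSeries.e_apply]
  · intro n hn
    simp [E, FormalSeries.smul_apply, FormalSeries.e_apply, hn.symm]

end ColoringMap

/-! ### The product formula over a triangular basis -/

namespace GradedColorLie

variable {Γ A L G : Type*} [AddCommSemigroup Γ] [AddCommGroup A] {θ : ColoringMap A}
  [AddCommGroup L] [Module ℂ L] {𝔏 : GradedColorLie Γ θ L} [Group G]

theorem HomogBasis.admissible_cons_iff {J : Type*} (b : 𝔏.HomogBasis J) {j : J}
    {s : Multiset J} :
    b.Admissible (j ::ₘ s) ↔ b.Admissible s ∧ ¬(b.sign j = 1 ∧ j ∈ s) := by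
  refine ⟨fun h => ⟨b.admissible_of_cons h, b.not_mem_of_admissible_cons h⟩, ?_⟩
  rintro ⟨hs, hj⟩ k t ht hk
  by_cases hjk : j = k
  · subst hjk
    rw [Multiset.cons_inj_right] at ht
    exact hj ⟨hk, ht ▸ Multiset.mem_cons_self _ _⟩
  -- When `j ≠ k`, both copies of `k` in `j ::ₘ s` already lie in `s`.
  · obtain ⟨u, rfl, hu⟩ := (Multiset.cons_eq_cons.1 ht).resolve_left (fun h => hjk h.1) |>.2
    obtain ⟨v, rfl, rfl⟩ :=
      (Multiset.cons_eq_cons.1 hu).resolve_left (fun h => hjk h.1.symm) |>.2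
    exact hs k v rfl hk

namespace TriangularBasis

variable {ρ : 𝔏.Action G} {g : G} {J : Type*} (b : TriangularBasis ρ g J)

/-- The admissible multisets of weight `m` with elements in `T`. -/
def admSet (T : Set J) (m : WithZero (Γ × A)) : Set (Multiset J) :=
  {s | b.weight s = m ∧ b.Admissible s ∧ ∀ j ∈ s, j ∈ T}

/-- The alternating sum over the admissible multisets with elements in `T` of the products of the
diagonal entries of `g`. -/
def admSeries (T : Set J) : FormalSeries (Γ × A) :=
  fun m => ∑ᶠ s ∈ b.admSet T m, (s.map fun j => -b.eig j).prod

theorem admSeries_apply (T : Set J) (m : WithZero (Γ × A)) :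
    b.admSeries T m = ∑ᶠ s ∈ b.admSet T m, (s.map fun j => -b.eig j).prod := rfl

theorem admSeries_empty : b.admSeries ∅ = 1 := by
  classical
  ext m
  rw [admSeries_apply, FormalSeries.one_apply]
  have : b.admSet ∅ m = if m = 0 then {0} else ∅ := by
    ext s
    constructor
    · rintro ⟨h1, _, h3⟩
      have hs : s = 0 := Multiset.eq_zero_of_forall_notMem h3
      subst hs
      have h1 : (0 : WithZero (Γ × A)) = m := h1
      simp [h1.symm]
    · intro hs
      split_ifs at hs with hm
      · obtain rfl : s = 0 := hs
        refine ⟨by rw [hm]; rfl, fun j t ht => ?_, by simp⟩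
        exact absurd ht.symm (Multiset.cons_ne_zero)
      · exact hs.elim
  rw [this]
  split_ifs
  · simp
  · simp

variable [FinitelyManySums (Γ × A)]

attribute [local instance] FormalSeries.algebraComplex

theorem finite_admSet (T : Set J) (m : WithZero (Γ × A)) : (b.admSet T m).Finite :=
  (b.finite_weight b.finite_fiber m).subset fun _ hs => hs.1

/-- Multisets over `insert j T` either avoid `j` or arise by adding one `j` to a multiset over `T'`.
The set `T'` is left open to serve both parities: `T` when `j` may occur once, `insert j T` when it
may be repeated. -/
theorem admSeries_insert {j : J} {T : Set J} (hj : j ∉ T) {T' : Set J}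
    (hT' : ∀ s : Multiset J, (b.Admissible s ∧ ∀ k ∈ s, k ∈ T') ↔
      b.Admissible (j ::ₘ s) ∧ ∀ k ∈ j ::ₘ s, k ∈ insert j T) :
    b.admSeries (insert j T) = b.admSeries T +
      (-b.eig j) • (FormalSeries.e (b.deg j : WithZero (Γ × A)) * b.admSeries T') := by
  ext m
  rw [FormalSeries.add_apply, FormalSeries.smul_apply, FormalSeries.e_mul_apply]
  have hq : {q | (b.deg j : WithZero (Γ × A)) + q = m}.Finite := by
    refine Set.Finite.of_finite_image (f := fun q => ((b.deg j : WithZero (Γ × A)), q))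
      ((FinitelyManySums.finite_pairs m).subset ?_) (fun x _ y _ h => (Prod.mk.inj h).2)
    rintro _ ⟨q, hq, rfl⟩
    exact hq
  have hdisj : {q | (b.deg j : WithZero (Γ × A)) + q = m}.PairwiseDisjoint (b.admSet T') := by
    intro p _ q _ hpq
    refine Set.disjoint_left.2 fun s hs hs' => hpq (hs.1.symm.trans hs'.1)
  simp only [admSeries_apply]
  rw [← finsum_mem_biUnion hdisj hq fun q _ => b.finite_admSet T' q]
  set U := ⋃ q ∈ {q | (b.deg j : WithZero (Γ × A)) + q = m}, b.admSet T' q with hU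
  have hUfin : U.Finite := hq.biUnion fun q _ => b.finite_admSet T' q
  have hsplit : b.admSet (insert j T) m = b.admSet T m ∪ (fun s => j ::ₘ s) '' U := by
    ext s
    constructor
    · rintro ⟨h1, h2, h3⟩
      by_cases hjs : j ∈ s
      · obtain ⟨t, rfl⟩ := Multiset.exists_cons_of_mem hjs
        have ht := (hT' t).2 ⟨h2, h3⟩
        rw [HomogBasis.weight_cons] at h1
        exact Or.inr ⟨t, Set.mem_biUnion (x := b.weight t) h1 ⟨rfl, ht⟩, rfl⟩
      · refine Or.inl ⟨h1, h2, fun k hk => (h3 k hk).resolve_left ?_⟩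
        rintro rfl
        exact hjs hk
    · rintro (⟨h1, h2, h3⟩ | ⟨t, ht, rfl⟩)
      · exact ⟨h1, h2, fun k hk => Or.inr (h3 k hk)⟩
      · obtain ⟨q, hq, h1, h2⟩ := Set.mem_iUnion₂.1 ht
        refine ⟨?_, (hT' t).1 h2⟩
        rw [HomogBasis.weight_cons, h1]
        exact hq
  have hd : Disjoint (b.admSet T m) ((fun s => j ::ₘ s) '' U) := by
    refine Set.disjoint_left.2 ?_
    rintro _ hs ⟨t, _, rfl⟩
    exact hj (hs.2.2 j (Multiset.mem_cons_self _ _))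
  rw [hsplit, finsum_mem_union hd (b.finite_admSet T m) (hUfin.image _),
    finsum_mem_image fun s _ t _ h => (Multiset.cons_inj_right j).1 h, mul_finsum_mem]
  simp only [Multiset.map_cons, Multiset.prod_cons]

/-- The factor of the product formula that belongs to a basis element. -/
def expFactor (j : J) : FormalSeries (Γ × A) :=
  FormalSeries.exp (-(b.sign j • FormalSeries.negLog
    ((b.sign j * b.eig j) • FormalSeries.e (b.deg j : WithZero (Γ × A)))))

theorem smul_e_apply_zero (c : ℂ) (j : J) :
    (c • FormalSeries.e (b.deg j : WithZero (Γ × A)) : FormalSeries (Γ × A)) 0 = 0 := by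
  rw [FormalSeries.smul_apply, FormalSeries.e_coe_apply_zero, mul_zero]

/-- For even `j` the recursion multiplies the series by 1 - λ_j e^(deg j). For odd `j` the new
series A' satisfies (1 + λ_j e^(deg j)) A' = A, and `expFactor` is the inverse of that factor. -/
theorem admSeries_insert_eq {j : J} {T : Set J} (hj : j ∉ T) :
    b.admSeries (insert j T) = b.expFactor j * b.admSeries T := by
  have hne : (1 : ℂ) ≠ -1 := by norm_num
  rcases b.sign_eq j with h | h
  · rw [b.admSeries_insert (T' := T) hj, expFactor, h, one_smul, one_mul,
      FormalSeries.exp_neg_negLog (b.smul_e_apply_zero _ _)]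
    · rw [sub_mul, one_mul, smul_mul_assoc, neg_smul, sub_eq_add_neg]
    · intro s
      rw [HomogBasis.admissible_cons_iff]
      constructor
      · rintro ⟨h1, h2⟩
        refine ⟨⟨h1, fun h3 => hj (h2 j h3.2)⟩, fun k hk => ?_⟩
        rcases Multiset.mem_cons.1 hk with rfl | hk
        · exact Or.inl rfl
        · exact Or.inr (h2 k hk)
      · rintro ⟨⟨h1, h2⟩, h3⟩
        refine ⟨h1, fun k hk => (h3 k (Multiset.mem_cons_of_mem hk)).resolve_left ?_⟩
        rintro rfl
        exact h2 ⟨h, hk⟩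
  · have h0 := b.smul_e_apply_zero (-b.eig j) j
    have h1 := b.admSeries_insert (T' := insert j T) hj (fun s => by
      rw [HomogBasis.admissible_cons_iff, h]
      constructor
      · rintro ⟨h1, h2⟩
        refine ⟨⟨h1, fun h3 => hne h3.1.symm⟩, fun k hk => ?_⟩
        rcases Multiset.mem_cons.1 hk with rfl | hk
        · exact Or.inl rfl
        · exact h2 k hk
      · rintro ⟨⟨h1, _⟩, h3⟩
        exact ⟨h1, fun k hk => h3 k (Multiset.mem_cons_of_mem hk)⟩)
    have h2 := FormalSeries.exp_neg_negLog h0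
    have h3 := FormalSeries.exp_neg_mul_exp (FormalSeries.negLog_apply_zero h0)
    rw [expFactor, h, neg_one_mul, neg_one_smul, neg_neg]
    set F := FormalSeries.exp (FormalSeries.negLog
      ((-b.eig j) • FormalSeries.e (b.deg j : WithZero (Γ × A)))) with hF
    rw [h2] at h3
    rw [← smul_mul_assoc] at h1
    have h4 : (1 - (-b.eig j) • FormalSeries.e (b.deg j : WithZero (Γ × A))) *
        b.admSeries (insert j T) = b.admSeries T := by
      rw [sub_mul, one_mul, sub_eq_iff_eq_add]
      exact h1
    rw [← h4, ← mul_assoc, mul_comm F, h3, one_mul]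

theorem admSeries_finset (T : Finset J) :
    b.admSeries T = ∏ j ∈ T, b.expFactor j := by
  classical
  induction T using Finset.induction_on with
  | empty => simpa using b.admSeries_empty
  | insert j T hj ih =>
    rw [Finset.coe_insert, b.admSeries_insert_eq (by simpa using hj), ih, Finset.prod_insert hj]

theorem logFactor_eq_ev (i : Γ × A) :
    ρ.logFactor g i = FormalSeries.ev (FormalSeries.e (i : WithZero (Γ × A)))
      (PowerSeries.mk fun n => (n : ℂ)⁻¹ * ρ.str (g ^ n) i * θ.sign i.2 ^ n) := by
  ext m
  rw [Action.logFactor, FormalSeries.ev, FormalSeries.formalSum_apply,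
    FormalSeries.formalSum_apply]
  -- The supertrace series runs over `r + 1`; including n = 0 is harmless because that term contains
  -- `(0 : ℂ)⁻¹ = 0`.
  refine Eq.trans (finsum_congr fun r => ?_) (finsum_succ_eq ?_)
  · rw [PowerSeries.coeff_mk, FormalSeries.e_pow, ColoringMap.E, smul_smul, θ.degSign_nsmul,
      θ.degSign_coe]
  · simp [FormalSeries.smul_apply]

/-- Insert tr(g^r) = ∑ λ_j^r and E^(r i) = ψ^r e^(r i), and interchange the sums: each λ_j
contributes ψ · (-log(1 - ψ λ_j e^i)). -/
theorem logFactor_eq_sum (i : Γ × A) :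
    ρ.logFactor g i = ∑ j ∈ (b.finite_fiber i).toFinset, b.sign j • FormalSeries.negLog
      ((b.sign j * b.eig j) • FormalSeries.e (b.deg j : WithZero (Γ × A))) := by
  have he := FormalSeries.e_coe_apply_zero i
  have : ∀ j ∈ (b.finite_fiber i).toFinset, b.sign j • FormalSeries.negLog
      ((b.sign j * b.eig j) • FormalSeries.e (b.deg j : WithZero (Γ × A))) =
      FormalSeries.ev (FormalSeries.e (i : WithZero (Γ × A))) (θ.sign i.2 •
        PowerSeries.rescale (θ.sign i.2 * b.eig j) FormalSeries.negLogSeries) := by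
    intro j hj
    obtain rfl : b.deg j = i := by simpa using hj
    rw [FormalSeries.ev_smul he, ← FormalSeries.ev_smul_left]
    rfl
  rw [Finset.sum_congr rfl this, ← FormalSeries.ev_sum he, logFactor_eq_ev]
  congr 1
  ext n
  rw [PowerSeries.coeff_mk, map_sum, Action.str, b.trace_pow, Finset.mul_sum, Finset.mul_sum,
    Finset.sum_mul]
  refine Finset.sum_congr rfl fun j _ => ?_
  rw [map_smul, PowerSeries.coeff_rescale, FormalSeries.negLogSeries, PowerSeries.coeff_mk,
    smul_eq_mul]
  ring

theorem negLog_smul_apply_zero (j : J) :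
    (b.sign j • FormalSeries.negLog
      ((b.sign j * b.eig j) • FormalSeries.e (b.deg j : WithZero (Γ × A)))) 0 = 0 := by
  rw [FormalSeries.smul_apply, FormalSeries.negLog_apply_zero (b.smul_e_apply_zero _ _), mul_zero]

theorem logFactor_apply_zero (i : Γ × A) : ρ.logFactor g i 0 = 0 := by
  rw [logFactor_eq_ev]
  exact FormalSeries.ev_apply_zero (FormalSeries.e_coe_apply_zero i) (by simp)

theorem exp_neg_logFactor (i : Γ × A) :
    FormalSeries.exp (-ρ.logFactor g i) =
      ∏ j ∈ (b.finite_fiber i).toFinset, b.expFactor j := by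
  rw [b.logFactor_eq_sum, ← Finset.sum_neg_distrib, FormalSeries.exp_sum]
  · rfl
  · intro j _
    rw [FormalSeries.neg_apply, b.negLog_smul_apply_zero, neg_zero]

theorem prod_exp_neg_logFactor (s : Finset (Γ × A)) :
    ∏ i ∈ s, FormalSeries.exp (-ρ.logFactor g i) = b.admSeries (b.deg ⁻¹' s) := by
  classical
  have hcoe : (b.deg ⁻¹' s) = ((s.biUnion fun i => (b.finite_fiber i).toFinset : Finset J) :
      Set J) := by
    ext j
    simp
  rw [hcoe, admSeries_finset, Finset.prod_biUnion]
  · exact Finset.prod_congr rfl fun i _ => b.exp_neg_logFactor i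
  · intro i _ i' _ hne
    refine Finset.disjoint_left.2 fun j hj hj' => hne ?_
    rw [Set.Finite.mem_toFinset] at hj hj'
    exact hj.symm.trans hj'

/-- Only finitely many multisets have weight `m`; once `s` contains all degrees occurring in them,
enlarging it no longer changes the coefficient. -/
theorem eventually_prod_exp_neg_logFactor (m : WithZero (Γ × A)) :
    ∀ᶠ s : Finset (Γ × A) in Filter.atTop,
      (∏ i ∈ s, FormalSeries.exp (-ρ.logFactor g i)) m = b.admSeries Set.univ m := by
  classical
  have hfin : (⋃ t ∈ {t : Multiset J | b.weight t = m}, {i | i ∈ t.map b.deg}).Finite :=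
    (b.finite_weight b.finite_fiber m).biUnion fun t _ => Multiset.finite_toSet _
  refine Filter.eventually_atTop.2 ⟨hfin.toFinset, fun s hs => ?_⟩
  rw [b.prod_exp_neg_logFactor, admSeries_apply, admSeries_apply]
  congr 1
  funext t
  have : t ∈ b.admSet (b.deg ⁻¹' s) m ↔ t ∈ b.admSet Set.univ m := by
    refine ⟨fun h => ⟨h.1, h.2.1, fun _ _ => trivial⟩, fun h => ⟨h.1, h.2.1, fun j hj => ?_⟩⟩
    exact hs (hfin.mem_toFinset.2 (Set.mem_biUnion (x := t) h.1 (Multiset.mem_map_of_mem _ hj)))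
  rw [this]

/-- Sorting the admissible multisets by cardinality k extracts (-1)^k from the products of the -λ_j
and leaves the trace on C_k. -/
theorem admSeries_univ_apply [LinearOrder J] (m : WithZero (Γ × A)) :
    b.admSeries Set.univ m =
      ∑ᶠ k : ℕ, (-1 : ℂ) ^ k * LinearMap.trace ℂ _ (ρ.onChain g k m) := by
  classical
  have hfin := b.finite_admSet Set.univ m
  obtain ⟨K, hK⟩ := (hfin.image Multiset.card).bddAbove
  have hlt : ∀ s ∈ b.admSet Set.univ m, Multiset.card s < K + 1 := fun s hs =>
    Nat.lt_succ_of_le (hK ⟨s, hs, rfl⟩)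
  have hsum : ∀ k : ℕ, (-1 : ℂ) ^ k * LinearMap.trace ℂ _ (ρ.onChain g k m) =
      ∑ s ∈ hfin.toFinset with Multiset.card s = k, (s.map fun j => -b.eig j).prod := by
    intro k
    have hk := b.finite_chainIndex b.finite_fiber k m
    let := hk.fintype
    rw [b.trace_onChain, Finset.mul_sum]
    refine Finset.sum_bij (fun s _ => s.1) ?_ (fun s _ t _ h => Subtype.ext h) ?_ ?_
    · rintro ⟨s, h1, h2, h3⟩ _
      rw [Finset.mem_filter, Set.Finite.mem_toFinset]
      exact ⟨⟨h2, h3, fun _ _ => trivial⟩, h1⟩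
    · intro s hs
      rw [Finset.mem_filter, Set.Finite.mem_toFinset] at hs
      exact ⟨⟨s, hs.2, hs.1.1, hs.1.2.1⟩, Finset.mem_univ _, rfl⟩
    · intro s _
      have : (fun j => -b.eig j) = fun j => (-1) * b.eig j := by funext j; ring
      rw [this, Multiset.prod_map_mul, Multiset.map_const', Multiset.prod_replicate, s.2.1]
  rw [admSeries_apply, finsum_mem_eq_finite_toFinset_sum _ hfin,
    finsum_eq_sum_of_support_subset (s := Finset.range (K + 1))]
  · rw [Finset.sum_congr rfl fun k _ => hsum k, Finset.sum_fiberwise_of_maps_to]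
    intro s hs
    exact Finset.mem_range.2 (hlt s (hfin.mem_toFinset.1 hs))
  · intro k hk
    rw [Function.mem_support, hsum] at hk
    obtain ⟨s, hs, _⟩ := Finset.exists_ne_zero_of_sum_ne_zero hk
    rw [Finset.mem_filter, Set.Finite.mem_toFinset] at hs
    rw [Finset.coe_range, Set.mem_Iio, ← hs.2]
    exact hlt s hs.1

end TriangularBasis

end GradedColorLie

/-! ### Coefficients of the logarithm and Möbius inversion -/

theorem finsum_eq_zero_add_finsum_succ {f : ℕ → ℂ} {K : ℕ} (hf : ∀ k, K ≤ k → f k = 0) :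
    ∑ᶠ k : ℕ, f k = f 0 + ∑ᶠ k : ℕ, f (k + 1) := by
  rw [finsum_eq_sum_of_support_subset (s := Finset.range (K + 1)),
    finsum_eq_sum_of_support_subset (s := Finset.range K), Finset.sum_range_succ', add_comm]
  · intro k hk
    by_contra h
    exact hk (hf _ (by simp at h; omega))
  · intro k hk
    by_contra h
    exact hk (hf _ (by simp at h; omega))

theorem ArithmeticFunction.sum_divisors_moebius (n : ℕ) :
    ∑ d ∈ n.divisors, ArithmeticFunction.moebius d = if n = 1 then 1 else 0 := by
  rw [← ArithmeticFunction.coe_mul_zeta_apply, ArithmeticFunction.moebius_mul_coe_zeta,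
    ArithmeticFunction.one_apply]

/-- The multinomial theorem as a sum over finitely supported functions. -/
theorem Finset.sum_pow_eq_sum_finsuppAntidiag {α R : Type*} [DecidableEq α] [CommRing R]
    [Algebra ℂ R] (D : Finset α) (x : α → R) (n : ℕ) :
    (∑ i ∈ D, x i) ^ n = ∑ s ∈ D.finsuppAntidiag n,
      ((n.factorial : ℂ) / (s.prod fun _ k => (k.factorial : ℂ))) • ∏ i ∈ D, x i ^ s i := by
  rw [Finset.sum_pow_eq_sum_piAntidiag]
  symm
  refine Finset.sum_bij (fun s _ => ⇑s) ?_ (fun s _ t _ h => DFunLike.coe_injective h) ?_ ?_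
  · intro s hs
    rw [Finset.mem_finsuppAntidiag] at hs
    exact Finset.mem_piAntidiag.2 ⟨hs.1, fun i hi => hs.2 (Finsupp.mem_support_iff.2 hi)⟩
  · intro k hk
    rw [Finset.mem_piAntidiag] at hk
    refine ⟨Finsupp.onFinset D k hk.2, ?_, rfl⟩
    rw [Finset.mem_finsuppAntidiag]
    exact ⟨hk.1, Finsupp.support_onFinset_subset⟩
  · intro s hs
    rw [Finset.mem_finsuppAntidiag] at hs
    have h := Nat.multinomial_spec D s
    rw [hs.1] at h
    have hne : (∏ i ∈ D, ((s i).factorial : ℂ)) ≠ 0 :=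
      Finset.prod_ne_zero_iff.2 fun i _ => by exact_mod_cast Nat.factorial_ne_zero _
    have hprod : (s.prod fun _ k => (k.factorial : ℂ)) = ∏ i ∈ D, ((s i).factorial : ℂ) :=
      Finsupp.prod_of_support_subset s hs.2 _ (by simp)
    have hm : (n.factorial : ℂ) / (s.prod fun _ k => (k.factorial : ℂ)) =
        (Nat.multinomial D s : ℂ) := by
      rw [hprod, div_eq_iff hne, ← h]
      push_cast
      ring
    rw [hm, Nat.cast_smul_eq_nsmul, nsmul_eq_mul]

namespace FormalSeries

variable {S : Type*} [AddCommSemigroup S] [FinitelyManySums S]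

open FinitelyManySums

theorem finite_summands (m : WithZero S) : {i : S | ∃ q, (i : WithZero S) + q = m}.Finite := by
  refine (((finite_pairs m).image Prod.fst).preimage (f := fun i : S => (i : WithZero S))
    (fun _ _ _ _ h => WithZero.coe_injective h)).subset ?_
  rintro i ⟨q, hq⟩
  exact ⟨(i, q), hq, rfl⟩

/-- The elements of `S` that are summands of `m`. -/
def summands (m : WithZero S) : Finset S := (finite_summands m).toFinset

theorem mem_summands {m : WithZero S} {i : S} :
    i ∈ summands m ↔ ∃ q, (i : WithZero S) + q = m := by
  simp [summands]

theorem mem_summands_of_nsmul {p q m : WithZero S} (h : p + q = m) {i : S} {n : ℕ} (hn : n ≠ 0)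
    (hi : n • (i : WithZero S) = p) : i ∈ summands m := by
  obtain ⟨k, rfl⟩ := Nat.exists_eq_succ_of_ne_zero hn
  rw [succ_nsmul'] at hi
  exact mem_summands.2 ⟨k • (i : WithZero S) + q, by rw [← add_assoc, hi, h]⟩

end FormalSeries

theorem Finsupp.multisetSum_toMultiset {S : Type*} [AddCommSemigroup S] (s : S →₀ ℕ) :
    FormalSeries.multisetSum (Finsupp.toMultiset s) =
      s.sum fun i n => n • (i : WithZero S) := by
  induction s using Finsupp.induction_linear with
  | zero => simp [FormalSeries.multisetSum]
  | add s t h1 h2 =>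
    rw [map_add, FormalSeries.multisetSum_add, h1, h2]
    exact (Finsupp.sum_add_index' (f := s) (g := t)
      (h := fun (i : S) (n : ℕ) => n • (i : WithZero S))
      (fun _ => zero_nsmul _) (fun _ _ _ => add_nsmul _ _ _)).symm
  | single i n => simp [FormalSeries.multisetSum, Multiset.map_nsmul, Multiset.sum_nsmul]

namespace ColoringMap

variable {A Γ : Type*} [AddCommGroup A] (θ : ColoringMap A)

theorem E_apply (m n : WithZero (Γ × A)) [Decidable (n = m)] :
    θ.E m n = if n = m then θ.degSign m else 0 := by
  rw [E, FormalSeries.smul_apply, FormalSeries.e_apply]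
  split_ifs <;> simp

variable [AddCommSemigroup Γ] [FinitelyManySums (Γ × A)]

attribute [local instance] FormalSeries.algebraComplex

theorem E_zero : θ.E (0 : WithZero (Γ × A)) = 1 := one_smul ℂ _

theorem E_mul_E (m n : WithZero (Γ × A)) : θ.E m * θ.E n = θ.E (m + n) := by
  rw [E, E, E, degSign_add, smul_mul_smul_comm, FormalSeries.e_mul_e]

theorem E_pow (m : WithZero (Γ × A)) (n : ℕ) : θ.E m ^ n = θ.E (n • m) := by
  induction n with
  | zero => rw [pow_zero, zero_smul, E_zero]
  | succ n ih => rw [pow_succ, ih, E_mul_E, succ_nsmul]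

theorem prod_smul_E_pow {ι : Type*} (D : Finset ι) (c : ι → ℂ) (m : ι → WithZero (Γ × A))
    (s : ι → ℕ) :
    ∏ i ∈ D, (c i • θ.E (m i)) ^ s i = (∏ i ∈ D, c i ^ s i) • θ.E (∑ i ∈ D, s i • m i) := by
  classical
  induction D using Finset.induction_on with
  | empty => simp [E_zero]
  | insert a D ha ih =>
    rw [Finset.prod_insert ha, Finset.prod_insert ha, Finset.sum_insert ha, ih, smul_pow, E_pow,
      smul_mul_smul_comm, E_mul_E]

/-- The coefficients of `-log (1 - ∑ c_i E^i)`. -/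
theorem negLog_apply (f : FormalSeries (Γ × A)) (hf : f 0 = 0) (c : Γ × A → ℂ)
    (hc : ∀ i : Γ × A, f (i : WithZero (Γ × A)) = c i * θ.degSign (i : WithZero (Γ × A)))
    (j : Γ × A) (T : Finset (Γ × A →₀ ℕ))
    (hT : ∀ s, s ∈ T ↔ (∀ i ∈ s.support, c i ≠ 0) ∧
      (s.sum fun i n => n • (i : WithZero (Γ × A))) = (j : WithZero (Γ × A))) :
    FormalSeries.negLog f (j : WithZero (Γ × A)) = θ.degSign (j : WithZero (Γ × A)) *
      ∑ s ∈ T, ((s.degree - 1).factorial : ℂ) / (s.prod fun _ n => (n.factorial : ℂ)) *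
        s.prod fun i n => c i ^ n := by
  classical
  set m : WithZero (Γ × A) := (j : WithZero (Γ × A)) with hm
  set D := FormalSeries.summands m with hD
  set N := FormalSeries.lengthBound m with hN
  -- Only summands of `m` influence the coefficient at `m`, so `f` may be replaced by a finite sum,
  -- to which the multinomial theorem applies.
  have hmk : Ideal.Quotient.mk (FormalSeries.vanishIdeal m) f =
      Ideal.Quotient.mk (FormalSeries.vanishIdeal m)
        (∑ i ∈ D, c i • θ.E (i : WithZero (Γ × A))) := by
    rw [Ideal.Quotient.eq]
    intro p q hpq
    rw [FormalSeries.sub_apply, FormalSeries.sum_apply, sub_eq_zero]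
    simp only [FormalSeries.smul_apply, E_apply]
    cases p with
    | zero => rw [hf]; simp
    | coe i =>
      have hi : i ∈ D := FormalSeries.mem_summands.2 ⟨q, hpq⟩
      simp [hc, hi]
  have h1 : FormalSeries.negLog f m = (∑ n ∈ Finset.range N,
      (n : ℂ)⁻¹ • (∑ i ∈ D, c i • θ.E (i : WithZero (Γ × A))) ^ n) m := by
    refine FormalSeries.apply_eq_of_mk_eq ?_
    rw [FormalSeries.negLog, FormalSeries.mk_ev_eq_sum hf _ le_rfl, map_sum]
    refine Finset.sum_congr rfl fun n _ => ?_
    rw [FormalSeries.negLogSeries, PowerSeries.coeff_mk, hmk, ← map_pow]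
    rfl
  let F : (Γ × A →₀ ℕ) → ℂ := fun s =>
    if (s.sum fun i n => n • (i : WithZero (Γ × A))) = m then
      ((s.degree - 1).factorial : ℂ) / (s.prod fun _ n => (n.factorial : ℂ)) *
        s.prod fun i n => c i ^ n
    else 0
  have h2 : ∀ n ∈ Finset.range N,
      ((n : ℂ)⁻¹ • (∑ i ∈ D, c i • θ.E (i : WithZero (Γ × A))) ^ n : FormalSeries (Γ × A)) m =
      θ.degSign m * ∑ s ∈ D.finsuppAntidiag n, F s := by
    intro n _
    rw [Finset.sum_pow_eq_sum_finsuppAntidiag, FormalSeries.smul_apply, FormalSeries.sum_apply,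
      Finset.mul_sum, Finset.mul_sum]
    refine Finset.sum_congr rfl fun s hs => ?_
    rw [Finset.mem_finsuppAntidiag] at hs
    have hdeg : s.degree = n := by
      rw [← hs.1, Finsupp.degree_apply]
      exact Finset.sum_subset hs.2 fun i _ hi => Finsupp.notMem_support_iff.1 hi
    have hsum : (s.sum fun i n => n • (i : WithZero (Γ × A))) =
        ∑ i ∈ D, s i • (i : WithZero (Γ × A)) :=
      Finsupp.sum_of_support_subset s hs.2 _ fun _ _ => zero_nsmul _
    have hprod : (s.prod fun i n => c i ^ n) = ∏ i ∈ D, c i ^ s i :=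
      Finsupp.prod_of_support_subset s hs.2 _ fun _ _ => pow_zero _
    rw [prod_smul_E_pow, FormalSeries.smul_apply, FormalSeries.smul_apply, E_apply, ← hsum,
      ← hprod]
    simp only [F]
    by_cases hsm : (s.sum fun i n => n • (i : WithZero (Γ × A))) = m
    -- The empty partition has sum zero, which is not `j`; so 1/n times n!/s! is (n - 1)!/s! without
    -- degenerate case.
    · have hn : n ≠ 0 := by
        rintro rfl
        have : s = 0 := (Finsupp.degree_eq_zero_iff s).1 hdeg
        subst this
        exact WithZero.coe_ne_zero (hm.symm.trans hsm.symm)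
      rw [if_pos hsm, if_pos hsm.symm, hsm, hdeg, ← Nat.mul_factorial_pred hn]
      have : (n : ℂ) ≠ 0 := by exact_mod_cast hn
      push_cast
      field_simp
    · rw [if_neg hsm, if_neg (Ne.symm hsm)]
      ring
  rw [h1, FormalSeries.sum_apply, Finset.sum_congr rfl h2, ← Finset.mul_sum,
    ← Finset.sum_biUnion]
  · congr 1
    have hF : ∑ s ∈ T, ((s.degree - 1).factorial : ℂ) / (s.prod fun _ n => (n.factorial : ℂ)) *
        (s.prod fun i n => c i ^ n) = ∑ s ∈ T, F s :=
      Finset.sum_congr rfl fun s hs => by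
        simp only [F]
        rw [if_pos ((hT s).1 hs).2]
    rw [hF]
    symm
    refine Finset.sum_subset ?_ ?_
    · intro s hs
      have hsum := ((hT s).1 hs).2
      rw [← Finsupp.multisetSum_toMultiset] at hsum
      have hcard := FormalSeries.card_lt_lengthBound hsum
      rw [Finset.mem_biUnion]
      have hsub : s.support ⊆ D := by
        intro i hi
        have hi' : i ∈ Finsupp.toMultiset s := by
          rwa [Finsupp.mem_toMultiset]
        obtain ⟨t, ht⟩ := Multiset.exists_cons_of_mem hi'
        refine FormalSeries.mem_summands.2 ⟨FormalSeries.multisetSum t, ?_⟩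
        rw [← hsum, ht]
        simp [FormalSeries.multisetSum]
      refine ⟨Multiset.card (Finsupp.toMultiset s), Finset.mem_range.2 hcard, ?_⟩
      rw [Finset.mem_finsuppAntidiag, Finsupp.card_toMultiset]
      exact ⟨(Finsupp.sum_of_support_subset s hsub (fun _ => id) fun _ _ => rfl).symm, hsub⟩
    · intro s _ hs
      simp only [F]
      split_ifs with h
      -- The multinomial expansion also contains partitions with parts outside the support of `c`;
      -- their products vanish.
      · have : ∃ i ∈ s.support, c i = 0 := by
          by_contra hne
          push Not at hne
          exact hs ((hT s).2 ⟨hne, h⟩)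
        obtain ⟨i, hi, hci⟩ := this
        have hzero : (s.prod fun i n => c i ^ n) = 0 :=
          Finset.prod_eq_zero hi (by
            change c i ^ s i = 0
            rw [hci, zero_pow (Finsupp.mem_support_iff.1 hi)])
        rw [hzero, mul_zero]
      · rfl
  · intro n _ n' _ hne
    refine Finset.disjoint_left.2 fun s hs hs' => hne ?_
    rw [Finset.mem_finsuppAntidiag] at hs hs'
    exact hs.1.symm.trans hs'.1

end ColoringMap

namespace GradedColorLie

variable {Γ A : Type*} [AddCommSemigroup Γ] [AddCommGroup A] [FinitelyManySums (Γ × A)]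

theorem mem_divisorSet {i : Γ × A} {p : ℕ × (Γ × A)} :
    p ∈ (divisorSet_finite i).toFinset ↔
      0 < p.1 ∧ p.1 • (p.2 : WithZero (Γ × A)) = (i : WithZero (Γ × A)) := by
  rw [Set.Finite.mem_toFinset]
  rfl

/-- Möbius inversion over the divisors of an element of `Γ × A`. -/
theorem moebius_inversion (f : ℕ → Γ × A → ℂ) (i : Γ × A) :
    ∑ p ∈ (divisorSet_finite i).toFinset, (1 / (p.1 : ℂ)) * (ArithmeticFunction.moebius p.1 : ℂ) *
      ∑ q ∈ (divisorSet_finite p.2).toFinset, (q.1 : ℂ)⁻¹ * f (p.1 * q.1) q.2 = f 1 i := by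
  classical
  have h1 : ∑ p ∈ (divisorSet_finite i).toFinset,
      (1 / (p.1 : ℂ)) * (ArithmeticFunction.moebius p.1 : ℂ) *
        ∑ q ∈ (divisorSet_finite p.2).toFinset, (q.1 : ℂ)⁻¹ * f (p.1 * q.1) q.2 =
      ∑ r ∈ (divisorSet_finite i).toFinset, ∑ d ∈ r.1.divisors,
        (ArithmeticFunction.moebius d : ℂ) * ((r.1 : ℂ)⁻¹ * f r.1 r.2) := by
    simp only [Finset.mul_sum]
    rw [Finset.sum_sigma', Finset.sum_sigma']
    -- Regroup the pairs `(d, k)`, `(n, l)` with d k = i and n l = k by `(d n, l)`, keeping the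
    -- divisor `d` of d n.
    refine Finset.sum_bij (fun x _ => ⟨(x.1.1 * x.2.1, x.2.2), x.1.1⟩) ?_ ?_ ?_ ?_
    · rintro ⟨⟨d, k⟩, ⟨n, l⟩⟩ hx
      simp only [Finset.mem_sigma, mem_divisorSet, Nat.mem_divisors] at hx ⊢
      obtain ⟨⟨hd, hk⟩, hn, hl⟩ := hx
      exact ⟨⟨Nat.mul_pos hd hn, by rw [mul_smul, hl, hk]⟩, dvd_mul_right _ _,
        (Nat.mul_pos hd hn).ne'⟩
    · rintro ⟨⟨d, k⟩, ⟨n, l⟩⟩ hx ⟨⟨d', k'⟩, ⟨n', l'⟩⟩ hx' h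
      simp only [Finset.mem_sigma, mem_divisorSet] at hx hx'
      simp only [Sigma.mk.injEq, Prod.mk.injEq, heq_eq_eq] at h
      obtain ⟨⟨h1, rfl⟩, rfl⟩ := h
      obtain rfl := Nat.eq_of_mul_eq_mul_left hx.1.1 h1
      -- The middle element `k` is recovered as n l, so no division by d is needed in the semigroup.
      obtain rfl := WithZero.coe_injective (hx.2.2.symm.trans hx'.2.2)
      rfl
    · rintro ⟨⟨r, l⟩, d⟩ hx
      simp only [Finset.mem_sigma, mem_divisorSet, Nat.mem_divisors] at hx
      obtain ⟨⟨hr, hl⟩, ⟨n, rfl⟩, _⟩ := hx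
      have hd : 0 < d := Nat.pos_of_mul_pos_right hr
      have hn : 0 < n := Nat.pos_of_mul_pos_left hr
      have hk : ∃ k : Γ × A, n • (l : WithZero (Γ × A)) = (k : WithZero (Γ × A)) := by
        cases h : n • (l : WithZero (Γ × A)) with
        | zero =>
          rw [mul_smul, h, smul_zero] at hl
          exact absurd hl.symm WithZero.coe_ne_zero
        | coe k => exact ⟨k, rfl⟩
      obtain ⟨k, hk⟩ := hk
      refine ⟨⟨(d, k), (n, l)⟩, ?_, rfl⟩
      simp only [Finset.mem_sigma, mem_divisorSet]
      exact ⟨⟨hd, by rw [← hk, ← mul_smul, hl]⟩, hn, hk⟩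
    · rintro ⟨⟨d, k⟩, ⟨n, l⟩⟩ _
      push_cast
      rw [mul_inv]
      ring
  rw [h1]
  have h2 : ∀ r ∈ (divisorSet_finite i).toFinset, ∑ d ∈ r.1.divisors,
      (ArithmeticFunction.moebius d : ℂ) * ((r.1 : ℂ)⁻¹ * f r.1 r.2) =
      if r = (1, i) then f 1 i else 0 := by
    rintro ⟨n, l⟩ hr
    rw [mem_divisorSet] at hr
    rw [← Finset.sum_mul, ← Int.cast_sum, ArithmeticFunction.sum_divisors_moebius]
    by_cases hn : n = 1
    · subst hn
      have : l = i := WithZero.coe_injective (by simpa using hr.2)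
      simp [this]
    · simp [hn]
  -- The sum of μ over the divisors of r vanishes unless r = 1, which leaves the pair `(1, i)`.
  rw [Finset.sum_congr rfl h2, Finset.sum_ite_eq', if_pos]
  rw [mem_divisorSet]
  exact ⟨one_pos, one_smul _ _⟩

end GradedColorLie

/-! ### Denominator identity and supertrace formula -/

namespace GradedColorLie

variable {Γ A L G : Type*} [AddCommSemigroup Γ] [AddCommGroup A] {θ : ColoringMap A}
  [AddCommGroup L] [Module ℂ L] {𝔏 : GradedColorLie Γ θ L} [Group G]

theorem TriangularBasis.trace_onChain_zero [FinitelyManySums (Γ × A)] {ρ : 𝔏.Action G} {g : G} {J : Type*} [LinearOrder J]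
    (b : TriangularBasis ρ g J) (m : WithZero (Γ × A)) :
    LinearMap.trace ℂ _ (ρ.onChain g 0 m) = (1 : FormalSeries (Γ × A)) m := by
  classical
  let := (b.finite_chainIndex b.finite_fiber 0 m).fintype
  rw [b.trace_onChain, FormalSeries.one_apply]
  have hs : ∀ s : b.chainIndex 0 m, s.1 = 0 := fun s => Multiset.card_eq_zero.1 s.2.1
  split_ifs with hm
  · have h0 : (0 : Multiset J) ∈ b.chainIndex 0 m :=
      ⟨rfl, hm.symm, fun j t ht => absurd ht.symm Multiset.cons_ne_zero⟩
    rw [Fintype.sum_eq_single ⟨0, h0⟩ fun s hne => absurd (Subtype.ext (hs s)) hne]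
    simp
  · refine Fintype.sum_eq_zero _ fun s => absurd ?_ hm
    have := s.2.2.1
    rw [hs s] at this
    exact this.symm

namespace Action

variable (ρ : 𝔏.Action G) (g : G)

/-- The sign ψ enters both the supertrace and E^m and cancels, since ψ² = 1. -/
theorem schChain_apply (k : ℕ) (m : WithZero (Γ × A)) :
    ρ.schChain g k m = LinearMap.trace ℂ _ (ρ.onChain g k m) := by
  rw [schChain, θ.formalSum_smul_E_apply, strChain, mul_right_comm, θ.degSign_mul_self, one_mul]

theorem schHomology_apply (k : ℕ) (m : WithZero (Γ × A)) :
    ρ.schHomology g k m = LinearMap.trace ℂ _ (ρ.onHomology g k m) := by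
  rw [schHomology, θ.formalSum_smul_E_apply, strHomology, mul_right_comm, θ.degSign_mul_self,
    one_mul]

theorem schH_apply (m : WithZero (Γ × A)) : ρ.schH g m = ρ.strH g m * θ.degSign m :=
  θ.formalSum_smul_E_apply _ m

theorem formalSum_schChain (hfin : ∀ k m, FiniteDimensional ℂ (𝔏.chain k m))
    (hbot : ∀ m, {k | 𝔏.chain k m ≠ ⊥}.Finite) :
    FormalSeries.formalSum (fun k : ℕ => (-1 : ℂ) ^ k • ρ.schChain g k) =
      FormalSeries.formalSum (fun k : ℕ => (-1 : ℂ) ^ k • ρ.schHomology g k) := by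
  ext m
  simp only [FormalSeries.formalSum_apply, FormalSeries.smul_apply, schChain_apply,
    schHomology_apply]
  exact ρ.finsum_trace_onChain g (fun k => hfin k m) (hbot m)

theorem schH_apply_eq_finsum (m : WithZero (Γ × A)) :
    ρ.schH g m = ∑ᶠ k : ℕ, (-1 : ℂ) ^ k * LinearMap.trace ℂ _ (ρ.onHomology g (k + 1) m) := by
  rw [schH_apply, strH, finsum_mul]
  refine finsum_congr fun k => ?_
  rw [strHomology]
  linear_combination (-1 : ℂ) ^ k * LinearMap.trace ℂ _ (ρ.onHomology g (k + 1) m) *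
    θ.degSign_mul_self m

variable {ρ g} [FinitelyManySums (Γ × A)]

/-- The 1 is the contribution of H_0 = C_0, and the shift k ↦ k + 1 accounts for the minus sign. -/
theorem one_sub_schH_apply {J : Type*} [LinearOrder J] (b : TriangularBasis ρ g J)
    (m : WithZero (Γ × A)) : (1 - ρ.schH g) m =
      ∑ᶠ k : ℕ, (-1 : ℂ) ^ k * LinearMap.trace ℂ _ (ρ.onHomology g k m) := by
  have := b.finiteDimensional_chain b.finite_fiber 0 m
  obtain ⟨K, hK⟩ := (b.finite_chain_ne_bot b.finite_fiber m).bddAbove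
  rw [finsum_eq_zero_add_finsum_succ (K := K + 1), FormalSeries.sub_apply, schH_apply_eq_finsum,
    trace_onHomology_zero, b.trace_onChain_zero, pow_zero, one_mul, sub_eq_add_neg,
    ← finsum_neg_distrib]
  · simp only [pow_succ, mul_neg_one, neg_mul]
  · intro k hk
    have : 𝔏.chain k m = ⊥ := by
      by_contra h
      have := hK h
      omega
    rw [trace_onHomology_eq_zero ρ g this, mul_zero]

theorem hasFormalProd {J : Type*} [LinearOrder J] (b : TriangularBasis ρ g J) :
    FormalSeries.HasFormalProd
      (fun i : Γ × A => FormalSeries.exp (-ρ.logFactor g i)) (1 - ρ.schH g) := by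
  intro m
  rw [one_sub_schH_apply b, ← ρ.finsum_trace_onChain g
    (fun k => b.finiteDimensional_chain b.finite_fiber k m)
    (b.finite_chain_ne_bot b.finite_fiber m), ← b.admSeries_univ_apply]
  exact b.eventually_prod_exp_neg_logFactor m

variable (ρ g)

open scoped Classical in
theorem logFactor_apply (i : Γ × A) (m : WithZero (Γ × A)) :
    ρ.logFactor g i m = ∑ᶠ n : ℕ, if n • (i : WithZero (Γ × A)) = m then
      (n : ℂ)⁻¹ * ρ.str (g ^ n) i * θ.degSign m else 0 := by
  rw [TriangularBasis.logFactor_eq_ev, FormalSeries.ev, FormalSeries.formalSum_apply]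
  refine finsum_congr fun n => ?_
  rw [PowerSeries.coeff_mk, FormalSeries.e_pow, FormalSeries.smul_apply, FormalSeries.e_apply]
  by_cases h : n • (i : WithZero (Γ × A)) = m
  · rw [if_pos h.symm, if_pos h, mul_one, ← h, θ.degSign_nsmul, θ.degSign_coe]
  · rw [if_neg (Ne.symm h), if_neg h, mul_zero]

/-- The sum `∑_i ∑_r (1/r) str(g^r | L_i) E^(r i)`. -/
def logSeries : FormalSeries (Γ × A) :=
  FormalSeries.formalSum fun i : Γ × A => ρ.logFactor g i

theorem logFactor_apply_eq_zero {p q m : WithZero (Γ × A)} (h : p + q = m) {i : Γ × A}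
    (hi : i ∉ FormalSeries.summands m) : ρ.logFactor g i p = 0 := by
  classical
  rw [logFactor_apply, finsum_eq_zero_of_forall_eq_zero]
  intro n
  split_ifs with hn
  · by_cases h0 : n = 0
    · simp [h0]
    · exact absurd (FormalSeries.mem_summands_of_nsmul h h0 hn) hi
  · rfl

theorem mk_logSeries {m : WithZero (Γ × A)} {s : Finset (Γ × A)}
    (hs : FormalSeries.summands m ⊆ s) :
    Ideal.Quotient.mk (FormalSeries.vanishIdeal m) (ρ.logSeries g) =
      Ideal.Quotient.mk (FormalSeries.vanishIdeal m) (∑ i ∈ s, ρ.logFactor g i) := by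
  rw [Ideal.Quotient.eq]
  intro p q h
  rw [FormalSeries.sub_apply, FormalSeries.sum_apply, logSeries, FormalSeries.formalSum_apply,
    finsum_eq_sum_of_support_subset, sub_self]
  intro i hi
  by_contra hne
  exact hi (ρ.logFactor_apply_eq_zero g h fun h' => hne (hs h'))

theorem logSeries_apply_zero : ρ.logSeries g 0 = 0 := by
  rw [logSeries, FormalSeries.formalSum_apply]
  exact finsum_eq_zero_of_forall_eq_zero fun i => TriangularBasis.logFactor_apply_zero i

theorem exp_neg_logSeries (h : FormalSeries.HasFormalProd
      (fun i : Γ × A => FormalSeries.exp (-ρ.logFactor g i)) (1 - ρ.schH g)) :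
    FormalSeries.exp (-ρ.logSeries g) = 1 - ρ.schH g := by
  classical
  have hneg : ∀ f : FormalSeries (Γ × A), f 0 = 0 → (-f) 0 = 0 := fun f hf => by
    rw [FormalSeries.neg_apply, hf, neg_zero]
  ext m
  obtain ⟨s₀, hs₀⟩ := Filter.eventually_atTop.1 (h m)
  -- On an index set that also contains all summands of `m`, the partial product is already constant
  -- and its logarithm agrees with `logSeries` modulo `vanishIdeal m`.
  rw [← hs₀ (s₀ ∪ FormalSeries.summands m) Finset.subset_union_left, ← FormalSeries.exp_sum]
  · refine FormalSeries.apply_eq_of_mk_eq (FormalSeries.mk_exp_congr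
      (hneg _ (ρ.logSeries_apply_zero g)) ?_ ?_)
    · rw [FormalSeries.sum_apply]
      exact Finset.sum_eq_zero fun i _ => hneg _ (TriangularBasis.logFactor_apply_zero i)
    · rw [Finset.sum_neg_distrib, map_neg, map_neg,
        ρ.mk_logSeries g (Finset.subset_union_right (s₁ := s₀))]
  · exact fun i _ => hneg _ (TriangularBasis.logFactor_apply_zero i)

theorem logSeries_apply (j : Γ × A) :
    ρ.logSeries g (j : WithZero (Γ × A)) = θ.degSign (j : WithZero (Γ × A)) *
      ∑ p ∈ (divisorSet_finite j).toFinset, (p.1 : ℂ)⁻¹ * ρ.str (g ^ p.1) p.2 := by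
  classical
  let F : (Γ × A) × ℕ → ℂ := fun x => if x.2 • (x.1 : WithZero (Γ × A)) = j then
      (x.2 : ℂ)⁻¹ * ρ.str (g ^ x.2) x.1 * θ.degSign (j : WithZero (Γ × A)) else 0
  have hsupp : Function.support (fun p : ℕ × (Γ × A) => F p.swap) ⊆
      (divisorSet_finite j).toFinset := by
    rintro ⟨n, i⟩ hp
    rw [Finset.mem_coe, mem_divisorSet]
    by_contra hne
    refine hp ?_
    simp only [F, Prod.swap]
    split_ifs with h
    · rcases Nat.eq_zero_or_pos n with rfl | hn
      · simp
      · exact absurd ⟨hn, h⟩ hne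
    · rfl
  have hfin : (Function.support F).Finite := by
    refine Set.Finite.of_preimage (f := Prod.swap) ?_ Prod.swap_surjective
    exact (Finset.finite_toSet _).subset hsupp
  rw [logSeries, FormalSeries.formalSum_apply, finsum_congr fun i => ρ.logFactor_apply g i j]
  -- The iterated sum over `i` and `n` becomes one finite sum over pairs with n i = j; pairs with n
  -- = 0 drop out because `(0 : ℂ)⁻¹ = 0`.
  refine (finsum_curry F hfin).symm.trans ?_
  rw [← finsum_comp_equiv (Equiv.prodComm ℕ (Γ × A))]
  refine (finsum_eq_sum_of_support_subset _ hsupp).trans ?_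
  rw [Finset.mul_sum]
  refine Finset.sum_congr rfl fun p hp => ?_
  simp only [F, Prod.swap]
  rw [if_pos (mem_divisorSet.1 hp).2, mul_comm]

/-- Both -`logSeries` and log(1 - sch_g H) exponentiate to the same series, so they agree by
injectivity of `exp`. Comparing coefficients at `j` and cancelling the sign gives the equality. -/
theorem witt_eq (h : FormalSeries.HasFormalProd
      (fun i : Γ × A => FormalSeries.exp (-ρ.logFactor g i)) (1 - ρ.schH g)) (j : Γ × A) :
    ρ.witt g j = ∑ p ∈ (divisorSet_finite j).toFinset, (p.1 : ℂ)⁻¹ * ρ.str (g ^ p.1) p.2 := by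
  have h1 := ρ.exp_neg_logSeries g h
  have hL : (-ρ.logSeries g) 0 = 0 := by
    rw [FormalSeries.neg_apply, logSeries_apply_zero, neg_zero]
  -- An exponential has constant term 1, so the denominator identity itself forces this.
  have hH : ρ.schH g 0 = 0 := by
    classical
    have := congrFun h1 0
    rw [FormalSeries.exp_apply_zero hL, FormalSeries.sub_apply, FormalSeries.one_apply,
      if_pos rfl] at this
    linear_combination this
  have hN := FormalSeries.negLog_apply_zero hH
  have h2 : ρ.logSeries g = FormalSeries.negLog (ρ.schH g) := by
    refine neg_injective (FormalSeries.exp_injective hL ?_ ?_)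
    · rw [FormalSeries.neg_apply, hN, neg_zero]
    · rw [h1, FormalSeries.exp_neg_negLog hH]
  have h3 := congrFun h2 (j : WithZero (Γ × A))
  rw [logSeries_apply, θ.negLog_apply (ρ.schH g) hH (fun i => ρ.strH g i)
    (fun i => ρ.schH_apply g i) j (ρ.partitionSet_finite g j).toFinset
    (fun s => Set.Finite.mem_toFinset _)] at h3
  have hne : θ.degSign (j : WithZero (Γ × A)) ≠ 0 :=
    left_ne_zero_of_mul_eq_one (θ.degSign_mul_self _)
  exact (mul_left_cancel₀ hne h3).symm

end Action

end GradedColorLie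

end

theorem theorem2p3 {Γ A L G : Type*} [AddCommSemigroup Γ] [Countable Γ] [AddCommGroup A]
    [Countable A] [FinitelyManySums (Γ × A)] (θ : ColoringMap A) [AddCommGroup L] [Module ℂ L]
    (𝔏 : GradedColorLie Γ θ L) (hfin : ∀ i, FiniteDimensional ℂ (𝔏.piece i))
    [Group G] (ρ : 𝔏.Action G) :
    -- the spaces `C_k(L)_m` are finite-dimensional, and for fixed `m` almost all of them vanish
    ((∀ k m, FiniteDimensional ℂ (𝔏.chain k m)) ∧ ∀ m, {k | 𝔏.chain k m ≠ ⊥}.Finite) ∧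
    -- the Euler-Poincaré principle for the standard complex
    (∀ g : G, FormalSeries.formalSum (fun k : ℕ => (-1 : ℂ) ^ k • ρ.schChain g k) =
      FormalSeries.formalSum (fun k : ℕ => (-1 : ℂ) ^ k • ρ.schHomology g k)) ∧
    -- the generalized denominator identity
    (∀ g : G, FormalSeries.HasFormalProd
      (fun i : Γ × A => FormalSeries.exp (-ρ.logFactor g i)) (1 - ρ.schH g)) ∧
    -- the supertrace formula
    (∀ (g : G) (i : Γ × A), ρ.str g i =
      ∑ p ∈ (GradedColorLie.divisorSet_finite i).toFinset,
        (1 / (p.1 : ℂ)) * (ArithmeticFunction.moebius p.1 : ℂ) * ρ.witt (g ^ p.1) p.2) := by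
  -- The model of the θ-exterior algebra needs some linear order on the basis; any one will do.
  have hlin : ∀ J : Type _, Nonempty (LinearOrder J) := fun J =>
    ⟨by classical exact linearOrderOfSTO (WellOrderingRel (α := J))⟩
  have hprod : ∀ g : G, FormalSeries.HasFormalProd
      (fun i : Γ × A => FormalSeries.exp (-ρ.logFactor g i)) (1 - ρ.schH g) := fun g => by
    obtain ⟨ι, ⟨b⟩⟩ := GradedColorLie.exists_triangularBasis hfin ρ g
    obtain ⟨_⟩ := hlin (Σ i, ι i)
    exact GradedColorLie.Action.hasFormalProd b
  -- Finiteness does not involve the group element, so a triangular basis for 1 suffices.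
  obtain ⟨ι, ⟨b⟩⟩ := GradedColorLie.exists_triangularBasis hfin ρ 1
  have hdim := b.finiteDimensional_chain b.finite_fiber
  have hbot := b.finite_chain_ne_bot b.finite_fiber
  refine ⟨⟨hdim, hbot⟩, fun g => ρ.formalSum_schChain g hdim hbot, hprod, fun g i => ?_⟩
  -- The Witt function at g^d involves the supertraces of (g^d)^n = g^(d n), so the inverted
  -- function must depend on the exponent as well as on the degree.
  have h := GradedColorLie.moebius_inversion (fun n j => ρ.str (g ^ n) j) i
  rw [pow_one] at h
  rw [← h]
  refine Finset.sum_congr rfl fun p _ => ?_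
  rw [ρ.witt_eq (g ^ p.1) (hprod _)]
  simp only [pow_mul]
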